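/- **Setting.** Let $B$ be a quaternion algebra over $\mathbb{Q}$, with reduced discriminant $d_B$ (the product of the primes at which $B$ ramifies), reduced trace $\mathrm{tr}$ and canonical involution $x\mapsto\bar x$. Let $R\subset B$ be an Eichler order (an intersection of two maximal orders) of squarefree level $N$; here $N$ is the natural number coprime to $d_B$ such that for every prime $p\nmid d_B$ some isomorphism $B\otimes\mathbb{Q}_p\cong \mathrm{Mat}_{2\times2}(\mathbb{Q}_p)$ maps $R\otimes\mathbb{Z}_p$ onto $\begin{pmatrix}\mathbb{Z}_p&\mathbb{Z}_p\\ N\mathbb{Z}_p&\mathbb{Z}_p\end{pmatrix}$. For $\ell\mid d_BN$ let $R(\ell)\subset B$ be the lattice with local component at $p$ equal to the dual lattice $R_p^\vee$ of $R_p$ for the form $\langle x,y\rangle=\mathrm{tr}(x\bar y)$ if $p\mid\ell$, and to $R_p$ if $p\nmid \ell$. A superscript $0$ denotes the elements of reduced trace $0$. Let $B_\infty=B\otimes\mathbb{R}$ and let $\mathbf i,\mathbf j,\mathbf k\in B_\infty$ satisfy $\mathbf i^2=-1$, $\mathbf j^2=\pm1$ ($+1$ if $B$ is indefinite, $-1$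 if $B$ is definite), $\mathbf k=\mathbf i\mathbf j=-\mathbf j\mathbf i$. Write $[a,b,c]+d=a\mathbf i+b\mathbf j+c\mathbf k+d$ for $a,b,c,d\in\mathbb{R}$. For $T>0$ and $0<\delta\le1$ put $$\Omega(\delta,T)=\{[a,b,c]+d:\ a^2+b^2+c^2+d^2\le T^2,\ b^2+c^2\le\delta T^2\},$$ $$\Psi(\delta,T)=\{[a,b,c]+d:\ a^2+b^2+c^2+d^2\le T^2,\ a^2+d^2\le\delta T^2\}.$$ Let $G(\mathbb{R})=B_\infty^\times/\mathbb{R}^\times$, acting on $B_\infty$ by conjugation. If $B$ is split, we take $B=\mathrm{Mat}_{2\times2}(\mathbb{Q})$ (so $d_B=1$), $R=\begin{pmatrix}\mathbb{Z}&\mathbb{Z}\\N\mathbb{Z}&\mathbb{Z}\end{pmatrix}$ and $[a,b,c]+d=\begin{pmatrix}d+c&b+a\\b-a&d-c\end{pmatrix}$, and for $g\in G(\mathbb{R})=\mathrm{PGL}_2(\mathbb{R})$ we set $H(g)=\max_{\gamma\in A_0(N)}\mathrm{Im}(\gamma g\cdot i)$, where $A_0(N)$ is the group generated by $\Gamma_0(N)$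 and all Atkin–Lehner operators, and $g$ with $\det g<0$ acts on the upper half-plane by $z\mapsto (a\bar z+b)/(c\bar z+d)$. The first successive minimum of a lattice $L$ in a real vector space $V$ with respect to a compact convex $0$-symmetric set $\mathcal{K}\subset V$ with nonempty interior is the smallest $\lambda>0$ for which there is a nonzero $v\in L$ with $\inf\{t>0: v\in t\mathcal{K}\}\le\lambda$. **Theorem (Type I estimates).** There is an absolute constant $\kappa>0$, and for every $\varepsilon>0$ a constant $C_\varepsilon>0$ depending only on $\varepsilon$, such that the following hold for all $B$, $R$, $\mathbf i,\mathbf j$, $N$, $\ell$, $g$, $\delta$, $T$ as above. (a) If $B$ is split, the first successive minimum of $g^{-1}R(\ell)^0g$ with respect to $\Omega(\delta,1)\cap B_\infty^0$ is at least $\kappa\min\{\ell^{-1/2},\ \ell^{-1}\delta^{-1/2}H(g)^{-1}\}$, and $g^{-1}R(\ell)^0g\cap\Omega(\delta,T)$ is finite with $$|g^{-1}R(\ell)^0g\cap\Omega(\delta,T)|\le C_\varepsilon (N(1+T))^{\varepsilon}\Big(1+\big(\ell^{1/2}+\ell\delta^{1/2}H(g)\big)T+\Big(\frac{\ell^{3/2}\delta^{1/2}}{N^{1/2}}+\ell\delta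 H(g)\Big)T^2+\frac{\ell^2\delta}{N}T^3\Big).$$ (b) If $B$ is non-split, the first successive minima of $g^{-1}R(\ell)^0g$ with respect to $\Omega(\delta,1)\cap B_\infty^0$ and with respect to $\Psi(\delta,1)\cap B_\infty^0$ are both at least $\kappa\,\ell^{-1/2}$, and the two sets below are finite with $$|g^{-1}R(\ell)^0g\cap\Omega(\delta,T)|\le C_\varepsilon (d_BN(1+T))^{\varepsilon}\Big(1+\ell^{1/2}T+\frac{\ell^{3/2}\delta^{1/2}}{(d_BN)^{1/2}}T^2+\frac{\ell^2\delta}{d_BN}T^3\Big),$$ $$|g^{-1}R(\ell)^0g\cap\Psi(\delta,T)|\le C_\varepsilon (d_BN(1+T))^{\varepsilon}\Big(1+\ell^{1/2}T+\frac{\ell^{3/2}}{(d_BN)^{1/2}}T^2+\frac{\ell^2\delta^{1/2}}{d_BN}T^3\Big).$$ -/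

import Mathlib

open scoped TensorProduct Pointwise MatrixGroups

noncomputable section

namespace QuatLattice

/-! ### Quaternion algebras: reduced trace, ramification, orders -/

/-- The reduced trace of a quaternion algebra `A` over a field `K` of characteristic zero:
half of the trace of left multiplication on the four-dimensional space `A`. -/
def redTrace (K A : Type*) [Field K] [Ring A] [Algebra K A] (x : A) : K :=
  (1 / 2 : K) * LinearMap.trace K A (LinearMap.mulLeft K x)

/-- The standard involution `x ↦ tr(x) - x` of a quaternion algebra. -/
def stdConj (K A : Type*) [Field K] [Ring A] [Algebra K A] (x : A) : A :=
  algebraMap K A (redTrace K A x) - x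

/-- `B` is ramified at the prime `p`: the completion `B ⊗ ℚ_p` is not a matrix algebra. -/
def IsRamifiedAt (B : Type*) [Ring B] [Algebra ℚ B] (p : ℕ) [Fact p.Prime] : Prop :=
  IsEmpty ((ℚ_[p] ⊗[ℚ] B) ≃ₐ[ℚ_[p]] Matrix (Fin 2) (Fin 2) ℚ_[p])

/-- The set of primes at which `B` ramifies. -/
def ramifiedPrimes (B : Type*) [Ring B] [Algebra ℚ B] : Set ℕ :=
  {p | ∃ hp : p.Prime, @IsRamifiedAt B _ _ p ⟨hp⟩}

/-- The reduced discriminant `d_B`: the product of the primes at which `B` ramifies. -/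
def redDisc (B : Type*) [Ring B] [Algebra ℚ B] : ℕ :=
  ∏ᶠ p ∈ ramifiedPrimes B, p

/-- An order in `B`: a subring which is a `ℤ`-lattice of full rank. -/
def IsOrder {B : Type*} [Ring B] [Algebra ℚ B] (R : Subring B) : Prop :=
  R.toAddSubgroup.FG ∧ Submodule.span ℚ (R : Set B) = ⊤

/-- A maximal order in `B`. -/
def IsMaximalOrder {B : Type*} [Ring B] [Algebra ℚ B] (R : Subring B) : Prop :=
  Maximal IsOrder R

/-- The completion `R_p = R ⊗ ℤ_p`, as a `ℤ_p`-submodule of `B ⊗ ℚ_p`. -/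
def completionAt {B : Type*} [Ring B] [Algebra ℚ B] (R : Subring B) (p : ℕ) [Fact p.Prime] :
    Submodule ℤ_[p] (ℚ_[p] ⊗[ℚ] B) :=
  Submodule.span ℤ_[p] ((fun x : B => (1 : ℚ_[p]) ⊗ₜ[ℚ] x) '' (R : Set B))

/-- The matrices over `ℚ_p` with entries in `ℤ_p` and lower left entry in `N ℤ_p`. -/
def localStdOrder (N p : ℕ) [Fact p.Prime] : Set (Matrix (Fin 2) (Fin 2) ℚ_[p]) :=
  {M | (∀ i j, ‖M i j‖ ≤ 1) ∧ ‖M 1 0‖ ≤ ‖(N : ℚ_[p])‖}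

/-- `R` is an Eichler order of level `N` in `B`: it is an intersection of two maximal orders, and
`N` is the natural number coprime to `d_B` such that, for every prime `p` not dividing `d_B`, some
isomorphism of `B ⊗ ℚ_p` with the matrix algebra takes `R_p` to the standard order of level `N`. -/
structure IsEichlerOrder {B : Type*} [Ring B] [Algebra ℚ B] (R : Subring B) (N : ℕ) : Prop where
  eq_inf : ∃ O₁ O₂ : Subring B, IsMaximalOrder O₁ ∧ IsMaximalOrder O₂ ∧ R = O₁ ⊓ O₂
  coprime : Nat.Coprime N (redDisc B)
  level : ∀ (p : ℕ) [Fact p.Prime], ¬ p ∣ redDisc B →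
    ∃ φ : (ℚ_[p] ⊗[ℚ] B) ≃ₐ[ℚ_[p]] Matrix (Fin 2) (Fin 2) ℚ_[p],
      φ '' (completionAt R p : Set (ℚ_[p] ⊗[ℚ] B)) = localStdOrder N p

/-- The standard Eichler order of level `N` in the algebra of rational `2 × 2` matrices: integral
matrices whose lower left entry is divisible by `N`. -/
def stdOrder (N : ℕ) : Subring (Matrix (Fin 2) (Fin 2) ℚ) where
  carrier := {M | ∃ a b c d : ℤ, M = !![(a : ℚ), (b : ℚ); (N : ℚ) * (c : ℚ), (d : ℚ)]}
  mul_mem' := by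
    rintro _ _ ⟨a, b, c, d, rfl⟩ ⟨a', b', c', d', rfl⟩
    refine ⟨a * a' + b * N * c', a * b' + b * d', c * a' + d * c', N * c * b' + d * d', ?_⟩
    ext i j
    fin_cases i <;> fin_cases j <;> (simp [Matrix.mul_apply, Fin.sum_univ_two]; try ring)
  one_mem' := ⟨1, 0, 0, 1, by ext i j; fin_cases i <;> fin_cases j <;> simp⟩
  add_mem' := by
    rintro _ _ ⟨a, b, c, d, rfl⟩ ⟨a', b', c', d', rfl⟩
    refine ⟨a + a', b + b', c + c', d + d', ?_⟩
    ext i j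
    fin_cases i <;> fin_cases j <;> simp <;> ring
  zero_mem' := ⟨0, 0, 0, 0, by ext i j; fin_cases i <;> fin_cases j <;> simp⟩
  neg_mem' := by
    rintro _ ⟨a, b, c, d, rfl⟩
    refine ⟨-a, -b, -c, -d, ?_⟩
    ext i j
    fin_cases i <;> fin_cases j <;> simp

/-! ### The partially dualized lattices -/

/-- The elements of `B` lying in `R_p`, i.e. in the localization of `R` at `p`. -/
def localAt {B : Type*} [Ring B] [Algebra ℚ B] (R : Subring B) (p : ℕ) : Set B :=
  {x | ∃ n : ℕ, ¬ p ∣ n ∧ n • x ∈ R}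

/-- The elements of `B` lying in the dual lattice `R_p^∨` of `R_p` with respect to the bilinear
form `⟨x, y⟩ = tr(x ȳ)` of the reduced norm: all `⟨x, y⟩`, `y ∈ R`, have denominator prime
to `p`. -/
def localDualAt {B : Type*} [Ring B] [Algebra ℚ B] (R : Subring B) (p : ℕ) : Set B :=
  {x | ∀ y ∈ R, ¬ p ∣ (redTrace ℚ B (x * stdConj ℚ B y)).den}

/-- The lattice `R(ℓ)` in `B`, whose local component at `p` is `R_p^∨` if `p ∣ ℓ`, and `R_p`
otherwise. -/
def partialDual {B : Type*} [Ring B] [Algebra ℚ B] (R : Subring B) (l : ℕ) : Set B :=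
  {x | ∀ p : ℕ, p.Prime →
    (p ∣ l → x ∈ localDualAt R p) ∧ (¬ p ∣ l → x ∈ localAt R p)}

/-- `R(ℓ)^0`: the elements of `R(ℓ)` of reduced trace zero. -/
def partialDualZero {B : Type*} [Ring B] [Algebra ℚ B] (R : Subring B) (l : ℕ) : Set B :=
  {x | x ∈ partialDual R l ∧ redTrace ℚ B x = 0}

/-- The set `g⁻¹ L g` in the real algebra `A`, where `L ⊆ B` is viewed in `A` through `ι`. -/
def conjBy {B A : Type*} [Ring A] (ι : B → A) (g : Aˣ) (L : Set B) : Set A :=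
  (fun x : B => (↑g⁻¹ : A) * ι x * (g : A)) '' L

/-! ### Archimedean regions and successive minima -/

section Regions

variable {A : Type*} [Ring A] [Algebra ℝ A] {s : ℝ}

/-- The element `[a, b, c] + d = a i + b j + c k + d`. -/
def coordElt (q : QuaternionAlgebra.Basis A (-1 : ℝ) 0 s) (a b c d : ℝ) : A :=
  a • q.i + b • q.j + c • q.k + algebraMap ℝ A d

/-- The region `Ω(δ, T)`. -/
def regionOmega (q : QuaternionAlgebra.Basis A (-1 : ℝ) 0 s) (δ T : ℝ) : Set A :=
  {x | ∃ a b c d : ℝ, x = coordElt q a b c d ∧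
    a ^ 2 + b ^ 2 + c ^ 2 + d ^ 2 ≤ T ^ 2 ∧ b ^ 2 + c ^ 2 ≤ δ * T ^ 2}

/-- The region `Ψ(δ, T)`. -/
def regionPsi (q : QuaternionAlgebra.Basis A (-1 : ℝ) 0 s) (δ T : ℝ) : Set A :=
  {x | ∃ a b c d : ℝ, x = coordElt q a b c d ∧
    a ^ 2 + b ^ 2 + c ^ 2 + d ^ 2 ≤ T ^ 2 ∧ a ^ 2 + d ^ 2 ≤ δ * T ^ 2}

variable (A) in
/-- The space of elements of reduced trace zero. -/
def traceZero : Set A := {x | redTrace ℝ A x = 0}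

/-- The `k`-th successive minimum of `𝒦` on `L`: the least `r > 0` such that `L` contains `k`
linearly independent vectors `v` with `inf {t > 0 : v ∈ t 𝒦} ≤ r`. -/
def succMin (𝒦 L : Set A) (k : ℕ) : ℝ :=
  sInf {r : ℝ | 0 < r ∧ ∃ v : Fin k → A, LinearIndependent ℝ v ∧
    ∀ m, v m ∈ L ∧ gauge 𝒦 (v m) ≤ r}

end Regions

/-! ### The split case -/

/-- The coordinates `[a, b, c] + d = !![d + c, b + a; b - a, d - c]` on real `2 × 2` matrices. -/
def splitBasis : QuaternionAlgebra.Basis (Matrix (Fin 2) (Fin 2) ℝ) (-1 : ℝ) 0 1 where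
  i := !![0, 1; -1, 0]
  j := !![0, 1; 1, 0]
  k := !![1, 0; 0, -1]
  i_mul_i := by ext i j; fin_cases i <;> fin_cases j <;> simp
  j_mul_j := by ext i j; fin_cases i <;> fin_cases j <;> simp
  i_mul_j := by ext i j; fin_cases i <;> fin_cases j <;> simp
  j_mul_i := by ext i j; fin_cases i <;> fin_cases j <;> simp

/-- The Atkin–Lehner operators for `Γ₀(N)`, for the divisors `e` of `N`, as integral matrices
`!![e a, b; N c, e d]` of determinant `e`; for `e = 1` these are the elements of `Γ₀(N)`. -/
def atkinLehner (N : ℕ) : Set (GL (Fin 2) ℝ) :=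
  {γ | ∃ (e : ℕ) (a b c d : ℤ), 0 < e ∧ e ∣ N ∧
    (e : ℤ) * a * (e * d) - b * (N * c) = e ∧
    (γ : Matrix (Fin 2) (Fin 2) ℝ) =
      !![(e : ℝ) * (a : ℝ), (b : ℝ); (N : ℝ) * (c : ℝ), (e : ℝ) * (d : ℝ)]}

/-- The group `A₀(N)` generated by `Γ₀(N)` and all Atkin–Lehner operators. -/
def atkinLehnerGroup (N : ℕ) : Subgroup (GL (Fin 2) ℝ) :=
  Subgroup.closure (atkinLehner N)

/-- The height `H(z)`: the maximum of `Im (γ z)` over `γ ∈ A₀(N)`. -/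
def heightPt (N : ℕ) (z : UpperHalfPlane) : ℝ :=
  sSup {y : ℝ | ∃ γ ∈ atkinLehnerGroup N, y = (γ • z).im}

/-- The height `H(g) = H(g · i)`. For `det g < 0` the action of `g` on the upper half-plane is
the one through `z ↦ (a z̄ + b) / (c z̄ + d)`. -/
def height (N : ℕ) (g : GL (Fin 2) ℝ) : ℝ :=
  heightPt N (g • UpperHalfPlane.I)

/-- The set `g⁻¹ R(ℓ)^0 g` for the standard Eichler order `R` of level `N`. -/
def splitLattice (N l : ℕ) (g : GL (Fin 2) ℝ) : Set (Matrix (Fin 2) (Fin 2) ℝ) :=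
  conjBy (fun M : Matrix (Fin 2) (Fin 2) ℚ => M.map (fun x : ℚ => (x : ℝ))) g
    (partialDualZero (stdOrder N) l)

/-! ### The general case -/

/-- The set `g⁻¹ R(ℓ)^0 g` in `B_∞ = ℝ ⊗ B`. -/
def realLattice {B : Type*} [Ring B] [Algebra ℚ B] (R : Subring B) (l : ℕ)
    (g : (ℝ ⊗[ℚ] B)ˣ) : Set (ℝ ⊗[ℚ] B) :=
  conjBy (fun x : B => (1 : ℝ) ⊗ₜ[ℚ] x) g (partialDualZero R l)

end QuatLattice

end

open scoped TensorProduct MatrixGroups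
open QuatLattice

/-!
The count needs no reduction theory. A set of vectors in `ℝ³` closed under differences has few
points in a cube as soon as its nonzero vectors, nondegenerate parallelograms and nondegenerate
parallelepipeds are not too small: cut the points by planes parallel to a shortest difference `v₁`
and a difference `v₂` of smallest area with `v₁`, and these by lines parallel to `v₁`
(`card_lattice_le`). In the coordinates `[a, b, c]` of trace zero elements, the cross product is, up
to constants, the commutator `x y - y x`, and the determinant is the trace of `(x y - y x) z`. The
first successive minimum and the three lower bounds therefore follow from arithmetic lower bounds
for `nr x`, `nr (x y - y x)` and `tr ((x y - y x) z)` on `R(ℓ)⁰`; the parameter `δ` enters through a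
rescaling of the coordinates (`scaledCoords`).

In a division algebra nonzero elements have nonzero norm, so it suffices to show that, up to bounded
powers of two, `ℓ nr x`, `ℓ³ nr (x y - y x)` and `ℓ² tr ((x y - y x) z)` are integers and that the
last two are divisible by `D = d_B N` (`partialDual_bounds`). This is checked prime by prime
(`norm_partialDual_le`). At a prime dividing `N` it is a computation with matrices. At a ramified
prime `p` Hensel's lemma gives `|tr x|² ≤ |nr x|` (`norm_redTrace_sq_le`), so that `|nr|` is
ultrametric and a maximal order is, locally, the set of all elements of integral norm
(`IsMaximalOrder.mem_localAt`). This bounds the norm on the dual. Commutators in the order have norm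
divisible by `p`, because the order modulo its elements of norm divisible by `p` is a finite domain,
which is commutative by Wedderburn's little theorem (`norm_redNorm_commutator_lt`).

In the split case `R(ℓ)⁰` consists of the matrices `!![a, b / ℓ; m c, -a]` with `N = ℓ m`, and
commutators are `m / ℓ` times elements of `R(m)⁰`. Elements of nonzero determinant are treated as
above. A nonzero element of determinant zero is nilpotent and fixes a cusp; an Atkin–Lehner
operator moves this cusp to infinity, where the element becomes strictly upper triangular, and the
definition of the height bounds its `i`-coordinate from below by a multiple of `1 / (ℓ H(g))`
(`inv_height_le_abs_trace`). Applied to `R(ℓ)⁰` and, for the commutators, to `R(m)⁰`, this gives the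
terms of the estimate that involve `H(g)`.
-/

namespace QuatLattice

/-! ### Reduced trace and reduced norm -/

section RedTrace

variable {K A : Type*} [Field K] [Ring A] [Algebra K A]

theorem redTrace_add (x y : A) : redTrace K A (x + y) = redTrace K A x + redTrace K A y := by
  have h : LinearMap.mulLeft K (x + y) = LinearMap.mulLeft K x + LinearMap.mulLeft K y := by
    ext z; simp [add_mul]
  simp only [redTrace, h, map_add]; ring

theorem redTrace_smul (c : K) (x : A) : redTrace K A (c • x) = c * redTrace K A x := by
  have h : LinearMap.mulLeft K (c • x) = c • LinearMap.mulLeft K x := by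
    ext z; simp
  simp only [redTrace, h, map_smul, smul_eq_mul]; ring

theorem redTrace_zero : redTrace K A 0 = 0 := by
  simpa using redTrace_smul (0 : K) (0 : A)

theorem redTrace_neg (x : A) : redTrace K A (-x) = -redTrace K A x := by
  simpa using redTrace_smul (-1 : K) x

theorem redTrace_sub (x y : A) : redTrace K A (x - y) = redTrace K A x - redTrace K A y := by
  rw [sub_eq_add_neg, redTrace_add, redTrace_neg, sub_eq_add_neg]

theorem redTrace_mul_comm (x y : A) : redTrace K A (x * y) = redTrace K A (y * x) := by
  simp only [redTrace, LinearMap.mulLeft_mul]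
  congr 1
  exact LinearMap.trace_mul_comm K _ _

theorem redTrace_one [CharZero K] (h : Module.finrank K A = 4) : redTrace K A 1 = 2 := by
  have : Module.Finite K A := Module.finite_of_finrank_pos (by omega)
  simp only [redTrace, LinearMap.mulLeft_one]
  have : LinearMap.trace K A LinearMap.id = 4 := by
    rw [LinearMap.trace_id, h]; norm_num
  rw [this]; norm_num

theorem redTrace_algebraMap [CharZero K] (h : Module.finrank K A = 4) (c : K) :
    redTrace K A (algebraMap K A c) = 2 * c := by
  rw [Algebra.algebraMap_eq_smul_one, redTrace_smul, redTrace_one h, mul_comm]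

theorem redTrace_algEquiv {A' : Type*} [Ring A'] [Algebra K A'] (e : A ≃ₐ[K] A') (x : A) :
    redTrace K A' (e x) = redTrace K A x := by
  have h : LinearMap.mulLeft K (e x) = e.toLinearEquiv.conj (LinearMap.mulLeft K x) := by
    ext z; simp [LinearEquiv.conj_apply]
  simp only [redTrace, h, LinearMap.trace_conj']

theorem redTrace_baseChange {L : Type*} [Field L] [Algebra K L] [Module.Finite K A] (x : A) :
    redTrace L (L ⊗[K] A) (1 ⊗ₜ x) = algebraMap K L (redTrace K A x) := by
  have h : LinearMap.mulLeft L ((1 : L) ⊗ₜ[K] x) = (LinearMap.mulLeft K x).baseChange L := by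
    ext z; simp
  simp only [redTrace, h, LinearMap.trace_baseChange, map_mul, map_div₀, map_one, map_ofNat]

theorem redTrace_matrix [CharZero K] (M : Matrix (Fin 2) (Fin 2) K) :
    redTrace K (Matrix (Fin 2) (Fin 2) K) M = M.trace := by
  have h : LinearMap.trace K _ (LinearMap.mulLeft K M) = 2 * M.trace := by
    rw [LinearMap.trace_eq_matrix_trace K (Matrix.stdBasis K (Fin 2) (Fin 2))]
    simp only [Matrix.trace, Matrix.diag, LinearMap.toMatrix_apply, Fintype.sum_prod_type,
      Fin.sum_univ_two, Matrix.stdBasis_eq_single, LinearMap.mulLeft_apply]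
    simp [Matrix.stdBasis, Matrix.mul_apply, Matrix.single_apply]
    ring
  rw [redTrace, h]; ring

variable (K) in
/-- The reduced norm of a quaternion algebra, defined from the reduced trace through
`2 nr(x) = tr(x)² - tr(x²)`. -/
noncomputable def redNorm (x : A) : K :=
  (redTrace K A x ^ 2 - redTrace K A (x * x)) / 2

theorem redNorm_matrix [CharZero K] (M : Matrix (Fin 2) (Fin 2) K) : redNorm K M = M.det := by
  rw [redNorm, redTrace_matrix, redTrace_matrix]
  simp [Matrix.trace, Fin.sum_univ_two, Matrix.mul_apply, Matrix.det_fin_two]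
  ring

theorem redNorm_algEquiv {A' : Type*} [Ring A'] [Algebra K A'] (e : A ≃ₐ[K] A') (x : A) :
    redNorm K (e x) = redNorm K x := by
  simp only [redNorm, ← map_mul, redTrace_algEquiv]

theorem redNorm_baseChange {L : Type*} [Field L] [Algebra K L] [Module.Finite K A] (x : A) :
    redNorm L ((1 : L) ⊗ₜ[K] x) = algebraMap K L (redNorm K x) := by
  simp only [redNorm, Algebra.TensorProduct.tmul_mul_tmul, one_mul, redTrace_baseChange, map_div₀,
    map_sub, map_pow, map_ofNat]

end RedTrace

/-! ### Simple algebras of dimension four and their scalar extensions -/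

/-- A four-dimensional simple algebra which is not a matrix algebra is a division algebra. -/
theorem isUnit_of_ne_zero_of_isEmpty_matrix {K A : Type*} [Field K] [Ring A] [Algebra K A]
    [IsSimpleRing A] (h4 : Module.finrank K A = 4)
    (hA : IsEmpty (A ≃ₐ[K] Matrix (Fin 2) (Fin 2) K)) {x : A} (hx : x ≠ 0) : IsUnit x := by
  have : Module.Finite K A := Module.finite_of_finrank_pos (by omega)
  have := IsArtinianRing.of_finite K A
  obtain ⟨n, hn, D, _, _, _, ⟨e⟩⟩ := IsSimpleRing.exists_algEquiv_matrix_divisionRing_finite K A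
  have hdim : n * n * Module.finrank K D = 4 := by
    have := e.toLinearEquiv.finrank_eq
    rw [h4, Module.finrank_matrix] at this
    simpa using this.symm
  have hn0 := hn.out
  have hn2 : n ≤ 2 := by
    by_contra hcon
    have h9 : 3 * 3 ≤ n * n := Nat.mul_le_mul (by omega) (by omega)
    have : 0 < Module.finrank K D := Module.finrank_pos
    nlinarith
  obtain rfl | rfl : n = 1 ∨ n = 2 := by omega
  · have hD : IsUnit (e x) := by
      have hne : e x ≠ 0 := by simpa using hx
      have h00 : e x 0 0 ≠ 0 := fun h => hne (by
        ext i j; rw [Subsingleton.elim i 0, Subsingleton.elim j 0, h]; rfl)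
      refine IsUnit.of_mul_eq_one (Matrix.of fun _ _ => (e x 0 0)⁻¹) ?_
      ext i j
      rw [Subsingleton.elim i 0, Subsingleton.elim j 0]
      simp [Matrix.mul_apply, h00]
    simpa using hD
  · have h1 : Module.finrank K D = 1 := by omega
    have hb : Function.Bijective (algebraMap K D) :=
      ⟨FaithfulSMul.algebraMap_injective K D, Algebra.surjective_algebraMap_iff.mpr
        (Subalgebra.bot_eq_top_iff_finrank_eq_one.mpr h1).symm⟩
    exact (hA.false (e.trans (AlgEquiv.mapMatrix
      (AlgEquiv.ofBijective (Algebra.ofId K D) hb).symm))).elim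

/-- A scalar extension of a central division algebra is simple: an element with the fewest nonzero
coordinates in a two-sided ideal can be normalized and is then central. -/
theorem isSimpleRing_baseChange {K A L : Type*} [Field K] [Ring A] [Algebra K A]
    [Algebra.IsCentral K A] [Nontrivial A] [Field L] [Algebra K L]
    (hA : ∀ x : A, x ≠ 0 → IsUnit x) : IsSimpleRing (L ⊗[K] A) := by
  classical
  let β := Module.Basis.ofVectorSpace K L
  let Φ := TensorProduct.equivFinsuppOfBasisLeft (N := A) β
  have hΦl : ∀ (b : A) (z : L ⊗[K] A) i, Φ ((1 ⊗ₜ b) * z) i = b * Φ z i := by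
    intro b z i
    induction z with
    | zero => simp
    | add z w hz hw => simp only [mul_add, map_add, Finsupp.add_apply, hz, hw]
    | tmul l a => simp [Φ]
  have hΦr : ∀ (b : A) (z : L ⊗[K] A) i, Φ (z * (1 ⊗ₜ b)) i = Φ z i * b := by
    intro b z i
    induction z with
    | zero => simp
    | add z w hz hw => simp only [add_mul, map_add, Finsupp.add_apply, hz, hw]
    | tmul l a => simp [Φ]
  have : Nontrivial (L ⊗[K] A) := by
    refine ⟨1, 0, fun h => ?_⟩
    have h1 : (Algebra.TensorProduct.includeRight : A →ₐ[K] L ⊗[K] A) 1 =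
        Algebra.TensorProduct.includeRight 0 := by
      rw [map_one, map_zero, h]
    have := Algebra.TensorProduct.includeRight_injective (R := K) (A := L) (B := A)
      (FaithfulSMul.algebraMap_injective K L) h1
    exact one_ne_zero this
  refine ⟨⟨fun I => ?_⟩⟩
  by_cases hI : ∀ z ∈ I, z = 0
  · left
    rw [eq_bot_iff]
    intro z hz
    rw [hI z hz]; exact TwoSidedIdeal.zero_mem _
  right
  push Not at hI
  obtain ⟨z, ⟨hzI, hz0⟩, hmin⟩ := (measure fun z => (Φ z).support.card).wf.has_min
    {z | z ∈ I ∧ z ≠ 0} hI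
  obtain ⟨i, hi⟩ : ∃ i, Φ z i ≠ 0 := by
    by_contra hcon
    push Not at hcon
    exact hz0 (by simpa using show Φ z = 0 from Finsupp.ext hcon)
  obtain ⟨u, hu⟩ := hA _ hi
  set w : L ⊗[K] A := (1 ⊗ₜ[K] (↑u⁻¹ : A)) * z with hw
  have hwI : w ∈ I := I.mul_mem_left _ _ hzI
  have hwi : Φ w i = 1 := by rw [hw, hΦl, ← hu]; simp
  have hwsupp : (Φ w).support ⊆ (Φ z).support := by
    intro j
    rw [Finsupp.mem_support_iff, Finsupp.mem_support_iff, hw, hΦl]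
    exact fun h h' => h (by rw [h', mul_zero])
  -- the commutator with `1 ⊗ b` has fewer nonzero coordinates than `z`, so it vanishes
  have hcomm : ∀ b j, b * Φ w j = Φ w j * b := by
    intro b
    set c : L ⊗[K] A := (1 ⊗ₜ[K] b) * w - w * (1 ⊗ₜ[K] b) with hc
    have hcj : ∀ j, Φ c j = b * Φ w j - Φ w j * b := by
      intro j; rw [hc, map_sub, Finsupp.sub_apply, hΦl, hΦr]
    have hc0 : c = 0 := by
      by_contra hne
      refine hmin c ⟨I.sub_mem (I.mul_mem_left _ _ hwI) (I.mul_mem_right _ _ hwI), hne⟩ ?_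
      refine Finset.card_lt_card ((Finset.ssubset_iff_of_subset ?_).mpr ⟨i, ?_, ?_⟩)
      · refine subset_trans (fun j => ?_) hwsupp
        rw [Finsupp.mem_support_iff, Finsupp.mem_support_iff, hcj]
        exact fun h h' => h (by rw [h']; simp)
      · exact Finsupp.mem_support_iff.mpr hi
      · rw [Finsupp.mem_support_iff, hcj, hwi]; simp
    intro j
    have := hcj j
    rw [hc0, map_zero, Finsupp.zero_apply] at this
    exact sub_eq_zero.mp this.symm
  have hcent : ∀ j, ∃ k : K, algebraMap K A k = Φ w j := by
    intro j
    have : Φ w j ∈ Subalgebra.center K A :=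
      Subalgebra.mem_center_iff.mpr fun b => hcomm b j
    rw [Algebra.IsCentral.center_eq_bot K A] at this
    exact Algebra.mem_bot.mp this
  -- all coordinates of `w` are scalars, so `w` is a pure tensor `l ⊗ 1`, hence a unit
  choose k hk using hcent
  obtain ⟨l, hl⟩ : ∃ l : L, w = l ⊗ₜ 1 := by
    refine ⟨∑ j ∈ (Φ w).support, k j • β j, ?_⟩
    refine (Φ.symm_apply_apply w).symm.trans ?_
    rw [TensorProduct.equivFinsuppOfBasisLeft_symm_apply, Finsupp.sum, TensorProduct.sum_tmul]
    refine Finset.sum_congr rfl fun j _ => ?_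
    rw [← hk j, Algebra.algebraMap_eq_smul_one, TensorProduct.tmul_smul, TensorProduct.smul_tmul']
  have hl0 : l ≠ 0 := by
    rintro rfl
    rw [hl, TensorProduct.zero_tmul, map_zero] at hwi
    exact zero_ne_one hwi
  have h1 : (1 : L ⊗[K] A) ∈ I := by
    have : (1 : L ⊗[K] A) = (l⁻¹ ⊗ₜ[K] (1 : A)) * w := by
      rw [hl, Algebra.TensorProduct.tmul_mul_tmul, inv_mul_cancel₀ hl0, mul_one,
        Algebra.TensorProduct.one_def]
    rw [this]; exact I.mul_mem_left _ _ hwI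
  rw [eq_top_iff]
  intro y _
  simpa using I.mul_mem_left y 1 h1

/-! ### Cayley–Hamilton and multiplicativity of the norm in a quaternion division algebra -/

/-- A quaternion division algebra embeds into the complex `2 × 2` matrices, compatibly with
traces. -/
theorem exists_splitting {B : Type*} [Ring B] [Algebra ℚ B] [Algebra.IsCentral ℚ B] [Nontrivial B]
    (h4 : Module.finrank ℚ B = 4) (hB : ∀ x : B, x ≠ 0 → IsUnit x) :
    ∃ φ : B →+* Matrix (Fin 2) (Fin 2) ℂ, Function.Injective φ ∧
      (∀ c : ℚ, φ (algebraMap ℚ B c) = algebraMap ℂ _ (c : ℂ)) ∧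
      ∀ x, (φ x).trace = (redTrace ℚ B x : ℂ) := by
  have : Module.Finite ℚ B := Module.finite_of_finrank_pos (by omega)
  have hs : IsSimpleRing (ℂ ⊗[ℚ] B) := isSimpleRing_baseChange hB
  obtain ⟨n, hn, ⟨e⟩⟩ := IsSimpleRing.exists_algEquiv_matrix_of_isAlgClosed ℂ (ℂ ⊗[ℚ] B)
  have hdim := e.toLinearEquiv.finrank_eq
  rw [Module.finrank_baseChange, h4, Module.finrank_matrix] at hdim
  obtain rfl : n = 2 := by
    simp only [Fintype.card_fin, Module.finrank_self, mul_one] at hdim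
    nlinarith
  refine ⟨(e : ℂ ⊗[ℚ] B →+* _).comp
    (Algebra.TensorProduct.includeRight : B →ₐ[ℚ] ℂ ⊗[ℚ] B).toRingHom, ?_, ?_, ?_⟩
  · exact e.injective.comp (Algebra.TensorProduct.includeRight_injective
      (FaithfulSMul.algebraMap_injective ℚ ℂ))
  · intro c
    have : (1 : ℂ) ⊗ₜ[ℚ] (algebraMap ℚ B c) = algebraMap ℂ (ℂ ⊗[ℚ] B) (c : ℂ) := by
      rw [Algebra.algebraMap_eq_smul_one, ← TensorProduct.smul_tmul,
        Algebra.TensorProduct.algebraMap_apply, Algebra.smul_def]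
      simp
    simp only [AlgHom.toRingHom_eq_coe, RingHom.coe_comp, RingHom.coe_coe, Function.comp_apply,
      Algebra.TensorProduct.includeRight_apply, this]
    exact e.commutes _
  · intro x
    rw [← redTrace_matrix]
    simp only [AlgHom.toRingHom_eq_coe, RingHom.coe_comp, RingHom.coe_coe, Function.comp_apply,
      Algebra.TensorProduct.includeRight_apply]
    exact (redTrace_algEquiv e _).trans (by rw [redTrace_baseChange]; rfl)

section Division

variable {B : Type*} [Ring B] [Algebra ℚ B] [Algebra.IsCentral ℚ B] [Nontrivial B]

theorem redNorm_mul (h4 : Module.finrank ℚ B = 4) (hB : ∀ x : B, x ≠ 0 → IsUnit x) (x y : B) :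
    redNorm ℚ (x * y) = redNorm ℚ x * redNorm ℚ y := by
  obtain ⟨φ, -, -, htr⟩ := exists_splitting h4 hB
  have hN : ∀ z : B, ((redNorm ℚ z : ℚ) : ℂ) = (φ z).det := by
    intro z
    rw [← redNorm_matrix, redNorm, redNorm, redTrace_matrix, redTrace_matrix, ← map_mul, htr, htr]
    push_cast; ring
  have : ((redNorm ℚ (x * y) : ℚ) : ℂ) = ((redNorm ℚ x * redNorm ℚ y : ℚ) : ℂ) := by
    rw [Rat.cast_mul, hN, hN, hN, map_mul, Matrix.det_mul]
  exact_mod_cast this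

/-- The Cayley–Hamilton identity `x (tr x - x) = nr x`. -/
theorem mul_stdConj (h4 : Module.finrank ℚ B = 4) (hB : ∀ x : B, x ≠ 0 → IsUnit x) (x : B) :
    x * stdConj ℚ B x = algebraMap ℚ B (redNorm ℚ x) := by
  obtain ⟨φ, hinj, hc, htr⟩ := exists_splitting h4 hB
  apply hinj
  rw [map_mul, stdConj, map_sub, hc, hc, redNorm]
  push_cast
  rw [← htr, ← htr, map_mul]
  ext i j
  fin_cases i <;> fin_cases j <;>
    simp [Matrix.mul_apply, Fin.sum_univ_two, Matrix.trace, Matrix.algebraMap_matrix_apply] <;> ring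

theorem redNorm_eq_zero_iff (h4 : Module.finrank ℚ B = 4) (hB : ∀ x : B, x ≠ 0 → IsUnit x)
    {x : B} : redNorm ℚ x = 0 ↔ x = 0 := by
  refine ⟨fun h => ?_, fun h => by simp [h, redNorm, redTrace_zero]⟩
  by_contra hx
  obtain ⟨u, rfl⟩ := hB x hx
  have h1 : redNorm ℚ (1 : B) = 1 := by
    rw [redNorm, one_mul, redTrace_one h4]; norm_num
  rw [← u.mul_inv, redNorm_mul h4 hB, h, zero_mul] at h1
  exact zero_ne_one h1

end Division

/-! ### Rational numbers and `p`-adic norms -/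

theorem not_dvd_den_of_padic_norm_le_one {p : ℕ} [Fact p.Prime] {q : ℚ} (h : ‖(q : ℚ_[p])‖ ≤ 1) :
    ¬ p ∣ q.den := by
  intro hd
  have hden : ‖(q.den : ℚ_[p])‖ < 1 := Padic.norm_natCast_lt_one_iff.mpr hd
  have hnum : (q.num : ℚ_[p]) = q * q.den := by exact_mod_cast (Rat.mul_den_eq_num q).symm
  have hlt : ‖(q.num : ℚ_[p])‖ < 1 := by
    rw [hnum, norm_mul]
    exact (mul_le_of_le_one_left (norm_nonneg _) h).trans_lt hden
  have hdn : p ∣ q.num.natAbs := Int.natCast_dvd.mp (Padic.norm_intCast_lt_one_iff.mp hlt)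
  exact (Fact.out : p.Prime).one_lt.ne' (Nat.dvd_one.mp (q.reduced ▸ Nat.dvd_gcd hdn hd))

theorem exists_int_eq_of_forall_norm_le_one {q : ℚ}
    (h : ∀ (p : ℕ) [Fact p.Prime], ‖(q : ℚ_[p])‖ ≤ 1) : ∃ z : ℤ, (z : ℚ) = q := by
  refine ⟨q.num, Rat.coe_int_num_of_den_eq_one ?_⟩
  by_contra hne
  obtain ⟨p, hp, hd⟩ := Nat.exists_prime_and_dvd hne
  have := Fact.mk hp
  exact not_dvd_den_of_padic_norm_le_one (h p) hd

theorem exists_int_eq_of_pow_smul {p : ℕ} [Fact p.Prime] {q : ℚ} (h : ‖(q : ℚ_[p])‖ ≤ 1)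
    {k : ℕ} (hk : ∃ z : ℤ, (z : ℚ) = (p : ℚ) ^ k * q) : ∃ z : ℤ, (z : ℚ) = q := by
  refine exists_int_eq_of_forall_norm_le_one fun r _ => ?_
  by_cases hr : r = p
  · subst hr; convert h
  · obtain ⟨z, hz⟩ := hk
    have h1 : ‖((p : ℚ_[r])) ^ k‖ = 1 := by
      rw [norm_pow, Padic.norm_natCast_eq_one_iff.mpr
        ((Nat.coprime_primes Fact.out Fact.out).mpr hr), one_pow]
    have h2 : (z : ℚ_[r]) = (p : ℚ_[r]) ^ k * (q : ℚ_[r]) := by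
      exact_mod_cast congrArg (Rat.cast : ℚ → ℚ_[r]) hz
    have := Padic.norm_int_le_one (p := r) z
    rwa [h2, norm_mul, h1, one_mul] at this

/-! ### Orders and their localizations -/

section Orders

variable {B : Type*} [Ring B] [Algebra ℚ B]

theorem IsOrder.finite {R : Subring B} (hR : IsOrder R) : Module.Finite ℤ R :=
  Module.Finite.iff_addGroup_fg.mpr ((AddGroup.fg_iff_addSubgroup_fg R.toAddSubgroup).mpr hR.1)

theorem IsOrder.isIntegral {R : Subring B} (hR : IsOrder R) {x : B} (hx : x ∈ R) :
    IsIntegral ℤ x := by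
  have := hR.finite
  exact (IsIntegral.of_finite ℤ (⟨x, hx⟩ : R)).map R.subtype.toIntAlgHom

theorem IsOrder.exists_nsmul_mem {O : Subring B} (hO : IsOrder O) (x : B) :
    ∃ m : ℕ, m ≠ 0 ∧ m • x ∈ O := by
  have hx : x ∈ Submodule.span ℚ (O : Set B) := hO.2 ▸ Submodule.mem_top
  induction hx using Submodule.span_induction with
  | mem y h => exact ⟨1, one_ne_zero, by simpa using h⟩
  | zero => exact ⟨1, one_ne_zero, by simp⟩
  | add a b _ _ iha ihb =>
    obtain ⟨m, hm, ha⟩ := iha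
    obtain ⟨n, hn, hb⟩ := ihb
    refine ⟨m * n, mul_ne_zero hm hn, ?_⟩
    have h := O.add_mem (O.nsmul_mem ha n) (O.nsmul_mem hb m)
    rwa [smul_smul, smul_smul, mul_comm n m, ← smul_add] at h
  | smul c a _ iha =>
    obtain ⟨m, hm, ha⟩ := iha
    refine ⟨m * c.den, mul_ne_zero hm c.den_ne_zero, ?_⟩
    have h := O.zsmul_mem ha c.num
    have hc : (m * c.den) • c • a = c.num • m • a := by
      rw [← Nat.cast_smul_eq_nsmul ℚ, ← Int.cast_smul_eq_zsmul ℚ, ← Nat.cast_smul_eq_nsmul ℚ m,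
        smul_smul, smul_smul, Nat.cast_mul, mul_assoc, Rat.den_mul_eq_num, mul_comm]
    rwa [hc]

theorem IsOrder.inf {O₁ O₂ : Subring B} (h₁ : IsOrder O₁) (h₂ : IsOrder O₂) :
    IsOrder (O₁ ⊓ O₂) := by
  have := h₁.finite
  have hfin : Module.Finite ℤ (O₁ ⊓ O₂ : Subring B) :=
    Module.Finite.of_injective
      (Subring.inclusion (inf_le_left : O₁ ⊓ O₂ ≤ O₁)).toAddMonoidHom.toIntLinearMap
      (Subring.inclusion_injective inf_le_left)
  refine ⟨(AddGroup.fg_iff_addSubgroup_fg (O₁ ⊓ O₂).toAddSubgroup).mp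
    (Module.Finite.iff_addGroup_fg.mp hfin), eq_top_iff.mpr fun x _ => ?_⟩
  obtain ⟨m, hm, hx⟩ := h₁.exists_nsmul_mem x
  obtain ⟨n, hn, hy⟩ := h₂.exists_nsmul_mem x
  have hmem : (m * n) • x ∈ O₁ ⊓ O₂ := by
    refine ⟨?_, ?_⟩
    · rw [mul_comm, mul_smul]; exact O₁.nsmul_mem hx n
    · rw [mul_smul]; exact O₂.nsmul_mem hy m
  have h : x = ((m * n : ℕ) : ℚ)⁻¹ • ((m * n) • x) := by
    rw [← Nat.cast_smul_eq_nsmul ℚ (m * n), smul_smul, inv_mul_cancel₀, one_smul]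
    exact_mod_cast mul_ne_zero hm hn
  rw [h]
  exact Submodule.smul_mem _ _ (Submodule.subset_span hmem)

variable [Algebra.IsCentral ℚ B] [Nontrivial B]

/-- Elements of an order have integral reduced trace and norm: by Gauss's lemma the minimal
polynomial is integral, and it is the reduced characteristic polynomial for nonscalar elements. -/
theorem IsOrder.exists_int (h4 : Module.finrank ℚ B = 4) (hB : ∀ x : B, x ≠ 0 → IsUnit x)
    {R : Subring B} (hR : IsOrder R) {x : B} (hx : x ∈ R) :
    (∃ z : ℤ, (z : ℚ) = redTrace ℚ B x) ∧ ∃ z : ℤ, (z : ℚ) = redNorm ℚ x := by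
  classical
  open Polynomial in
  obtain ⟨f, hf, hfx⟩ := hR.isIntegral hx
  have hfx' : aeval x (f.map (algebraMap ℤ ℚ)) = 0 := by
    rw [aeval_map_algebraMap]; exact hfx
  have hint : IsIntegral ℚ x := ⟨f.map (algebraMap ℤ ℚ), hf.map _, by simpa [aeval_def] using hfx'⟩
  have key : ∃ g : ℤ[X], g.map (algebraMap ℤ ℚ) = minpoly ℚ x := by
    obtain ⟨g, hg⟩ := IsIntegrallyClosed.eq_map_mul_C_of_dvd ℚ hf (minpoly.dvd ℚ x hfx')
    exact ⟨g, by simpa [(minpoly.monic hint).leadingCoeff] using hg⟩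
  obtain ⟨g, hg⟩ := key
  have hcoeff : ∀ n, ((g.coeff n : ℤ) : ℚ) = (minpoly ℚ x).coeff n := by
    intro n; rw [← hg, coeff_map]; rfl
  by_cases hsc : x ∈ (algebraMap ℚ B).range
  · obtain ⟨q, rfl⟩ := hsc
    rw [minpoly.eq_X_sub_C] at hcoeff
    have h0 : ((-g.coeff 0 : ℤ) : ℚ) = q := by
      have := hcoeff 0
      simp at this
      push_cast; linarith
    rw [redNorm, ← map_mul, redTrace_algebraMap h4, redTrace_algebraMap h4]
    refine ⟨⟨2 * -g.coeff 0, by rw [Int.cast_mul, h0]; norm_num⟩, ⟨-g.coeff 0 * -g.coeff 0, ?_⟩⟩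
    rw [Int.cast_mul, h0]; ring
  · set h : ℚ[X] := X ^ 2 - C (redTrace ℚ B x) * X + C (redNorm ℚ x) with hh
    have hm : h.Monic := by rw [hh]; monicity!
    have hd : h.natDegree = 2 := by rw [hh]; compute_degree!
    have hroot : aeval x h = 0 := by
      have := mul_stdConj h4 hB x
      rw [hh]
      simp only [map_add, map_sub, map_mul, map_pow, aeval_X, aeval_C]
      rw [← this, stdConj, mul_sub, ← Algebra.commutes]
      noncomm_ring
    have heq : h = minpoly ℚ x := by
      refine (eq_of_monic_of_dvd_of_natDegree_le (minpoly.monic hint) hm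
        (minpoly.dvd ℚ x hroot) ?_)
      rw [hd]
      exact (minpoly.two_le_natDegree_iff hint).mpr hsc
    rw [← heq] at hcoeff
    refine ⟨⟨-g.coeff 1, ?_⟩, ⟨g.coeff 0, ?_⟩⟩
    · rw [Int.cast_neg, hcoeff 1, hh]
      simp [coeff_C]
    · rw [hcoeff 0, hh]
      simp [coeff_C]

end Orders

section LocalAt

variable {B : Type*} [Ring B] [Algebra ℚ B] {R : Subring B} {p : ℕ} [hp : Fact p.Prime]

theorem localAt_mul {x y : B} (hx : x ∈ localAt R p) (hy : y ∈ localAt R p) :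
    x * y ∈ localAt R p := by
  obtain ⟨n, hn, hx⟩ := hx
  obtain ⟨m, hm, hy⟩ := hy
  refine ⟨n * m, fun h => (hp.out.dvd_mul.mp h).elim hn hm, ?_⟩
  have := R.mul_mem hx hy
  rwa [smul_mul_smul_comm] at this

theorem localAt_sub {x y : B} (hx : x ∈ localAt R p) (hy : y ∈ localAt R p) :
    x - y ∈ localAt R p := by
  obtain ⟨n, hn, hx⟩ := hx
  obtain ⟨m, hm, hy⟩ := hy
  refine ⟨n * m, fun h => (hp.out.dvd_mul.mp h).elim hn hm, ?_⟩
  have := R.sub_mem (R.nsmul_mem hx m) (R.nsmul_mem hy n)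
  rwa [smul_smul, smul_smul, mul_comm m n, ← smul_sub] at this

theorem redTrace_nsmul (n : ℕ) (x : B) : redTrace ℚ B (n • x) = n * redTrace ℚ B x := by
  rw [← redTrace_smul, Nat.cast_smul_eq_nsmul]

theorem redNorm_smul (c : ℚ) (x : B) : redNorm ℚ (c • x) = c ^ 2 * redNorm ℚ x := by
  rw [redNorm, redNorm, smul_mul_smul_comm, redTrace_smul, redTrace_smul]; ring

theorem redNorm_nsmul (n : ℕ) (x : B) : redNorm ℚ (n • x) = n ^ 2 * redNorm ℚ x := by
  rw [← redNorm_smul, Nat.cast_smul_eq_nsmul]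

theorem norm_natCast_eq_one_of_not_dvd {n : ℕ} (hn : ¬ p ∣ n) : ‖(n : ℚ_[p])‖ = 1 :=
  Padic.norm_natCast_eq_one_iff.mpr ((Nat.Prime.coprime_iff_not_dvd hp.out).mpr hn)

variable [Algebra.IsCentral ℚ B] [Nontrivial B]

theorem norm_redTrace_le_one (h4 : Module.finrank ℚ B = 4) (hB : ∀ x : B, x ≠ 0 → IsUnit x)
    (hR : IsOrder R) {x : B} (hx : x ∈ localAt R p) : ‖((redTrace ℚ B x : ℚ) : ℚ_[p])‖ ≤ 1 := by
  obtain ⟨n, hn, hx⟩ := hx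
  obtain ⟨z, hz⟩ := (hR.exists_int h4 hB hx).1
  have h := Padic.norm_int_le_one (p := p) z
  have h2 : (z : ℚ_[p]) = (n : ℚ_[p]) * ((redTrace ℚ B x : ℚ) : ℚ_[p]) := by
    rw [redTrace_nsmul] at hz
    exact_mod_cast congrArg (Rat.cast : ℚ → ℚ_[p]) hz
  rwa [h2, norm_mul, norm_natCast_eq_one_of_not_dvd hn, one_mul] at h

theorem norm_redNorm_le_one (h4 : Module.finrank ℚ B = 4) (hB : ∀ x : B, x ≠ 0 → IsUnit x)
    (hR : IsOrder R) {x : B} (hx : x ∈ localAt R p) : ‖((redNorm ℚ x : ℚ) : ℚ_[p])‖ ≤ 1 := by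
  obtain ⟨n, hn, hx⟩ := hx
  obtain ⟨z, hz⟩ := (hR.exists_int h4 hB hx).2
  have h := Padic.norm_int_le_one (p := p) z
  have h2 : (z : ℚ_[p]) = (n : ℚ_[p]) ^ 2 * ((redNorm ℚ x : ℚ) : ℚ_[p]) := by
    rw [redNorm_nsmul] at hz
    exact_mod_cast congrArg (Rat.cast : ℚ → ℚ_[p]) hz
  rwa [h2, norm_mul, norm_pow, norm_natCast_eq_one_of_not_dvd hn, one_pow, one_mul] at h

end LocalAt

/-! ### Ramified primes -/

section Norm

variable {B : Type*} [Ring B] [Algebra ℚ B]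

theorem redNorm_one (h4 : Module.finrank ℚ B = 4) : redNorm ℚ (1 : B) = 1 := by
  rw [redNorm, one_mul, redTrace_one h4]; norm_num

theorem redNorm_neg (x : B) : redNorm ℚ (-x) = redNorm ℚ x := by
  rw [redNorm, redNorm, neg_mul_neg, redTrace_neg, neg_sq]

theorem redNorm_stdConj (h4 : Module.finrank ℚ B = 4) (x : B) :
    redNorm ℚ (stdConj ℚ B x) = redNorm ℚ x := by
  have h : stdConj ℚ B x * stdConj ℚ B x
      = algebraMap ℚ B (redTrace ℚ B x ^ 2) - (2 * redTrace ℚ B x) • x + x * x := by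
    rw [stdConj, Algebra.smul_def, map_pow, map_mul, map_ofNat, mul_sub, sub_mul, sub_mul,
      ← Algebra.commutes (redTrace ℚ B x) x]
    noncomm_ring
  rw [redNorm, redNorm, h, redTrace_add, redTrace_sub, redTrace_smul, redTrace_algebraMap h4,
    stdConj, redTrace_sub, redTrace_algebraMap h4]
  ring

theorem redNorm_add (x y : B) :
    redNorm ℚ (x + y)
      = redNorm ℚ x + redNorm ℚ y + redTrace ℚ B (x * stdConj ℚ B y) := by
  have h : (x + y) * (x + y) = x * x + x * y + (y * x + y * y) := by noncomm_ring
  have h' : x * stdConj ℚ B y = redTrace ℚ B y • x - x * y := by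
    rw [stdConj, mul_sub, ← Algebra.commutes, Algebra.smul_def]
  rw [redNorm, redNorm, redNorm, h, h']
  simp only [redTrace_add, redTrace_sub, redTrace_smul, redTrace_mul_comm y x]
  ring

end Norm

section Ramified

variable {B : Type*} [Ring B] [Algebra ℚ B] [Algebra.IsCentral ℚ B] [Nontrivial B]

/-- If `|nr x| < |tr x|²`, the reduced characteristic polynomial of `x` has two distinct roots
in `ℚ_p` by Hensel's lemma, and `ℚ_p ⊗ B` has zero divisors. -/
theorem norm_redTrace_sq_le (h4 : Module.finrank ℚ B = 4) (hB : ∀ x : B, x ≠ 0 → IsUnit x)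
    {p : ℕ} [Fact p.Prime] (hram : IsRamifiedAt B p) (x : B) :
    ‖((redTrace ℚ B x : ℚ) : ℚ_[p])‖ ^ 2 ≤ ‖((redNorm ℚ x : ℚ) : ℚ_[p])‖ := by
  have : Module.Finite ℚ B := Module.finite_of_finrank_pos (by omega)
  have hs : IsSimpleRing (ℚ_[p] ⊗[ℚ] B) := isSimpleRing_baseChange hB
  have h4p : Module.finrank ℚ_[p] (ℚ_[p] ⊗[ℚ] B) = 4 := by rw [Module.finrank_baseChange, h4]
  by_contra! hlt
  set t : ℚ_[p] := ((redTrace ℚ B x : ℚ) : ℚ_[p]) with ht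
  set n : ℚ_[p] := ((redNorm ℚ x : ℚ) : ℚ_[p]) with hn
  have ht0 : t ≠ 0 := by
    rintro h0; rw [h0] at hlt; simp at hlt
    exact absurd hlt (not_lt.mpr (norm_nonneg _))
  have hm : ‖n / t ^ 2‖ < 1 := by
    rw [norm_div, norm_pow, div_lt_one (by positivity)]; exact hlt
  -- `t y` and `t - t y` are the roots of the reduced characteristic polynomial
  obtain ⟨y, hy, hy1⟩ : ∃ y : ℚ_[p], y ^ 2 - y + n / t ^ 2 = 0 ∧ ‖y‖ < 1 := by
    let c : ℤ_[p] := ⟨n / t ^ 2, hm.le⟩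
    open Polynomial in
    obtain ⟨z, hz, hz1, -⟩ := hensels_lemma (p := p) (R := ℤ_[p])
      (F := X ^ 2 - X + C c) (a := 0)
      (by simpa using show ‖c‖ < 1 from hm)
    refine ⟨z, ?_, by simpa using hz1⟩
    have hz' : z ^ 2 - z + c = 0 := by simpa using hz
    exact congrArg (Subtype.val : ℤ_[p] → ℚ_[p]) hz'
  have hyn : (t * y) * (t - t * y) = n := by
    have : n = t ^ 2 * (y - y ^ 2) := by
      have : n / t ^ 2 = y - y ^ 2 := by linear_combination hy
      rw [← this]; field_simp
    rw [this]; ring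
  have hne : t ≠ 2 * (t * y) := by
    intro h
    have h1 : (1 : ℚ_[p]) = 2 * y := by
      have : t * 1 = t * (2 * y) := by linear_combination h
      exact mul_left_cancel₀ ht0 this
    have h2 : ‖(1 : ℚ_[p])‖ < 1 := by
      rw [h1, norm_mul]
      have : ‖(2 : ℚ_[p])‖ ≤ 1 := by exact_mod_cast Padic.norm_int_le_one (p := p) 2
      exact (mul_le_of_le_one_left (norm_nonneg _) this).trans_lt hy1
    simp at h2
  set X : ℚ_[p] ⊗[ℚ] B := 1 ⊗ₜ x with hX
  have htX : redTrace ℚ_[p] (ℚ_[p] ⊗[ℚ] B) X = t := by rw [hX, redTrace_baseChange]; rfl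
  have hCH : X * (algebraMap _ _ t - X) = algebraMap _ _ n := by
    have h1 : ∀ c : ℚ, algebraMap ℚ_[p] (ℚ_[p] ⊗[ℚ] B) (c : ℚ_[p]) = 1 ⊗ₜ algebraMap ℚ B c := by
      intro c
      rw [Algebra.algebraMap_eq_smul_one (A := B), ← TensorProduct.smul_tmul,
        Algebra.TensorProduct.algebraMap_apply, Algebra.smul_def]
      simp
    rw [ht, hn, h1, h1, hX, ← TensorProduct.tmul_sub, Algebra.TensorProduct.tmul_mul_tmul,
      ← mul_stdConj h4 hB x, stdConj, one_mul]
  have hfac : (X - algebraMap _ _ (t * y)) * (X - algebraMap _ _ (t - t * y)) = 0 := by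
    have hc : algebraMap ℚ_[p] (ℚ_[p] ⊗[ℚ] B) n
        = algebraMap _ _ (t * y) * algebraMap _ _ (t - t * y) := by rw [← map_mul, hyn]
    have h2 : algebraMap ℚ_[p] (ℚ_[p] ⊗[ℚ] B) t * X
        = algebraMap _ _ (t * y) * X + algebraMap _ _ (t - t * y) * X := by
      rw [← add_mul, ← map_add]; congr 2; ring
    have h3 : X * X = algebraMap _ _ t * X - algebraMap _ _ n := by
      rw [← hCH, Algebra.commutes]; noncomm_ring
    rw [sub_mul, mul_sub, mul_sub, ← Algebra.commutes (t - t * y), h3, h2, hc]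
    noncomm_ring
  have hscal : ∀ c, X ≠ algebraMap _ _ c ∨ t = 2 * c := by
    intro c
    by_cases h : X = algebraMap _ _ c
    · right; rw [← htX, h, redTrace_algebraMap h4p]
    · exact Or.inl h
  have hu : ∀ z : ℚ_[p] ⊗[ℚ] B, z ≠ 0 → IsUnit z :=
    fun z hz => isUnit_of_ne_zero_of_isEmpty_matrix h4p hram hz
  by_cases h0 : X - algebraMap _ _ (t * y) = 0
  · exact ((hscal _).resolve_left (not_not.mpr (sub_eq_zero.mp h0)) |> hne)
  · rw [(hu _ h0).mul_right_eq_zero] at hfac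
    have := (hscal _).resolve_left (not_not.mpr (sub_eq_zero.mp hfac))
    exact hne (by linear_combination -this)

/-- At a ramified prime the square root of `|nr x|` is an ultrametric norm. -/
theorem norm_redNorm_add_le (h4 : Module.finrank ℚ B = 4) (hB : ∀ x : B, x ≠ 0 → IsUnit x)
    {p : ℕ} [Fact p.Prime] (hram : IsRamifiedAt B p) {x y : B} {r : ℝ}
    (hx : ‖((redNorm ℚ x : ℚ) : ℚ_[p])‖ ≤ r) (hy : ‖((redNorm ℚ y : ℚ) : ℚ_[p])‖ ≤ r) :
    ‖((redNorm ℚ (x + y) : ℚ) : ℚ_[p])‖ ≤ r := by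
  have hr : 0 ≤ r := (norm_nonneg _).trans hx
  have ht : ‖((redTrace ℚ B (x * stdConj ℚ B y) : ℚ) : ℚ_[p])‖ ≤ r := by
    have h := norm_redTrace_sq_le h4 hB hram (x * stdConj ℚ B y)
    rw [redNorm_mul h4 hB, redNorm_stdConj h4, Rat.cast_mul, norm_mul] at h
    have h2 := mul_le_mul hx hy (norm_nonneg _) hr
    exact abs_le_of_sq_le_sq' (by nlinarith) hr |>.2
  rw [redNorm_add, Rat.cast_add, Rat.cast_add]
  exact (Padic.nonarchimedean _ _).trans
    (max_le ((Padic.nonarchimedean _ _).trans (max_le hx hy)) ht)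

theorem norm_redNorm_sub_le (h4 : Module.finrank ℚ B = 4) (hB : ∀ x : B, x ≠ 0 → IsUnit x)
    {p : ℕ} [Fact p.Prime] (hram : IsRamifiedAt B p) {x y : B} {r : ℝ}
    (hx : ‖((redNorm ℚ x : ℚ) : ℚ_[p])‖ ≤ r) (hy : ‖((redNorm ℚ y : ℚ) : ℚ_[p])‖ ≤ r) :
    ‖((redNorm ℚ (x - y) : ℚ) : ℚ_[p])‖ ≤ r := by
  rw [sub_eq_add_neg]
  exact norm_redNorm_add_le h4 hB hram hx (by rwa [redNorm_neg])

/-- For a ramified prime `p`, the elements of `O[1/p]` whose reduced norm is `p`-integral. They form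
a ring because the norm is ultrametric at `p`. -/
noncomputable def saturation (h4 : Module.finrank ℚ B = 4) (hB : ∀ x : B, x ≠ 0 → IsUnit x)
    {p : ℕ} [Fact p.Prime] (hram : IsRamifiedAt B p) (O : Subring B) : Subring B where
  carrier := {x | ‖((redNorm ℚ x : ℚ) : ℚ_[p])‖ ≤ 1 ∧ ∃ k : ℕ, p ^ k • x ∈ O}
  mul_mem' := by
    rintro x y ⟨hx, k, hk⟩ ⟨hy, m, hm⟩
    refine ⟨?_, k + m, ?_⟩
    · rw [redNorm_mul h4 hB, Rat.cast_mul, norm_mul]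
      exact mul_le_one₀ hx (norm_nonneg _) hy
    · have := O.mul_mem hk hm
      rwa [smul_mul_smul_comm, ← pow_add] at this
  one_mem' := ⟨by rw [redNorm_one h4]; simp, 0, by simp⟩
  add_mem' := by
    rintro x y ⟨hx, k, hk⟩ ⟨hy, m, hm⟩
    refine ⟨norm_redNorm_add_le h4 hB hram hx hy, k + m, ?_⟩
    have h := O.add_mem (O.nsmul_mem hk (p ^ m)) (O.nsmul_mem hm (p ^ k))
    rwa [smul_smul, smul_smul, ← pow_add, ← pow_add, add_comm m k, ← smul_add] at h
  zero_mem' := ⟨by simp [redNorm, redTrace_zero], 0, by simp⟩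
  neg_mem' := by
    rintro x ⟨hx, k, hk⟩
    exact ⟨by rwa [redNorm_neg], k, by simpa using O.neg_mem hk⟩

/-- The saturation of an order is an order: its elements have integral traces, so it embeds
into a finite power of `ℤ` by pairing with generators of `O`. -/
theorem isOrder_saturation (h4 : Module.finrank ℚ B = 4) (hB : ∀ x : B, x ≠ 0 → IsUnit x)
    {p : ℕ} [Fact p.Prime] (hram : IsRamifiedAt B p) {O : Subring B} (hO : IsOrder O) :
    O ≤ saturation h4 hB hram O ∧ IsOrder (saturation h4 hB hram O) := by
  set S := saturation h4 hB hram O with hS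
  have hle : O ≤ S := fun x hx => by
    refine ⟨?_, 0, by simpa using hx⟩
    obtain ⟨z, hz⟩ := (hO.exists_int h4 hB hx).2
    rw [← hz, Rat.cast_intCast]
    exact Padic.norm_int_le_one z
  refine ⟨hle, ?_, eq_top_iff.mpr (hO.2 ▸ Submodule.span_mono hle)⟩
  -- traces are integral at `p` by the norm bound, and away from `p` because `p ^ k • x ∈ O`
  have hint : ∀ x ∈ S, ∃ z : ℤ, (z : ℚ) = redTrace ℚ B x := by
    rintro x ⟨hx, k, hk⟩
    have htr : ‖((redTrace ℚ B x : ℚ) : ℚ_[p])‖ ≤ 1 := by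
      have := norm_redTrace_sq_le h4 hB hram x
      exact abs_le_of_sq_le_sq' (by linarith) zero_le_one |>.2
    refine exists_int_eq_of_pow_smul htr (k := k) ?_
    obtain ⟨z, hz⟩ := (hO.exists_int h4 hB hk).1
    exact ⟨z, by rw [hz, redTrace_nsmul]; push_cast; rfl⟩
  obtain ⟨s, hs⟩ := hO.1
  have hsO : ∀ y ∈ s, y ∈ O := fun y hy => by
    have : y ∈ O.toAddSubgroup := hs ▸ AddSubgroup.subset_closure hy
    exact this
  have hnd : ∀ x : B, (∀ y ∈ s, redTrace ℚ B (x * y) = 0) → x = 0 := by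
    intro x hx
    by_contra hne
    have hOx : ∀ y ∈ O, redTrace ℚ B (x * y) = 0 := by
      intro y hy
      have hy' : y ∈ AddSubgroup.closure (s : Set B) := hs ▸ hy
      induction hy' using AddSubgroup.closure_induction with
      | mem y h => exact hx y h
      | zero => rw [mul_zero, redTrace_zero]
      | add a b ha hb iha ihb =>
        rw [hs] at ha hb
        rw [mul_add, redTrace_add, iha ha, ihb hb, add_zero]
      | neg a ha iha =>
        rw [hs] at ha
        rw [mul_neg, redTrace_neg, iha ha, neg_zero]
    have hall : ∀ y : B, redTrace ℚ B (x * y) = 0 := by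
      intro y
      have hy : y ∈ Submodule.span ℚ (O : Set B) := hO.2 ▸ Submodule.mem_top
      induction hy using Submodule.span_induction with
      | mem y h => exact hOx y h
      | zero => rw [mul_zero, redTrace_zero]
      | add a b _ _ iha ihb => rw [mul_add, redTrace_add, iha, ihb, add_zero]
      | smul c a _ iha => rw [mul_smul_comm, redTrace_smul, iha, mul_zero]
    obtain ⟨u, rfl⟩ := hB x hne
    have := hall ↑u⁻¹
    rw [Units.mul_inv, redTrace_one h4] at this
    norm_num at this
  choose! f hf using hint
  let Φ : S →+ (s → ℤ) :=
    { toFun := fun x y => f (x * y)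
      map_zero' := by
        ext y
        have := hf _ (S.mul_mem S.zero_mem (hle (hsO y y.2)))
        rw [zero_mul, redTrace_zero] at this
        simpa using this
      map_add' := by
        intro a b
        ext y
        have hy := hle (hsO y y.2)
        have h1 := hf _ (S.mul_mem a.2 hy)
        have h2 := hf _ (S.mul_mem b.2 hy)
        have h3 := hf _ (S.mul_mem (S.add_mem a.2 b.2) hy)
        rw [add_mul, redTrace_add, ← h1, ← h2, ← add_mul] at h3
        simpa using (by exact_mod_cast h3 : f ((↑a + ↑b) * ↑y) = f (↑a * ↑y) + f (↑b * ↑y)) }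
  have hΦ : Function.Injective Φ := by
    rw [injective_iff_map_eq_zero]
    intro a ha
    refine Subtype.ext (hnd _ fun y hy => ?_)
    have h := congrFun ha ⟨y, hy⟩
    rw [← hf _ (S.mul_mem a.2 (hle (hsO y hy)))]
    exact_mod_cast h
  have hfin : Module.Finite ℤ S := Module.Finite.of_injective Φ.toIntLinearMap hΦ
  exact (AddGroup.fg_iff_addSubgroup_fg S.toAddSubgroup).mp (Module.Finite.iff_addGroup_fg.mp hfin)

/-- At a ramified prime, a maximal order contains, locally, all elements of integral norm. -/
theorem IsMaximalOrder.mem_localAt (h4 : Module.finrank ℚ B = 4) (hB : ∀ x : B, x ≠ 0 → IsUnit x)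
    {p : ℕ} [hp : Fact p.Prime] (hram : IsRamifiedAt B p) {O : Subring B} (hO : IsMaximalOrder O)
    {x : B} (hx : ‖((redNorm ℚ x : ℚ) : ℚ_[p])‖ ≤ 1) : x ∈ localAt O p := by
  obtain ⟨hle, hS⟩ := isOrder_saturation h4 hB hram hO.prop
  have hSO : saturation h4 hB hram O ≤ O := hO.le_of_ge hS hle
  obtain ⟨m, hm0, hm⟩ := hO.prop.exists_nsmul_mem x
  obtain ⟨k, n, hn, rfl⟩ := Nat.exists_eq_pow_mul_and_not_dvd hm0 p hp.out.ne_one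
  refine ⟨n, hn, hSO ⟨?_, k, by rwa [smul_smul]⟩⟩
  rw [redNorm_nsmul, Rat.cast_mul, norm_mul, Rat.cast_pow, norm_pow, Rat.cast_natCast]
  exact mul_le_one₀ (pow_le_one₀ (norm_nonneg _)
    (by exact_mod_cast Padic.norm_int_le_one (p := p) n)) (norm_nonneg _) hx

/-- The duals at a ramified prime: `|4 nr x| ≤ p` for `x` in the local dual of `R`, seen by pairing
`x` with the multiple of `x` which makes `x ȳ` equal to `1 / (2p)`. -/
theorem norm_four_mul_redNorm_le (h4 : Module.finrank ℚ B = 4)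
    (hB : ∀ x : B, x ≠ 0 → IsUnit x) {p : ℕ} [hp : Fact p.Prime] {R : Subring B}
    (hR : ∀ x : B, ‖((redNorm ℚ x : ℚ) : ℚ_[p])‖ ≤ 1 → x ∈ localAt R p)
    {x : B} (hx : x ∈ localDualAt R p) : ‖((4 * redNorm ℚ x : ℚ) : ℚ_[p])‖ ≤ p := by
  have hp0 : (p : ℚ) ≠ 0 := by exact_mod_cast hp.out.ne_zero
  have hp1 : (1 : ℝ) < p := by exact_mod_cast hp.out.one_lt
  by_contra! hlt
  -- the norm takes integral powers of `p` as values, so a violation is one by a factor `p`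
  have hsq : (p : ℝ) ^ 2 ≤ ‖((4 * redNorm ℚ x : ℚ) : ℚ_[p])‖ := by
    by_contra! h2
    have := (Padic.norm_le_pow_iff_norm_lt_pow_add_one ((4 * redNorm ℚ x : ℚ) : ℚ_[p]) 1).mpr
      (by exact_mod_cast h2)
    rw [zpow_one] at this
    exact absurd this (not_le.mpr hlt)
  set n := redNorm ℚ x with hn
  have hn0 : n ≠ 0 := by
    intro h; rw [h] at hlt; simp at hlt
    linarith
  set c : ℚ := 1 / (2 * p) with hc
  have hy : ‖((redNorm ℚ ((c / n) • x) : ℚ) : ℚ_[p])‖ ≤ 1 := by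
    have hval : redNorm ℚ ((c / n) • x) = 1 / (p ^ 2 * (4 * n)) := by
      rw [redNorm_smul, ← hn, hc]; field_simp; norm_num
    have hP : ‖(((p : ℚ) : ℚ) : ℚ_[p])‖ = (p : ℝ)⁻¹ := by
      rw [Rat.cast_natCast]; exact Padic.norm_p
    rw [hval, Rat.cast_div, Rat.cast_mul, norm_div, norm_mul, Rat.cast_pow, norm_pow, hP,
      Rat.cast_one, norm_one]
    have hpos := (pow_pos (zero_lt_one.trans hp1) 2).trans_le hsq
    rw [div_le_one (by positivity), inv_pow, ← div_eq_inv_mul, le_div_iff₀ (by positivity), one_mul]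
    exact hsq
  obtain ⟨m, hm, hmem⟩ := hR _ hy
  have h := Padic.norm_rat_le_one (p := p) (hx _ hmem)
  have hval : redTrace ℚ B (x * stdConj ℚ B (m • (c / n) • x)) = m / p := by
    have hs : stdConj ℚ B (m • (c / n) • x) = (m * (c / n) : ℚ) • stdConj ℚ B x := by
      rw [← Nat.cast_smul_eq_nsmul ℚ, smul_smul, stdConj, stdConj, redTrace_smul, smul_sub, map_mul,
        ← Algebra.smul_def]
    rw [hs, mul_smul_comm, redTrace_smul, mul_stdConj h4 hB, redTrace_algebraMap h4, ← hn, hc]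
    field_simp
  rw [hval, Rat.cast_div, norm_div, Rat.cast_natCast, Rat.cast_natCast,
    norm_natCast_eq_one_of_not_dvd hm, Padic.norm_p, one_div, inv_inv] at h
  linarith

/-- At a ramified prime, commutators of elements of an order have norm divisible by `p`: the
residue ring of the order is a finite domain, hence commutative. -/
theorem norm_redNorm_commutator_lt (h4 : Module.finrank ℚ B = 4)
    (hB : ∀ x : B, x ≠ 0 → IsUnit x) {p : ℕ} [hp : Fact p.Prime] (hram : IsRamifiedAt B p)
    {R : Subring B} (hR : IsOrder R) {x y : B} (hx : x ∈ R) (hy : y ∈ R) :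
    ‖((redNorm ℚ (x * y - y * x) : ℚ) : ℚ_[p])‖ < 1 := by
  have hle : ∀ z : R, ‖((redNorm ℚ (z : B) : ℚ) : ℚ_[p])‖ ≤ 1 := by
    intro z
    obtain ⟨k, hk⟩ := (hR.exists_int h4 hB z.2).2
    rw [← hk, Rat.cast_intCast]; exact Padic.norm_int_le_one k
  let I : Ideal R :=
    { carrier := {z | ‖((redNorm ℚ (z : B) : ℚ) : ℚ_[p])‖ < 1}
      zero_mem' := by simp [redNorm, redTrace_zero]
      add_mem' := by
        intro a b ha hb
        exact (norm_redNorm_add_le h4 hB hram (le_max_left _ _) (le_max_right _ _)).trans_lt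
          (max_lt ha hb)
      smul_mem' := by
        intro c a ha
        simp only [Set.mem_ofPred_eq, smul_eq_mul, Subring.coe_mul, redNorm_mul h4 hB, Rat.cast_mul,
          norm_mul] at ha ⊢
        exact (mul_le_of_le_one_left (norm_nonneg _) (hle c)).trans_lt ha }
  have hI : ∀ z : R, z ∈ I ↔ ‖((redNorm ℚ (z : B) : ℚ) : ℚ_[p])‖ < 1 := fun z => Iff.rfl
  have : I.IsTwoSided := ⟨fun {a} b ha => by
    rw [hI, Subring.coe_mul, redNorm_mul h4 hB, Rat.cast_mul, norm_mul] at *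
    exact (mul_le_of_le_one_right (norm_nonneg _) (hle b)).trans_lt ha⟩
  have hpI : ∀ z : R, (p : ℤ) • z ∈ I := by
    intro z
    rw [hI]
    have : (((p : ℤ) • z : R) : B) = p • (z : B) := by simp
    rw [this, redNorm_nsmul, Rat.cast_mul, norm_mul, Rat.cast_pow, norm_pow, Rat.cast_natCast]
    have hp1 : ‖(p : ℚ_[p])‖ < 1 := Padic.norm_natCast_lt_one_iff.mpr dvd_rfl
    exact (mul_le_of_le_one_right (by positivity) (hle z)).trans_lt
      (pow_lt_one₀ (norm_nonneg _) hp1 two_ne_zero)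
  have := hR.finite
  have hfg : Module.Finite ℤ (R ⧸ I) :=
    Module.Finite.of_surjective (Ideal.Quotient.mk I).toAddMonoidHom.toIntLinearMap
      Ideal.Quotient.mk_surjective
  have hfin : Finite (R ⧸ I) := by
    refine Module.finite_of_fg_torsion _ fun {z} => ?_
    obtain ⟨z, rfl⟩ := Ideal.Quotient.mk_surjective z
    refine ⟨⟨(p : ℤ), mem_nonZeroDivisors_of_ne_zero (by exact_mod_cast hp.out.ne_zero)⟩, ?_⟩
    have := Ideal.Quotient.eq_zero_iff_mem.mpr (hpI z)
    rwa [map_zsmul] at this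
  have hnt : Nontrivial (R ⧸ I) := by
    refine ⟨1, 0, fun h => ?_⟩
    have h1 : (1 : R) ∈ I := Ideal.Quotient.eq_zero_iff_mem.mp (by simpa using h)
    rw [hI, Subring.coe_one, redNorm_one h4] at h1
    simp at h1
  have hnz : NoZeroDivisors (R ⧸ I) := by
    refine ⟨fun {a b} hab => ?_⟩
    obtain ⟨a, rfl⟩ := Ideal.Quotient.mk_surjective a
    obtain ⟨b, rfl⟩ := Ideal.Quotient.mk_surjective b
    rw [← map_mul, Ideal.Quotient.eq_zero_iff_mem, hI, Subring.coe_mul, redNorm_mul h4 hB,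
      Rat.cast_mul, norm_mul] at hab
    rw [Ideal.Quotient.eq_zero_iff_mem, Ideal.Quotient.eq_zero_iff_mem, hI, hI]
    by_contra! hcon
    exact absurd hab (not_lt.mpr (one_le_mul_of_one_le_of_one_le hcon.1 hcon.2))
  have hdom : IsDomain (R ⧸ I) := NoZeroDivisors.to_isDomain _
  have hcomm := (Finite.isDomain_to_isField (R ⧸ I)).mul_comm
    (Ideal.Quotient.mk I ⟨x, hx⟩) (Ideal.Quotient.mk I ⟨y, hy⟩)
  rw [← map_mul, ← map_mul, Ideal.Quotient.eq, hI] at hcomm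
  exact hcomm

end Ramified

/-! ### Primes dividing the level -/

section Level

/-- Integral matrices of level `p` are upper triangular modulo `p`, so their commutators are
strictly upper triangular modulo `p`. -/
theorem norm_commutator_of_level {p : ℕ} [hp : Fact p.Prime]
    {X Y Z : Matrix (Fin 2) (Fin 2) ℚ_[p]}
    (hX : (∀ i j, ‖X i j‖ ≤ 1) ∧ ‖X 1 0‖ ≤ ‖(p : ℚ_[p])‖)
    (hY : (∀ i j, ‖Y i j‖ ≤ 1) ∧ ‖Y 1 0‖ ≤ ‖(p : ℚ_[p])‖)
    (hZ : (∀ i j, ‖Z i j‖ ≤ 1) ∧ ‖Z 1 0‖ ≤ ‖(p : ℚ_[p])‖) :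
    ‖(X * Y - Y * X).det‖ ≤ ‖(p : ℚ_[p])‖ ∧ ‖((X * Y - Y * X) * Z).trace‖ ≤ ‖(p : ℚ_[p])‖ := by
  have hp0 : (p : ℚ_[p]) ≠ 0 := by exact_mod_cast hp.out.ne_zero
  have hform : ∀ {M : Matrix (Fin 2) (Fin 2) ℚ_[p]},
      (∀ i j, ‖M i j‖ ≤ 1) ∧ ‖M 1 0‖ ≤ ‖(p : ℚ_[p])‖ →
      ∃ a b c d : ℤ_[p], M = !![(a : ℚ_[p]), (b : ℚ_[p]); p * (c : ℚ_[p]), (d : ℚ_[p])] := by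
    rintro M ⟨h, h'⟩
    have hc : ‖M 1 0 / p‖ ≤ 1 := by
      rw [norm_div, div_le_one (norm_pos_iff.mpr hp0)]; exact h'
    refine ⟨⟨_, h 0 0⟩, ⟨_, h 0 1⟩, ⟨_, hc⟩, ⟨_, h 1 1⟩, ?_⟩
    ext i j
    fin_cases i <;> fin_cases j <;> simp [mul_div_cancel₀, hp0]
  obtain ⟨a, b, c, d, rfl⟩ := hform hX
  obtain ⟨a', b', c', d', rfl⟩ := hform hY
  obtain ⟨e, f, g, h, rfl⟩ := hform hZ
  have hle : ∀ E : ℤ_[p], ‖(p : ℚ_[p]) * (E : ℚ_[p])‖ ≤ ‖(p : ℚ_[p])‖ := fun E => by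
    rw [norm_mul]; exact mul_le_of_le_one_right (norm_nonneg _) E.2
  constructor
  · convert hle (-p * (b * c' - b' * c) ^ 2
      - (a * b' + b * d' - a' * b - b' * d) * (c * a' + d * c' - c' * a - d' * c)) using 2
    simp [Matrix.det_fin_two]
    ring
  · convert hle ((b * c' - b' * c) * (e - h) + (a * b' + b * d' - a' * b - b' * d) * g
      + (c * a' + d * c' - c' * a - d' * c) * f) using 2
    simp [Matrix.trace_fin_two]
    ring

/-- Norms, commutators and triple products on the dual of the order of integral matrices of level
`p`, which consists of the matrices with entries in `ℤ_p` except for the upper right one in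
`p⁻¹ ℤ_p`. -/
theorem norm_commutator_of_dual_level {p : ℕ} [hp : Fact p.Prime]
    {X Y Z : Matrix (Fin 2) (Fin 2) ℚ_[p]}
    (hX : ‖X 0 0‖ ≤ 1 ∧ ‖X 1 1‖ ≤ 1 ∧ ‖X 1 0‖ ≤ 1 ∧ ‖(p : ℚ_[p]) * X 0 1‖ ≤ 1)
    (hY : ‖Y 0 0‖ ≤ 1 ∧ ‖Y 1 1‖ ≤ 1 ∧ ‖Y 1 0‖ ≤ 1 ∧ ‖(p : ℚ_[p]) * Y 0 1‖ ≤ 1)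
    (hZ : ‖Z 0 0‖ ≤ 1 ∧ ‖Z 1 1‖ ≤ 1 ∧ ‖Z 1 0‖ ≤ 1 ∧ ‖(p : ℚ_[p]) * Z 0 1‖ ≤ 1) :
    ‖p * X.det‖ ≤ 1 ∧ ‖p ^ 2 * (X * Y - Y * X).det‖ ≤ 1 ∧
      ‖p * ((X * Y - Y * X) * Z).trace‖ ≤ 1 := by
  have hp0 : (p : ℚ_[p]) ≠ 0 := by exact_mod_cast hp.out.ne_zero
  have hform : ∀ {M : Matrix (Fin 2) (Fin 2) ℚ_[p]},
      ‖M 0 0‖ ≤ 1 ∧ ‖M 1 1‖ ≤ 1 ∧ ‖M 1 0‖ ≤ 1 ∧ ‖(p : ℚ_[p]) * M 0 1‖ ≤ 1 →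
      ∃ a b c d : ℤ_[p], M = !![(a : ℚ_[p]), (b : ℚ_[p]) / p; (c : ℚ_[p]), (d : ℚ_[p])] := by
    rintro M ⟨h0, h1, h2, h3⟩
    refine ⟨⟨_, h0⟩, ⟨_, h3⟩, ⟨_, h2⟩, ⟨_, h1⟩, ?_⟩
    ext i j
    fin_cases i <;> fin_cases j <;> simp [hp0]
  obtain ⟨a, b, c, d, rfl⟩ := hform hX
  obtain ⟨a', b', c', d', rfl⟩ := hform hY
  obtain ⟨e, f, g, h, rfl⟩ := hform hZ
  refine ⟨?_, ?_, ?_⟩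
  · convert (p * a * d - b * c : ℤ_[p]).2 using 2
    simp [Matrix.det_fin_two]
    field_simp
  · convert (-(b * c' - b' * c) ^ 2 - p * (a * b' + b * d' - a' * b - b' * d)
      * (c * a' + d * c' - c' * a - d' * c) : ℤ_[p]).2 using 2
    simp [Matrix.det_fin_two]
    field_simp
    ring
  · convert ((b * c' - b' * c) * (e - h) + (a * b' + b * d' - a' * b - b' * d) * g
      + (c * a' + d * c' - c' * a - d' * c) * f : ℤ_[p]).2 using 2
    simp [Matrix.trace_fin_two]
    field_simp
    ring

variable {B : Type*} [Ring B] [Algebra ℚ B] {p : ℕ} [hp : Fact p.Prime]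

theorem trace_algEquiv_tmul [Module.Finite ℚ B]
    (φ : (ℚ_[p] ⊗[ℚ] B) ≃ₐ[ℚ_[p]] Matrix (Fin 2) (Fin 2) ℚ_[p]) (x : B) :
    (φ (1 ⊗ₜ x)).trace = ((redTrace ℚ B x : ℚ) : ℚ_[p]) := by
  rw [← redTrace_matrix, redTrace_algEquiv, redTrace_baseChange]; rfl

theorem det_algEquiv_tmul [Module.Finite ℚ B]
    (φ : (ℚ_[p] ⊗[ℚ] B) ≃ₐ[ℚ_[p]] Matrix (Fin 2) (Fin 2) ℚ_[p]) (x : B) :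
    (φ (1 ⊗ₜ x)).det = ((redNorm ℚ x : ℚ) : ℚ_[p]) := by
  rw [← redNorm_matrix, redNorm_algEquiv, redNorm_baseChange]; rfl

theorem tmul_commutator (φ : (ℚ_[p] ⊗[ℚ] B) ≃ₐ[ℚ_[p]] Matrix (Fin 2) (Fin 2) ℚ_[p]) (x y : B) :
    φ (1 ⊗ₜ (x * y - y * x))
      = φ (1 ⊗ₜ x) * φ (1 ⊗ₜ y) - φ (1 ⊗ₜ y) * φ (1 ⊗ₜ x) := by
  rw [← map_mul, ← map_mul, ← map_sub]
  simp [TensorProduct.tmul_sub]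

theorem mem_localStdOrder_of_mem_localAt {R : Subring B} {N : ℕ}
    {φ : (ℚ_[p] ⊗[ℚ] B) ≃ₐ[ℚ_[p]] Matrix (Fin 2) (Fin 2) ℚ_[p]}
    (hφ : φ '' (completionAt R p : Set (ℚ_[p] ⊗[ℚ] B)) = localStdOrder N p)
    {x : B} (hx : x ∈ localAt R p) : φ (1 ⊗ₜ x) ∈ localStdOrder N p := by
  obtain ⟨n, hn, hx⟩ := hx
  have h1 : φ (1 ⊗ₜ (n • x)) ∈ localStdOrder N p := by
    rw [← hφ]
    exact ⟨_, Submodule.subset_span ⟨_, hx, rfl⟩, rfl⟩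
  have h2 : φ (1 ⊗ₜ (n • x)) = (n : ℚ_[p]) • φ (1 ⊗ₜ x) := by
    rw [TensorProduct.tmul_smul, map_nsmul, Nat.cast_smul_eq_nsmul]
  have hn1 := norm_natCast_eq_one_of_not_dvd hn
  rw [h2] at h1
  simpa [localStdOrder, hn1] using h1

theorem norm_entries_of_mem_localDualAt [Module.Finite ℚ B] {R : Subring B} {N : ℕ}
    {φ : (ℚ_[p] ⊗[ℚ] B) ≃ₐ[ℚ_[p]] Matrix (Fin 2) (Fin 2) ℚ_[p]}
    (hφ : φ '' (completionAt R p : Set (ℚ_[p] ⊗[ℚ] B)) = localStdOrder N p)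
    {x : B} (hx : x ∈ localDualAt R p) :
    ‖φ (1 ⊗ₜ x) 0 0‖ ≤ 1 ∧ ‖φ (1 ⊗ₜ x) 1 1‖ ≤ 1 ∧ ‖φ (1 ⊗ₜ x) 1 0‖ ≤ 1 ∧
      ‖(N : ℚ_[p]) * φ (1 ⊗ₜ x) 0 1‖ ≤ 1 := by
  set M := φ (1 ⊗ₜ x) with hM
  have key : ∀ Y ∈ localStdOrder N p, ‖M.trace * Y.trace - (M * Y).trace‖ ≤ 1 := by
    intro Y hY
    rw [← hφ] at hY
    obtain ⟨u, hu, rfl⟩ := hY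
    induction hu using Submodule.span_induction with
    | mem u hu =>
      obtain ⟨y, hy, rfl⟩ := hu
      have h := Padic.norm_rat_le_one (hx y hy)
      have h' : x * stdConj ℚ B y = redTrace ℚ B y • x - x * y := by
        rw [stdConj, mul_sub, ← Algebra.commutes, Algebra.smul_def]
      rw [h', redTrace_sub, redTrace_smul] at h
      have h3 : M * φ (1 ⊗ₜ y) = φ (1 ⊗ₜ (x * y)) := by rw [hM, ← map_mul]; simp
      dsimp only
      rw [h3, hM, trace_algEquiv_tmul, trace_algEquiv_tmul, trace_algEquiv_tmul, mul_comm]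
      exact_mod_cast h
    | zero => simp
    | add a b _ _ iha ihb =>
      rw [map_add, Matrix.trace_add, mul_add, mul_add, Matrix.trace_add, add_sub_add_comm]
      exact (Padic.nonarchimedean _ _).trans (max_le iha ihb)
    | smul c a _ iha =>
      obtain ⟨k, hk, hck⟩ : ∃ k : ℚ_[p], ‖k‖ ≤ 1 ∧ φ (c • a) = k • φ a :=
        ⟨c, c.2, by rw [← map_smul]; rfl⟩
      rw [hck, Matrix.mul_smul, Matrix.trace_smul, Matrix.trace_smul, mul_smul_comm, ← smul_sub,
        norm_smul]
      exact mul_le_one₀ hk (norm_nonneg _) iha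
  have hN : ‖(N : ℚ_[p])‖ ≤ 1 := by exact_mod_cast Padic.norm_int_le_one (p := p) N
  have mem : ∀ a b c d : ℚ_[p], ‖a‖ ≤ 1 → ‖b‖ ≤ 1 → ‖c‖ ≤ ‖(N : ℚ_[p])‖ → ‖d‖ ≤ 1 →
      !![a, b; c, d] ∈ localStdOrder N p := by
    intro a b c d ha hb hc hd
    refine ⟨fun i j => ?_, by simpa using hc⟩
    fin_cases i <;> fin_cases j <;> simp [*, hc.trans hN]
  have h1 := key _ (mem 0 0 0 1 (by simp) (by simp) (by simp) (by simp))
  have h2 := key _ (mem 1 0 0 0 (by simp) (by simp) (by simp) (by simp))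
  have h3 := key _ (mem 0 1 0 0 (by simp) (by simp) (by simp) (by simp))
  have h4 := key _ (mem 0 0 N 0 (by simp) (by simp) le_rfl (by simp))
  simp [Matrix.trace_fin_two, Matrix.mul_apply] at h1 h2 h3 h4
  refine ⟨h1, h2, h3, by rwa [norm_mul, mul_comm]⟩

end Level

/-! ### Integrality on the partially dualized lattices -/

section Global

variable {B : Type*} [Ring B] [Algebra ℚ B]

/-- The reduced discriminant of an algebra with an Eichler order is squarefree, and its prime
divisors ramify: the level condition at the primes not dividing it forces the set of ramified primes
to be finite. -/
theorem IsEichlerOrder.redDisc {R : Subring B} {N : ℕ} (hR : IsEichlerOrder R N) :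
    Squarefree (redDisc B) ∧ ∀ (p : ℕ) [Fact p.Prime], p ∣ redDisc B → IsRamifiedAt B p := by
  by_cases hfin : (ramifiedPrimes B).Finite
  · have heq : QuatLattice.redDisc B = ∏ p ∈ hfin.toFinset, p :=
      finprod_mem_eq_finite_toFinset_prod _ hfin
    have hmem : ∀ p ∈ hfin.toFinset, p.Prime := fun p h => (hfin.mem_toFinset.mp h).1
    constructor
    · rw [heq]
      refine Finset.squarefree_prod_of_pairwise_isCoprime (fun p hp q hq hpq => ?_)
        fun p hp => (hmem p hp).prime.squarefree
      exact Nat.coprime_iff_isRelPrime.mp ((Nat.coprime_primes (hmem p hp) (hmem q hq)).mpr hpq)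
    · intro p hp hd
      rw [heq, Prime.dvd_finsetProd_iff hp.out.prime] at hd
      obtain ⟨q, hq, hpq⟩ := hd
      obtain rfl := (Nat.prime_dvd_prime_iff_eq hp.out (hmem q hq)).mp hpq
      exact (hfin.mem_toFinset.mp hq).2
  · exfalso
    have hone : QuatLattice.redDisc B = 1 := by
      refine finprod_mem_eq_one_of_infinite ?_
      have : ramifiedPrimes B ∩ Function.mulSupport (fun p : ℕ => p) = ramifiedPrimes B :=
        Set.inter_eq_left.mpr fun p hp => hp.1.ne_one
      rwa [this]
    refine hfin (Set.Finite.subset Set.finite_empty ?_)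
    rintro p ⟨hp, hram⟩
    have := Fact.mk hp
    obtain ⟨φ, -⟩ := hR.level p (by rw [hone]; exact fun h => hp.one_lt.ne' (Nat.dvd_one.mp h))
    exact (hram.false φ).elim

theorem IsEichlerOrder.squarefree {R : Subring B} {N : ℕ} (hR : IsEichlerOrder R N)
    (hN : Squarefree N) : Squarefree (QuatLattice.redDisc B * N) :=
  Nat.squarefree_mul_iff.mpr ⟨hR.coprime.symm, hR.redDisc.1, hN⟩

theorem IsEichlerOrder.isOrder {R : Subring B} {N : ℕ} (hR : IsEichlerOrder R N) : IsOrder R := by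
  obtain ⟨O₁, O₂, h₁, h₂, rfl⟩ := hR.eq_inf
  exact h₁.prop.inf h₂.prop

theorem norm_natCast_of_squarefree {p : ℕ} [hp : Fact p.Prime] {n : ℕ} (hn : Squarefree n)
    (hd : p ∣ n) : ‖(n : ℚ_[p])‖ = (p : ℝ)⁻¹ := by
  obtain ⟨m, rfl⟩ := hd
  have hm : ¬ p ∣ m := by
    rintro ⟨k, rfl⟩
    exact hp.out.one_lt.ne' (Nat.isUnit_iff.mp (hn p ⟨k, by ring⟩))
  rw [Nat.cast_mul, norm_mul, Padic.norm_p, norm_natCast_eq_one_of_not_dvd hm, mul_one]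

variable [Algebra.IsCentral ℚ B] [Nontrivial B]

/-- The local bounds for norms, commutators and triple products on `R(ℓ)` at a prime `p`. The powers
of two absorb the loss at a ramified `2`, where the elements of the dual are only controlled up to
`4 nr x`. -/
theorem norm_partialDual_le (h4 : Module.finrank ℚ B = 4) (hB : ∀ x : B, x ≠ 0 → IsUnit x)
    {R : Subring B} {N l : ℕ} (hR : IsEichlerOrder R N) (hN : Squarefree N)
    (hl : l ∣ redDisc B * N) (p : ℕ) [hp : Fact p.Prime] {x y z : B}
    (hx : x ∈ partialDual R l) (hy : y ∈ partialDual R l) (hz : z ∈ partialDual R l) :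
    ‖((l * (4 * redNorm ℚ x) : ℚ) : ℚ_[p])‖ ≤ 1 ∧
    ‖((l ^ 3 * (16 * redNorm ℚ (x * y - y * x)) : ℚ) : ℚ_[p])‖ ≤
      ‖((redDisc B * N : ℕ) : ℚ_[p])‖ ∧
    ‖((l ^ 2 * (8 * redTrace ℚ B ((x * y - y * x) * z)) : ℚ) : ℚ_[p])‖ ≤
      ‖((redDisc B * N : ℕ) : ℚ_[p])‖ := by
  have : Module.Finite ℚ B := Module.finite_of_finrank_pos (by omega)
  have hO := hR.isOrder
  have hD := hR.squarefree hN
  have hp1 : (1 : ℝ) < p := by exact_mod_cast hp.out.one_lt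
  have hint : ∀ m : ℕ, ‖(m : ℚ_[p])‖ ≤ 1 := fun m => by
    exact_mod_cast Padic.norm_int_le_one (p := p) m
  have h2 : ‖(2 : ℚ_[p])‖ ≤ 1 := by exact_mod_cast hint 2
  -- multiplication by integers does not increase `p`-adic norms
  have hweak : ∀ (m k : ℕ) (q : ℚ) (r : ℝ), ‖(q : ℚ_[p])‖ ≤ r →
      ‖((m * (k * q) : ℚ) : ℚ_[p])‖ ≤ r := by
    intro m k q r h
    rw [Rat.cast_mul, Rat.cast_mul, norm_mul, norm_mul, Rat.cast_natCast, Rat.cast_natCast]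
    exact (mul_le_of_le_one_left (by positivity) (hint m)).trans
      ((mul_le_of_le_one_left (norm_nonneg _) (hint k)).trans h)
  by_cases hpl : p ∣ l
  · have hpD : p ∣ redDisc B * N := hpl.trans hl
    have hlN : ‖(l : ℚ_[p])‖ = (p : ℝ)⁻¹ := norm_natCast_of_squarefree (hD.squarefree_of_dvd hl) hpl
    rw [norm_natCast_of_squarefree hD hpD]
    have hx := (hx p hp.out).1 hpl
    have hy := (hy p hp.out).1 hpl
    have hz := (hz p hp.out).1 hpl
    rcases hp.out.dvd_mul.mp hpD with hd | hd
    -- `p` ramified: `R_p` consists of all elements of integral norm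
    · have hram := hR.redDisc.2 p hd
      obtain ⟨O₁, O₂, h₁, h₂, rfl⟩ := hR.eq_inf
      have hS : ∀ w : B, ‖((redNorm ℚ w : ℚ) : ℚ_[p])‖ ≤ 1 → w ∈ localAt (O₁ ⊓ O₂) p := by
        intro w hw
        obtain ⟨n, hn, hnw⟩ := h₁.mem_localAt h4 hB hram hw
        obtain ⟨m, hm, hmw⟩ := h₂.mem_localAt h4 hB hram hw
        refine ⟨n * m, fun h => (hp.out.dvd_mul.mp h).elim hn hm, ?_, ?_⟩
        · rw [mul_comm, mul_smul]; exact O₁.nsmul_mem hnw m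
        · rw [mul_smul]; exact O₂.nsmul_mem hmw n
      have bx := norm_four_mul_redNorm_le h4 hB hS hx
      have by' := norm_four_mul_redNorm_le h4 hB hS hy
      have bz := norm_four_mul_redNorm_le h4 hB hS hz
      have h44 : ∀ u v : B, ‖((4 * redNorm ℚ u : ℚ) : ℚ_[p])‖ ≤ p →
          ‖((4 * redNorm ℚ v : ℚ) : ℚ_[p])‖ ≤ p →
          ‖((redNorm ℚ (((4 : ℚ) • (u * v))) : ℚ) : ℚ_[p])‖ ≤ (p : ℝ) ^ 2 := by
        intro u v hu hv
        have : redNorm ℚ (((4 : ℚ) • (u * v))) = (4 * redNorm ℚ u) * (4 * redNorm ℚ v) := by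
          rw [redNorm_smul, redNorm_mul h4 hB]; ring
        rw [this, Rat.cast_mul, norm_mul, sq]
        exact mul_le_mul hu hv (norm_nonneg _) (by positivity)
      have hcomm : ‖((16 * redNorm ℚ (x * y - y * x) : ℚ) : ℚ_[p])‖ ≤ (p : ℝ) ^ 2 := by
        have := norm_redNorm_sub_le h4 hB hram (h44 x y bx by') (h44 y x by' bx)
        rw [← smul_sub, redNorm_smul] at this
        norm_num at this ⊢
        exact this
      refine ⟨?_, ?_, ?_⟩
      · rw [Rat.cast_mul, norm_mul, Rat.cast_natCast, hlN]
        exact (inv_mul_le_one₀ (by positivity)).mpr bx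
      · rw [Rat.cast_mul, norm_mul, Rat.cast_pow, Rat.cast_natCast, norm_pow, hlN]
        calc _ ≤ ((p : ℝ)⁻¹) ^ 3 * (p : ℝ) ^ 2 := by gcongr
          _ = _ := by field_simp
      · -- `|tr u|² ≤ |nr u|` with `|nr u| ≤ p³` leaves `|tr u| ≤ p`, as norms are powers of `p`
        have htr : ‖((8 * redTrace ℚ B ((x * y - y * x) * z) : ℚ) : ℚ_[p])‖ ≤ p := by
          have h := norm_redTrace_sq_le h4 hB hram ((8 : ℚ) • ((x * y - y * x) * z))
          rw [redTrace_smul, redNorm_smul, redNorm_mul h4 hB,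
            show (8 : ℚ) ^ 2 * (redNorm ℚ (x * y - y * x) * redNorm ℚ z)
              = (16 * redNorm ℚ (x * y - y * x)) * (4 * redNorm ℚ z) by ring,
            Rat.cast_mul (16 * _), norm_mul] at h
          have h3 := h.trans (mul_le_mul hcomm bz (norm_nonneg _) (by positivity))
          have h4' : ‖((8 * redTrace ℚ B ((x * y - y * x) * z) : ℚ) : ℚ_[p])‖ < (p : ℝ) ^ 2 := by
            refine lt_of_pow_lt_pow_left₀ 2 (by positivity) (h3.trans_lt ?_)
            rw [← pow_succ, ← pow_mul]
            exact pow_lt_pow_right₀ hp1 (by norm_num)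
          have := (Padic.norm_le_pow_iff_norm_lt_pow_add_one
            ((8 * redTrace ℚ B ((x * y - y * x) * z) : ℚ) : ℚ_[p]) 1).mpr (by exact_mod_cast h4')
          rwa [zpow_one] at this
        rw [Rat.cast_mul, norm_mul, Rat.cast_pow, Rat.cast_natCast, norm_pow, hlN]
        calc _ ≤ ((p : ℝ)⁻¹) ^ 2 * (p : ℝ) := by gcongr
          _ = _ := by field_simp
    · have hnd : ¬ p ∣ redDisc B := fun h =>
        Nat.Prime.not_coprime_iff_dvd.mpr ⟨p, hp.out, hd, h⟩ hR.coprime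
      obtain ⟨φ, hφ⟩ := hR.level p hnd
      have hNp : ‖(N : ℚ_[p])‖ = ‖(p : ℚ_[p])‖ := by
        rw [norm_natCast_of_squarefree hN hd, Padic.norm_p]
      have ent : ∀ {w : B}, w ∈ localDualAt R p → ‖φ (1 ⊗ₜ w) 0 0‖ ≤ 1 ∧ ‖φ (1 ⊗ₜ w) 1 1‖ ≤ 1 ∧
          ‖φ (1 ⊗ₜ w) 1 0‖ ≤ 1 ∧ ‖(p : ℚ_[p]) * φ (1 ⊗ₜ w) 0 1‖ ≤ 1 := by
        intro w hw
        have := norm_entries_of_mem_localDualAt hφ hw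
        rwa [norm_mul, hNp, ← norm_mul] at this
      obtain ⟨b1, b2, b3⟩ := norm_commutator_of_dual_level (ent hx) (ent hy) (ent hz)
      rw [← tmul_commutator] at b2 b3
      rw [← map_mul, Algebra.TensorProduct.tmul_mul_tmul, one_mul, trace_algEquiv_tmul] at b3
      rw [det_algEquiv_tmul] at b1 b2
      rw [norm_mul, Padic.norm_p, inv_mul_le_one₀ (by positivity)] at b1 b3
      rw [norm_mul, norm_pow, Padic.norm_p, inv_pow, inv_mul_le_one₀ (by positivity)] at b2
      have hk : ∀ (k : ℕ) (q : ℚ) (r : ℝ), ‖(q : ℚ_[p])‖ ≤ r → ‖((k * q : ℚ) : ℚ_[p])‖ ≤ r := by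
        intro k q r h
        simpa using hweak 1 k q r h
      refine ⟨?_, ?_, ?_⟩
      · rw [Rat.cast_mul, norm_mul, Rat.cast_natCast, hlN]
        exact (inv_mul_le_one₀ (by positivity)).mpr (by exact_mod_cast hk 4 _ _ b1)
      · rw [Rat.cast_mul, norm_mul, Rat.cast_pow, Rat.cast_natCast, norm_pow, hlN]
        calc _ ≤ ((p : ℝ)⁻¹) ^ 3 * (p : ℝ) ^ 2 := by
              gcongr
              exact_mod_cast hk 16 _ _ b2
          _ = _ := by field_simp
      · rw [Rat.cast_mul, norm_mul, Rat.cast_pow, Rat.cast_natCast, norm_pow, hlN]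
        calc _ ≤ ((p : ℝ)⁻¹) ^ 2 * (p : ℝ) := by
              gcongr
              exact_mod_cast hk 8 _ _ b3
          _ = _ := by field_simp
  · have hx := (hx p hp.out).2 hpl
    have hy := (hy p hp.out).2 hpl
    have hz := (hz p hp.out).2 hpl
    refine ⟨by exact_mod_cast hweak l 4 _ _ (norm_redNorm_le_one h4 hB hO hx), ?_⟩
    suffices h : ‖((redNorm ℚ (x * y - y * x) : ℚ) : ℚ_[p])‖ ≤ ‖((redDisc B * N : ℕ) : ℚ_[p])‖ ∧
        ‖((redTrace ℚ B ((x * y - y * x) * z) : ℚ) : ℚ_[p])‖ ≤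
          ‖((redDisc B * N : ℕ) : ℚ_[p])‖ from
      ⟨by exact_mod_cast hweak (l ^ 3) 16 _ _ h.1, by exact_mod_cast hweak (l ^ 2) 8 _ _ h.2⟩
    have hxy : x * y - y * x ∈ localAt R p := localAt_sub (localAt_mul hx hy) (localAt_mul hy hx)
    by_cases hpD : p ∣ redDisc B * N
    · rw [norm_natCast_of_squarefree hD hpD]
      rcases hp.out.dvd_mul.mp hpD with hd | hd
      · have hram := hR.redDisc.2 p hd
        have hlt : ‖((redNorm ℚ (x * y - y * x) : ℚ) : ℚ_[p])‖ < 1 := by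
          obtain ⟨n, hn, hnx⟩ := hx
          obtain ⟨m, hm, hmy⟩ := hy
          have h := norm_redNorm_commutator_lt h4 hB hram hO hnx hmy
          rw [smul_mul_smul_comm, smul_mul_smul_comm, mul_comm m n, ← smul_sub, redNorm_nsmul,
            Rat.cast_mul, norm_mul, Rat.cast_pow, norm_pow, Rat.cast_natCast, Nat.cast_mul,
            norm_mul, norm_natCast_eq_one_of_not_dvd hn, norm_natCast_eq_one_of_not_dvd hm] at h
          simpa using h
        have hpow : ∀ q : ℚ_[p], ‖q‖ < 1 → ‖q‖ ≤ (p : ℝ)⁻¹ := by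
          intro q hq
          have := (Padic.norm_le_pow_iff_norm_lt_pow_add_one q (-1)).mpr (by simpa using hq)
          rwa [zpow_neg_one] at this
        refine ⟨hpow _ hlt, hpow _ ?_⟩
        have h := norm_redTrace_sq_le h4 hB hram ((x * y - y * x) * z)
        rw [redNorm_mul h4 hB, Rat.cast_mul, norm_mul] at h
        have h' := h.trans_lt ((mul_le_of_le_one_right (norm_nonneg _)
          (norm_redNorm_le_one h4 hB hO hz)).trans_lt hlt)
        exact (sq_lt_one_iff₀ (norm_nonneg _)).mp h'
      · have hnd : ¬ p ∣ redDisc B := fun h =>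
          Nat.Prime.not_coprime_iff_dvd.mpr ⟨p, hp.out, hd, h⟩ hR.coprime
        obtain ⟨φ, hφ⟩ := hR.level p hnd
        have hNp : ‖(N : ℚ_[p])‖ = ‖(p : ℚ_[p])‖ := by
          rw [norm_natCast_of_squarefree hN hd, Padic.norm_p]
        have ent : ∀ {w : B}, w ∈ localAt R p → (∀ i j, ‖φ (1 ⊗ₜ w) i j‖ ≤ 1) ∧
            ‖φ (1 ⊗ₜ w) 1 0‖ ≤ ‖(p : ℚ_[p])‖ := by
          intro w hw
          have := mem_localStdOrder_of_mem_localAt hφ hw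
          rwa [localStdOrder, Set.mem_ofPred_eq, hNp] at this
        obtain ⟨b2, b3⟩ := norm_commutator_of_level (ent hx) (ent hy) (ent hz)
        rw [← tmul_commutator] at b2 b3
        rw [← map_mul, Algebra.TensorProduct.tmul_mul_tmul, one_mul, trace_algEquiv_tmul] at b3
        rw [det_algEquiv_tmul] at b2
        rw [Padic.norm_p] at b2 b3
        exact ⟨b2, b3⟩
    · rw [norm_natCast_eq_one_of_not_dvd hpD]
      exact ⟨norm_redNorm_le_one h4 hB hO hxy,
        norm_redTrace_le_one h4 hB hO (localAt_mul hxy hz)⟩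

theorem le_abs_of_forall_norm_le {q : ℚ} {n : ℕ} (hn : n ≠ 0) (hq : q ≠ 0)
    (h : ∀ (p : ℕ) [Fact p.Prime], ‖(q : ℚ_[p])‖ ≤ ‖(n : ℚ_[p])‖) : (n : ℚ) ≤ |q| := by
  have hn' : (n : ℚ) ≠ 0 := by exact_mod_cast hn
  obtain ⟨z, hz⟩ := exists_int_eq_of_forall_norm_le_one (q := q / n) fun p _ => by
    have : (n : ℚ_[p]) ≠ 0 := by exact_mod_cast hn
    rw [Rat.cast_div, norm_div, Rat.cast_natCast, div_le_one (norm_pos_iff.mpr this)]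
    exact h p
  have hz0 : z ≠ 0 := by
    rintro rfl
    exact div_ne_zero hq hn' (by rw [← hz]; simp)
  have hz1 : (1 : ℚ) ≤ |(z : ℚ)| := by exact_mod_cast Int.one_le_abs hz0
  have hnp : (0 : ℚ) < n := by positivity
  rwa [hz, abs_div, abs_of_pos hnp, le_div_iff₀ hnp, one_mul] at hz1

/-- The lower bounds for norms, commutators and triple products on `R(ℓ)`: nonzero integers have
absolute value at least one. -/
theorem partialDual_bounds (h4 : Module.finrank ℚ B = 4) (hB : ∀ x : B, x ≠ 0 → IsUnit x)
    {R : Subring B} {N l : ℕ} (hR : IsEichlerOrder R N) (hN : Squarefree N)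
    (hl : l ∣ redDisc B * N) {x y z : B}
    (hx : x ∈ partialDual R l) (hy : y ∈ partialDual R l) (hz : z ∈ partialDual R l) :
    (x ≠ 0 → 1 ≤ l * (4 * |redNorm ℚ x|)) ∧
    (x * y - y * x ≠ 0 →
      ((redDisc B * N : ℕ) : ℚ) ≤ l ^ 3 * (16 * |redNorm ℚ (x * y - y * x)|)) ∧
    (redTrace ℚ B ((x * y - y * x) * z) ≠ 0 →
      ((redDisc B * N : ℕ) : ℚ) ≤ l ^ 2 * (8 * |redTrace ℚ B ((x * y - y * x) * z)|)) := by
  have hD0 := (hR.squarefree hN).ne_zero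
  have hl0 : (l : ℚ) ≠ 0 := by
    have : l ≠ 0 := fun h => hD0 (Nat.eq_zero_of_zero_dvd (h ▸ hl))
    exact_mod_cast this
  have h := fun (p : ℕ) (_ : Fact p.Prime) => norm_partialDual_le h4 hB hR hN hl p hx hy hz
  refine ⟨fun h0 => ?_, fun h0 => ?_, fun h0 => ?_⟩
  · have h0' := mt (redNorm_eq_zero_iff h4 hB).mp h0
    have := le_abs_of_forall_norm_le (q := l * (4 * redNorm ℚ x)) one_ne_zero
      (by positivity) fun p hp => by simpa using (h p hp).1
    simpa [abs_mul] using this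
  · have h0' := mt (redNorm_eq_zero_iff h4 hB).mp h0
    have := le_abs_of_forall_norm_le (q := l ^ 3 * (16 * redNorm ℚ (x * y - y * x))) hD0
      (by positivity) fun p hp => (h p hp).2.1
    simpa [abs_mul] using this
  · have := le_abs_of_forall_norm_le (q := l ^ 2 * (8 * redTrace ℚ B ((x * y - y * x) * z))) hD0
      (by positivity) fun p hp => (h p hp).2.2
    simpa [abs_mul] using this

/-- `R(ℓ)⁰` is nonzero: it contains `2x - tr x` for every `x ∈ R`. -/
theorem exists_ne_zero_mem_partialDualZero (h4 : Module.finrank ℚ B = 4)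
    (hB : ∀ x : B, x ≠ 0 → IsUnit x) {R : Subring B} (hR : IsOrder R) (l : ℕ) :
    ∃ x ∈ partialDualZero R l, x ≠ 0 := by
  obtain ⟨x, hx, hns⟩ : ∃ x ∈ R, x ∉ (algebraMap ℚ B).range := by
    by_contra! hcon
    have hle : Submodule.span ℚ (R : Set B) ≤ Submodule.span ℚ {(1 : B)} := by
      refine Submodule.span_le.mpr fun x hx => ?_
      obtain ⟨q, rfl⟩ := hcon x hx
      rw [Algebra.algebraMap_eq_smul_one]
      exact Submodule.smul_mem _ _ (Submodule.mem_span_singleton_self _)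
    rw [hR.2, top_le_iff] at hle
    have h1 := finrank_span_le_card (R := ℚ) ({1} : Set B)
    rw [hle, finrank_top, h4] at h1
    simp at h1
  obtain ⟨z, hz⟩ := (hR.exists_int h4 hB hx).1
  have halg : ∀ n : ℤ, algebraMap ℚ B (n : ℚ) ∈ R := fun n => by simp
  have hyR : (2 : ℕ) • x - algebraMap ℚ B (z : ℚ) ∈ R := R.sub_mem (R.nsmul_mem hx 2) (halg z)
  refine ⟨_, ⟨fun p hp => ⟨fun _ w hw => ?_, fun _ => ⟨1, ?_, by rwa [one_smul]⟩⟩, ?_⟩, ?_⟩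
  · obtain ⟨k, hk⟩ := (hR.exists_int h4 hB hw).1
    have hsw : stdConj ℚ B w ∈ R := by
      rw [stdConj, ← hk]; exact R.sub_mem (halg k) hw
    obtain ⟨m, hm⟩ := (hR.exists_int h4 hB (R.mul_mem hyR hsw)).1
    rw [← hm]
    simpa using hp.one_lt.ne'
  · exact fun h => hp.one_lt.ne' (Nat.dvd_one.mp h)
  · rw [redTrace_sub, redTrace_nsmul, redTrace_algebraMap h4, hz]; push_cast; ring
  · intro h0
    refine hns ⟨z / 2, ?_⟩
    have h2 : (2 : ℚ) • x = algebraMap ℚ B (z : ℚ) := by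
      rw [← sub_eq_zero, ← h0, ← Nat.cast_smul_eq_nsmul ℚ]; norm_num
    rw [div_eq_inv_mul, map_mul, ← h2, ← Algebra.smul_def, smul_smul]; norm_num

end Global

section Additive

variable {B : Type*} [Ring B] [Algebra ℚ B]

theorem sub_mem_partialDualZero {R : Subring B} {l : ℕ} {x y : B} (hx : x ∈ partialDualZero R l)
    (hy : y ∈ partialDualZero R l) : x - y ∈ partialDualZero R l := by
  refine ⟨fun p hp => ?_, by rw [redTrace_sub, hx.2, hy.2, sub_zero]⟩
  have := Fact.mk hp
  refine ⟨fun hpl w hw => ?_, fun hpl => localAt_sub ((hx.1 p hp).2 hpl) ((hy.1 p hp).2 hpl)⟩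
  rw [sub_mul, redTrace_sub]
  refine not_dvd_den_of_padic_norm_le_one ?_
  rw [Rat.cast_sub, sub_eq_add_neg]
  refine (Padic.nonarchimedean _ _).trans (max_le ?_ ?_)
  · exact Padic.norm_rat_le_one ((hx.1 p hp).1 hpl w hw)
  · rw [norm_neg]; exact Padic.norm_rat_le_one ((hy.1 p hp).1 hpl w hw)

end Additive

/-! ### Counting lattice points in three dimensions -/

section Counting

open scoped Matrix

theorem norm_cross_le (v w : Fin 3 → ℝ) : ‖v ⨯₃ w‖ ≤ 2 * ‖v‖ * ‖w‖ := by
  have h : ∀ i j k l : Fin 3, |v i * w j - v k * w l| ≤ 2 * ‖v‖ * ‖w‖ := by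
    intro i j k l
    have h1 : |v i * w j| ≤ ‖v‖ * ‖w‖ := by
      rw [abs_mul]
      exact mul_le_mul (norm_le_pi_norm v i) (norm_le_pi_norm w j) (abs_nonneg _) (norm_nonneg _)
    have h2 : |v k * w l| ≤ ‖v‖ * ‖w‖ := by
      rw [abs_mul]
      exact mul_le_mul (norm_le_pi_norm v k) (norm_le_pi_norm w l) (abs_nonneg _) (norm_nonneg _)
    linarith [abs_sub (v i * w j) (v k * w l)]
  rw [pi_norm_le_iff_of_nonneg (by positivity)]
  intro i
  rw [Real.norm_eq_abs, cross_apply]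
  fin_cases i <;> exact h _ _ _ _

theorem abs_dotProduct_le (v w : Fin 3 → ℝ) : |v ⬝ᵥ w| ≤ 3 * ‖v‖ * ‖w‖ := by
  have h : ∀ i, |v i * w i| ≤ ‖v‖ * ‖w‖ := by
    intro i
    rw [abs_mul]
    exact mul_le_mul (norm_le_pi_norm v i) (norm_le_pi_norm w i) (abs_nonneg _) (norm_nonneg _)
  rw [dotProduct, Fin.sum_univ_three]
  linarith [abs_add_le (v 0 * w 0 + v 1 * w 1) (v 2 * w 2), abs_add_le (v 0 * w 0) (v 1 * w 1),
    h 0, h 1, h 2]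

theorem exists_abs_apply_eq_norm (v : Fin 3 → ℝ) : ∃ k, |v k| = ‖v‖ := by
  obtain ⟨k, -, hk⟩ := Finset.exists_max_image Finset.univ (fun i => |v i|) Finset.univ_nonempty
  refine ⟨k, le_antisymm (norm_le_pi_norm v k) ?_⟩
  exact (pi_norm_le_iff_of_nonneg (abs_nonneg _)).mpr fun i => hk i (Finset.mem_univ i)

theorem eq_smul_of_cross_eq_zero {v w : Fin 3 → ℝ} {k : Fin 3} (hk : v k ≠ 0)
    (h : v ⨯₃ w = 0) : w = (w k / v k) • v := by
  have h0 := congrFun h 0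
  have h1 := congrFun h 1
  have h2 := congrFun h 2
  simp [cross_apply] at h0 h1 h2
  ext i
  rw [Pi.smul_apply, smul_eq_mul, div_mul_eq_mul_div, eq_div_iff hk]
  fin_cases k <;> fin_cases i <;> simp <;> linarith

theorem cross_cross_cross (u v w : Fin 3 → ℝ) :
    (u ⨯₃ v) ⨯₃ (u ⨯₃ w) = ((u ⨯₃ v) ⬝ᵥ w) • u := by
  ext i
  fin_cases i <;> simp [cross_apply, dotProduct, Fin.sum_univ_three] <;> ring

/-- Slicing a finite set along a real function whose distinct values are `μ`-separated. -/
theorem card_le_of_separated {α : Type*} (S : Finset α) (f : α → ℝ) {M μ K : ℝ} (hμ : 0 < μ)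
    (hM0 : 0 ≤ M) (hK0 : 0 ≤ K) (hM : ∀ x ∈ S, |f x| ≤ M)
    (hsep : ∀ x ∈ S, ∀ y ∈ S, f x ≠ f y → μ ≤ |f x - f y|)
    (hK : ∀ x ∈ S, ((S.filter fun y => f y = f x).card : ℝ) ≤ K) :
    (S.card : ℝ) ≤ (1 + 2 * M / μ) * K := by
  classical
  have himage : ((S.image f).card : ℝ) ≤ 1 + 2 * M / μ := by
    have hcard : (S.image f).card ≤ (Finset.range (⌊2 * M / μ⌋₊ + 1)).card := by
      refine Finset.card_le_card_of_injOn (fun t => ⌊(t + M) / μ⌋₊) ?_ ?_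
      · intro t ht
        obtain ⟨x, hx, rfl⟩ := Finset.mem_image.mp ht
        have := abs_le.mp (hM x hx)
        simp only [Finset.coe_range, Set.mem_Iio]
        exact Nat.lt_succ_of_le (Nat.floor_mono (by gcongr; linarith))
      · intro t ht t' ht' heq
        obtain ⟨x, hx, rfl⟩ := Finset.mem_image.mp ht
        obtain ⟨y, hy, rfl⟩ := Finset.mem_image.mp ht'
        by_contra hne
        have hsep' := hsep x hx y hy hne
        have h1 := abs_le.mp (hM x hx)
        have h2 := abs_le.mp (hM y hy)
        have h3 : (0 : ℝ) ≤ (f x + M) / μ := div_nonneg (by linarith) hμ.le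
        have h4 : (0 : ℝ) ≤ (f y + M) / μ := div_nonneg (by linarith) hμ.le
        have h5 : |(f x + M) / μ - (f y + M) / μ| < 1 := by
          have a1 := Nat.floor_le h3
          have a2 := Nat.lt_floor_add_one ((f x + M) / μ)
          have a3 := Nat.floor_le h4
          have a4 := Nat.lt_floor_add_one ((f y + M) / μ)
          simp only at heq
          rw [heq] at a1 a2
          rw [abs_lt]; constructor <;> linarith
        rw [← sub_div, add_sub_add_right_eq_sub, abs_div, abs_of_pos hμ, div_lt_one hμ] at h5
        linarith
    rw [Finset.card_range] at hcard
    have h0 : 0 ≤ 2 * M / μ := by positivity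
    calc ((S.image f).card : ℝ) ≤ ((⌊2 * M / μ⌋₊ + 1 : ℕ) : ℝ) := by exact_mod_cast hcard
      _ ≤ 1 + 2 * M / μ := by push_cast; linarith [Nat.floor_le h0]
  rw [Finset.card_eq_sum_card_image f S]
  push_cast
  calc ∑ b ∈ S.image f, ((S.filter fun y => f y = b).card : ℝ)
      ≤ ∑ b ∈ S.image f, K := by
        refine Finset.sum_le_sum fun b hb => ?_
        obtain ⟨x, hx, rfl⟩ := Finset.mem_image.mp hb
        exact hK x hx
    _ = (S.image f).card * K := by rw [Finset.sum_const, nsmul_eq_mul]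
    _ ≤ _ := by gcongr

/-- The number of points of a lattice in a cube, bounded through lower bounds for the lengths of
nonzero vectors, the areas of nondegenerate parallelograms and the volumes of nondegenerate
parallelepipeds. The points are sliced along planes and lines parallel to a shortest difference
`v₁` and a difference `v₂` spanning the smallest area with `v₁`. -/
theorem card_lattice_le {Λ : Set (Fin 3 → ℝ)} (hsub : ∀ v ∈ Λ, ∀ w ∈ Λ, v - w ∈ Λ)
    {m₁ m₂ m₃ T : ℝ} (hm₁ : 0 < m₁) (hm₂ : 0 < m₂) (hm₃ : 0 < m₃) (hT : 0 < T)
    (h₁ : ∀ v ∈ Λ, v ≠ 0 → m₁ ≤ ‖v‖)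
    (h₂ : ∀ v ∈ Λ, ∀ w ∈ Λ, v ⨯₃ w ≠ 0 → m₂ ≤ ‖v ⨯₃ w‖)
    (h₃ : ∀ u ∈ Λ, ∀ v ∈ Λ, ∀ w ∈ Λ, (u ⨯₃ v) ⬝ᵥ w ≠ 0 → m₃ ≤ |(u ⨯₃ v) ⬝ᵥ w|)
    (F : Finset (Fin 3 → ℝ)) (hFΛ : ∀ v ∈ F, v ∈ Λ) (hFT : ∀ v ∈ F, ‖v‖ ≤ T) :
    (F.card : ℝ) ≤ 192 * (1 + T / m₁ + T ^ 2 / m₂ + T ^ 3 / m₃) := by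
  classical
  set D := (F ×ˢ F).image (fun x => x.1 - x.2) with hD
  have hDmem : ∀ x ∈ F, ∀ y ∈ F, x - y ∈ D := fun x hx y hy =>
    Finset.mem_image.mpr ⟨(x, y), Finset.mk_mem_product hx hy, rfl⟩
  have hDΛ : ∀ v ∈ D, v ∈ Λ := by
    intro v hv
    obtain ⟨⟨x, y⟩, hxy, rfl⟩ := Finset.mem_image.mp hv
    rw [Finset.mem_product] at hxy
    exact hsub _ (hFΛ _ hxy.1) _ (hFΛ _ hxy.2)
  have hDT : ∀ v ∈ D, ‖v‖ ≤ 2 * T := by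
    intro v hv
    obtain ⟨⟨x, y⟩, hxy, rfl⟩ := Finset.mem_image.mp hv
    rw [Finset.mem_product] at hxy
    exact (norm_sub_le _ _).trans (by linarith [hFT _ hxy.1, hFT _ hxy.2])
  have p1 : 0 < T / m₁ := by positivity
  have p2 : 0 < T ^ 2 / m₂ := by positivity
  have p3 : 0 < T ^ 3 / m₃ := by positivity
  rcases (D.filter (· ≠ 0)).eq_empty_or_nonempty with hE | hE
  · have : F.card ≤ 1 := by
      refine Finset.card_le_one.mpr fun x hx y hy => ?_
      by_contra hne
      exact Finset.eq_empty_iff_forall_notMem.mp hE _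
        (Finset.mem_filter.mpr ⟨hDmem x hx y hy, sub_ne_zero.mpr hne⟩)
    have : (F.card : ℝ) ≤ 1 := by exact_mod_cast this
    linarith
  obtain ⟨v₁, hv₁, hmin₁⟩ := Finset.exists_min_image _ (fun v => ‖v‖) hE
  obtain ⟨hv₁D, hv₁0⟩ := Finset.mem_filter.mp hv₁
  set a := ‖v₁‖ with ha
  have ha0 : 0 < a := norm_pos_iff.mpr hv₁0
  have ham : m₁ ≤ a := h₁ _ (hDΛ _ hv₁D) hv₁0
  have haT : a ≤ 2 * T := hDT _ hv₁D
  obtain ⟨k₁, hk₁⟩ := exists_abs_apply_eq_norm v₁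
  have hk₁0 : v₁ k₁ ≠ 0 := by rw [← abs_pos, hk₁]; exact ha0
  -- a set of points on a line parallel to `v₁`
  have line : ∀ A ⊆ F, (∀ x ∈ A, ∀ y ∈ A, v₁ ⨯₃ (x - y) = 0) → (A.card : ℝ) ≤ 1 + 2 * T / a := by
    intro A hA hpar
    have hs : ∀ x ∈ A, ∀ y ∈ A, x - y = ((x - y) k₁ / v₁ k₁) • v₁ := fun x hx y hy =>
      eq_smul_of_cross_eq_zero hk₁0 (hpar x hx y hy)
    have := card_le_of_separated A (fun v => v k₁) (K := 1) (M := T) ha0 hT.le zero_le_one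
      (fun x hx => (norm_le_pi_norm x k₁).trans (hFT x (hA hx))) ?_ ?_
    · simpa using this
    · intro x hx y hy hne
      have hne' : x - y ≠ 0 := fun h => hne (congrFun (sub_eq_zero.mp h) k₁)
      have hle := hmin₁ _ (Finset.mem_filter.mpr ⟨hDmem x (hA hx) y (hA hy), hne'⟩)
      have hn := congrArg norm (hs x hx y hy)
      rw [norm_smul, norm_div, Real.norm_eq_abs, Real.norm_eq_abs, hk₁, div_mul_cancel₀ _ ha0.ne']
        at hn
      rw [← Pi.sub_apply, ← hn]; exact hle
    · intro x hx
      have : (A.filter fun y => y k₁ = x k₁).card ≤ 1 := by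
        refine Finset.card_le_one.mpr fun y hy z hz => ?_
        rw [Finset.mem_filter] at hy hz
        have h := hs y hy.1 z hz.1
        rw [Pi.sub_apply, hy.2, hz.2, sub_self, zero_div, zero_smul] at h
        exact sub_eq_zero.mp h
      exact_mod_cast this
  have h2Ta : 2 * T / a ≤ 2 * (T / m₁) := by
    rw [mul_div_assoc]; gcongr
  rcases (D.filter fun v => v₁ ⨯₃ v ≠ 0).eq_empty_or_nonempty with hE₂ | hE₂
  · have := line F subset_rfl fun x hx y hy => by
      by_contra hne
      exact Finset.eq_empty_iff_forall_notMem.mp hE₂ _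
        (Finset.mem_filter.mpr ⟨hDmem x hx y hy, hne⟩)
    linarith
  obtain ⟨v₂, hv₂, hmin₂⟩ := Finset.exists_min_image _ (fun v => ‖v₁ ⨯₃ v‖) hE₂
  obtain ⟨hv₂D, hv₂0⟩ := Finset.mem_filter.mp hv₂
  set w := v₁ ⨯₃ v₂ with hw
  set μ := ‖w‖ with hμ
  have hμ0 : 0 < μ := norm_pos_iff.mpr hv₂0
  have hμm : m₂ ≤ μ := h₂ _ (hDΛ _ hv₁D) _ (hDΛ _ hv₂D) hv₂0
  have hμT : μ ≤ 4 * a * T := by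
    have h1 := norm_cross_le v₁ v₂
    have h2 := hDT _ hv₂D
    calc μ ≤ 2 * a * ‖v₂‖ := h1
      _ ≤ 2 * a * (2 * T) := by gcongr
      _ = _ := by ring
  obtain ⟨k₂, hk₂⟩ := exists_abs_apply_eq_norm w
  have hk₂0 : w k₂ ≠ 0 := by rw [← abs_pos, hk₂]; exact hμ0
  have hline0 : 0 ≤ 1 + 2 * T / a := by positivity
  -- a set of points on a plane parallel to `v₁` and `v₂`
  have plane : ∀ A ⊆ F, (∀ x ∈ A, ∀ y ∈ A, w ⬝ᵥ (x - y) = 0) →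
      (A.card : ℝ) ≤ (1 + 2 * (2 * a * T) / μ) * (1 + 2 * T / a) := by
    intro A hA hpar
    have hs : ∀ x ∈ A, ∀ y ∈ A, v₁ ⨯₃ (x - y) = ((v₁ ⨯₃ (x - y)) k₂ / w k₂) • w := by
      intro x hx y hy
      refine eq_smul_of_cross_eq_zero hk₂0 ?_
      rw [hw, cross_cross_cross, ← hw, hpar x hx y hy, zero_smul]
    refine card_le_of_separated A (fun v => (v₁ ⨯₃ v) k₂) hμ0 (by positivity) hline0 ?_ ?_ ?_
    · intro x hx
      refine (norm_le_pi_norm (v₁ ⨯₃ x) k₂).trans ((norm_cross_le v₁ x).trans ?_)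
      have := hFT x (hA hx)
      gcongr
    · intro x hx y hy hne
      rw [← Pi.sub_apply, ← map_sub]
      have hne' : v₁ ⨯₃ (x - y) ≠ 0 := fun h => hne (by
        rw [map_sub] at h
        exact congrFun (sub_eq_zero.mp h) k₂)
      have hle := hmin₂ _ (Finset.mem_filter.mpr ⟨hDmem x (hA hx) y (hA hy), hne'⟩)
      have hn := congrArg norm (hs x hx y hy)
      rw [norm_smul, norm_div, Real.norm_eq_abs, Real.norm_eq_abs, hk₂, div_mul_cancel₀ _ hμ0.ne']
        at hn
      rw [← hn]; exact hle
    · intro x hx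
      refine line _ ((Finset.filter_subset _ _).trans hA) fun y hy z hz => ?_
      rw [Finset.mem_filter] at hy hz
      rw [hs y hy.1 z hz.1, map_sub, Pi.sub_apply, hy.2, hz.2, sub_self, zero_div, zero_smul]
  have hplane0 : 0 ≤ (1 + 2 * (2 * a * T) / μ) * (1 + 2 * T / a) := by positivity
  have main := card_le_of_separated F (fun v => w ⬝ᵥ v) (M := 3 * μ * T) hm₃ (by positivity) hplane0
    (fun x hx => (abs_dotProduct_le w x).trans (by gcongr; exact hFT x hx))
    (fun x hx y hy hne => by
      rw [← dotProduct_sub]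
      refine h₃ _ (hDΛ _ hv₁D) _ (hDΛ _ hv₂D) _ (hDΛ _ (hDmem x hx y hy)) ?_
      rw [← hw, dotProduct_sub]; exact sub_ne_zero.mpr hne)
    (fun x hx => plane _ (Finset.filter_subset _ _) fun y hy z hz => by
      rw [Finset.mem_filter] at hy hz
      rw [dotProduct_sub, hy.2, hz.2, sub_self])
  refine main.trans ?_
  -- expand the product, using `a ≤ 2T` and `μ ≤ 4aT`
  have e1 : a * T / μ ≤ 2 * (T ^ 2 / m₂) := by
    calc a * T / μ ≤ (2 * T) * T / m₂ := by gcongr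
      _ = _ := by ring
  have e2 : T ^ 2 / μ ≤ T ^ 2 / m₂ := by gcongr
  have e3 : μ * T / m₃ ≤ 8 * (T ^ 3 / m₃) := by
    calc μ * T / m₃ ≤ (4 * (2 * T) * T) * T / m₃ := by
          gcongr; exact hμT.trans (by gcongr)
      _ = _ := by ring
  have e4 : μ * T ^ 2 / (a * m₃) ≤ 4 * (T ^ 3 / m₃) := by
    calc μ * T ^ 2 / (a * m₃) ≤ (4 * a * T) * T ^ 2 / (a * m₃) := by gcongr
      _ = _ := by field_simp
  have e5 : a * T ^ 2 / m₃ ≤ 2 * (T ^ 3 / m₃) := by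
    calc a * T ^ 2 / m₃ ≤ (2 * T) * T ^ 2 / m₃ := by gcongr
      _ = _ := by ring
  have e6 : T / a ≤ T / m₁ := by gcongr
  have hexp : (1 + 2 * (3 * μ * T) / m₃) * ((1 + 2 * (2 * a * T) / μ) * (1 + 2 * T / a))
      = 1 + 2 * (T / a) + 4 * (a * T / μ) + 8 * (T ^ 2 / μ) + 6 * (μ * T / m₃)
        + 12 * (μ * T ^ 2 / (a * m₃)) + 24 * (a * T ^ 2 / m₃) + 48 * (T ^ 3 / m₃) := by
    field_simp; ring
  rw [hexp]
  linarith

end Counting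

/-! ### Coordinates on a real quaternion algebra -/

section Coordinates

open scoped Matrix

variable {A : Type*} [Ring A] [Algebra ℝ A] {s : ℝ} (q : QuaternionAlgebra.Basis A (-1 : ℝ) 0 s)

theorem redTrace_units (hs : s ≠ 0) :
    redTrace ℝ A q.i = 0 ∧ redTrace ℝ A q.j = 0 ∧ redTrace ℝ A q.k = 0 := by
  have hji : q.j * q.i = -q.k := by rw [q.j_mul_i]; simp
  have hii : q.i * q.i = -1 := by rw [q.i_mul_i]; simp
  have hij := q.i_mul_j
  have hjj := q.j_mul_j
  refine ⟨?_, ?_, ?_⟩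
  · have h1 : redTrace ℝ A (q.i * q.j * q.j) = s * redTrace ℝ A q.i := by
      rw [mul_assoc, hjj, mul_smul_comm, mul_one, redTrace_smul]
    have h2 : redTrace ℝ A (q.j * (q.i * q.j)) = -(s * redTrace ℝ A q.i) := by
      rw [← mul_assoc, hji, ← hij, neg_mul, mul_assoc, hjj, redTrace_neg, mul_smul_comm, mul_one,
        redTrace_smul]
    rw [redTrace_mul_comm, h2] at h1
    have : s * redTrace ℝ A q.i = 0 := by linarith
    exact (mul_eq_zero.mp this).resolve_left hs
  · have h1 : redTrace ℝ A (q.i * (q.i * q.j)) = -redTrace ℝ A q.j := by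
      rw [← mul_assoc, hii, neg_one_mul, redTrace_neg]
    have h2 : redTrace ℝ A (q.i * q.j * q.i) = redTrace ℝ A q.j := by
      rw [mul_assoc, hji, ← hij, mul_neg, ← mul_assoc, hii, neg_one_mul, neg_neg]
    rw [redTrace_mul_comm, h2] at h1
    linarith
  · have h1 := redTrace_mul_comm (K := ℝ) q.i q.j
    rw [hij, hji, redTrace_neg] at h1
    linarith

theorem redTrace_coordElt (h4 : Module.finrank ℝ A = 4) (hs : s ≠ 0) (a b c d : ℝ) :
    redTrace ℝ A (coordElt q a b c d) = 2 * d := by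
  obtain ⟨hi, hj, hk⟩ := redTrace_units q hs
  simp only [coordElt, redTrace_add, redTrace_smul, hi, hj, hk, redTrace_algebraMap h4]
  ring

theorem coordElt_mul (a b c a' b' c' : ℝ) :
    coordElt q a b c 0 * coordElt q a' b' c' 0 =
      coordElt q (-s * (b * c' - c * b')) (c * a' - a * c') (a * b' - b * a')
        (-(a * a') + s * (b * b') + s * (c * c')) := by
  simp only [coordElt, map_zero, add_zero, add_mul, mul_add, smul_mul_smul_comm, q.i_mul_i,
    q.j_mul_j, q.i_mul_j, q.j_mul_i, q.i_mul_k, q.k_mul_i, q.k_mul_j, q.j_mul_k, q.k_mul_k,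
    Algebra.algebraMap_eq_smul_one]
  module

theorem coordElt_sub (a b c d a' b' c' d' : ℝ) :
    coordElt q a b c d - coordElt q a' b' c' d' =
      coordElt q (a - a') (b - b') (c - c') (d - d') := by
  simp only [coordElt, Algebra.algebraMap_eq_smul_one]
  module

theorem coordElt_smul (t a b c d : ℝ) :
    t • coordElt q a b c d = coordElt q (t * a) (t * b) (t * c) (t * d) := by
  simp only [coordElt, Algebra.algebraMap_eq_smul_one]
  module

theorem coordElt_commutator (a b c a' b' c' : ℝ) :
    coordElt q a b c 0 * coordElt q a' b' c' 0 - coordElt q a' b' c' 0 * coordElt q a b c 0 =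
      coordElt q (-(2 * s) * (b * c' - c * b')) (2 * (c * a' - a * c')) (2 * (a * b' - b * a'))
        0 := by
  rw [coordElt_mul, coordElt_mul, coordElt_sub]
  congr 1 <;> ring

theorem redNorm_coordElt (h4 : Module.finrank ℝ A = 4) (hs : s ≠ 0) (a b c : ℝ) :
    redNorm ℝ (coordElt q a b c 0) = a ^ 2 - s * (b ^ 2 + c ^ 2) := by
  rw [redNorm, coordElt_mul, redTrace_coordElt q h4 hs, redTrace_coordElt q h4 hs]
  ring

theorem exists_coordElt (h4 : Module.finrank ℝ A = 4) (hs : s ≠ 0) {x : A}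
    (hx : redTrace ℝ A x = 0) : ∃ a b c, x = coordElt q a b c 0 := by
  have : Module.Finite ℝ A := Module.finite_of_finrank_pos (by omega)
  have hli : LinearIndependent ℝ ![q.i, q.j, q.k, (1 : A)] := by
    rw [Fintype.linearIndependent_iff]
    intro g hg
    have hg' : coordElt q (g 0) (g 1) (g 2) (g 3) = 0 := by
      rw [← hg]; simp [Fin.sum_univ_four, coordElt, Algebra.algebraMap_eq_smul_one]
    have h3 : g 3 = 0 := by
      have := congrArg (redTrace ℝ A) hg'
      rw [redTrace_coordElt q h4 hs, redTrace_zero] at this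
      linarith
    rw [h3] at hg'
    have key : ∀ a b c, -(g 0 * a) + s * (g 1 * b) + s * (g 2 * c) = 0 := by
      intro a b c
      have := congrArg (fun y => redTrace ℝ A (y * coordElt q a b c 0)) hg'
      simp only [coordElt_mul, redTrace_coordElt q h4 hs, zero_mul, redTrace_zero] at this
      linarith
    have h0 := key 1 0 0
    have h1 := key 0 1 0
    have h2 := key 0 0 1
    simp [hs] at h0 h1 h2
    intro i
    fin_cases i <;> assumption
  have htop := hli.span_eq_top_of_card_eq_finrank (by rw [h4]; rfl)
  have hmem : x ∈ Submodule.span ℝ (Set.range ![q.i, q.j, q.k, (1 : A)]) := htop ▸ Submodule.mem_top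
  obtain ⟨g, hg⟩ := (Submodule.mem_span_range_iff_exists_fun ℝ).mp hmem
  have hg' : x = coordElt q (g 0) (g 1) (g 2) (g 3) := by
    rw [← hg]; simp [Fin.sum_univ_four, coordElt, Algebra.algebraMap_eq_smul_one]
  have h3 : g 3 = 0 := by
    rw [hg', redTrace_coordElt q h4 hs] at hx
    linarith
  exact ⟨g 0, g 1, g 2, by rw [hg', h3]⟩

/-- The coordinates of the trace zero part of an element, the first scaled by `α⁻¹` and the other
two by `β⁻¹`, expressed through traces. -/
noncomputable def scaledCoords (α β : ℝ) : A →ₗ[ℝ] (Fin 3 → ℝ) where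
  toFun x := ![-redTrace ℝ A (x * q.i) / 2 / α, s * redTrace ℝ A (x * q.j) / 2 / β,
    s * redTrace ℝ A (x * q.k) / 2 / β]
  map_add' x y := by
    ext i
    fin_cases i <;> simp [add_mul, redTrace_add] <;> ring
  map_smul' t x := by
    ext i
    fin_cases i <;> simp [redTrace_smul] <;> ring

theorem scaledCoords_coordElt (h4 : Module.finrank ℝ A = 4) (hs : s = 1 ∨ s = -1) (α β a b c : ℝ) :
    scaledCoords q α β (coordElt q a b c 0) = ![a / α, b / β, c / β] := by
  have hs0 : s ≠ 0 := by rcases hs with rfl | rfl <;> norm_num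
  have hs2 : s * s = 1 := by rcases hs with rfl | rfl <;> norm_num
  have hi : q.i = coordElt q 1 0 0 0 := by simp [coordElt]
  have hj : q.j = coordElt q 0 1 0 0 := by simp [coordElt]
  have hk : q.k = coordElt q 0 0 1 0 := by simp [coordElt]
  have e1 : redTrace ℝ A (coordElt q a b c 0 * q.i) = -(2 * a) := by
    rw [hi, coordElt_mul, redTrace_coordElt q h4 hs0]; ring
  have e2 : redTrace ℝ A (coordElt q a b c 0 * q.j) = s * (2 * b) := by
    rw [hj, coordElt_mul, redTrace_coordElt q h4 hs0]; ring
  have e3 : redTrace ℝ A (coordElt q a b c 0 * q.k) = s * (2 * c) := by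
    rw [hk, coordElt_mul, redTrace_coordElt q h4 hs0]; ring
  ext i
  simp only [scaledCoords, LinearMap.coe_mk, AddHom.coe_mk, e1, e2, e3, ← mul_assoc, hs2]
  fin_cases i <;> simp

theorem scaledCoords_injective (h4 : Module.finrank ℝ A = 4) (hs : s = 1 ∨ s = -1)
    {α β : ℝ} (hα : 0 < α) (hβ : 0 < β) {x : A}
    (hx : redTrace ℝ A x = 0) (h : scaledCoords q α β x = 0) : x = 0 := by
  have hs0 : s ≠ 0 := by rcases hs with rfl | rfl <;> norm_num
  obtain ⟨a, b, c, rfl⟩ := exists_coordElt q h4 hs0 hx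
  rw [scaledCoords_coordElt q h4 hs] at h
  have h0 := congrFun h 0
  have h1 := congrFun h 1
  have h2 := congrFun h 2
  simp [hα.ne', hβ.ne'] at h0 h1 h2
  simp [coordElt, h0, h1, h2]

/-- Bounds for the norm of a trace zero element, and for the `i`-coordinate of an isotropic one. -/
theorem redNorm_le_scaledCoords (h4 : Module.finrank ℝ A = 4) (hs : s = 1 ∨ s = -1)
    {α β : ℝ} (hα : 0 < α) (hα1 : α ≤ 1) (hβ : 0 < β) (hβ1 : β ≤ 1)
    {x : A} (hx : redTrace ℝ A x = 0) :
    |redNorm ℝ x| ≤ 3 * ‖scaledCoords q α β x‖ ^ 2 ∧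
    (redNorm ℝ x = 0 → redTrace ℝ A (x * q.i) ^ 2 ≤ 8 * β ^ 2 * ‖scaledCoords q α β x‖ ^ 2) := by
  have hs0 : s ≠ 0 := by rcases hs with rfl | rfl <;> norm_num
  obtain ⟨a, b, c, rfl⟩ := exists_coordElt q h4 hs0 hx
  have hi : q.i = coordElt q 1 0 0 0 := by simp [coordElt]
  have e1 : redTrace ℝ A (coordElt q a b c 0 * q.i) = -(2 * a) := by
    rw [hi, coordElt_mul, redTrace_coordElt q h4 hs0]; ring
  rw [scaledCoords_coordElt q h4 hs, redNorm_coordElt q h4 hs0, e1]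
  set v : Fin 3 → ℝ := ![a / α, b / β, c / β] with hv
  have comp : ∀ i, v i ^ 2 ≤ ‖v‖ ^ 2 := fun i => by
    rw [← sq_abs]; exact pow_le_pow_left₀ (abs_nonneg _) (norm_le_pi_norm v i) 2
  have ha : a ^ 2 ≤ α ^ 2 * ‖v‖ ^ 2 := by
    have h := comp 0
    simp only [hv, Matrix.cons_val_zero, div_pow] at h
    rwa [div_le_iff₀ (by positivity), mul_comm] at h
  have hb : b ^ 2 ≤ β ^ 2 * ‖v‖ ^ 2 := by
    have h := comp 1
    simp only [hv, Matrix.cons_val_one, Matrix.cons_val_zero, div_pow] at h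
    rwa [div_le_iff₀ (by positivity), mul_comm] at h
  have hc : c ^ 2 ≤ β ^ 2 * ‖v‖ ^ 2 := by
    have h := comp 2
    simp only [hv, Matrix.cons_val, div_pow] at h
    rwa [div_le_iff₀ (by positivity), mul_comm] at h
  have hα2 : α ^ 2 * ‖v‖ ^ 2 ≤ ‖v‖ ^ 2 :=
    mul_le_of_le_one_left (by positivity) (pow_le_one₀ hα.le hα1)
  have hβ2 : β ^ 2 * ‖v‖ ^ 2 ≤ ‖v‖ ^ 2 :=
    mul_le_of_le_one_left (by positivity) (pow_le_one₀ hβ.le hβ1)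
  have na := sq_nonneg a
  have nb := sq_nonneg b
  have nc := sq_nonneg c
  rcases hs with rfl | rfl
  · refine ⟨abs_le.mpr ⟨by linarith, by linarith⟩, fun h => ?_⟩
    rw [neg_sq, mul_pow]
    linarith
  · refine ⟨abs_le.mpr ⟨by linarith, by linarith⟩, fun h => ?_⟩
    have : a ^ 2 = 0 := by linarith
    rw [neg_sq, mul_pow, this]
    nlinarith

/-- Commutators and triple products in terms of cross products of scaled coordinates. -/
theorem commutator_le_scaledCoords (h4 : Module.finrank ℝ A = 4) (hs : s = 1 ∨ s = -1)
    {α β : ℝ} (hα : 0 < α) (hα1 : α ≤ 1) (hβ : 0 < β) (hβ1 : β ≤ 1)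
    {x y z : A} (hx : redTrace ℝ A x = 0) (hy : redTrace ℝ A y = 0) (hz : redTrace ℝ A z = 0) :
    (scaledCoords q α β x ⨯₃ scaledCoords q α β y ≠ 0 → x * y - y * x ≠ 0) ∧
    |redNorm ℝ (x * y - y * x)|
      ≤ 12 * β ^ 2 * ‖scaledCoords q α β x ⨯₃ scaledCoords q α β y‖ ^ 2 ∧
    |redTrace ℝ A ((x * y - y * x) * q.i)|
      ≤ 4 * β ^ 2 * ‖scaledCoords q α β x ⨯₃ scaledCoords q α β y‖ ∧
    |redTrace ℝ A ((x * y - y * x) * z)| = 4 * (α * β ^ 2) *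
      |(scaledCoords q α β x ⨯₃ scaledCoords q α β y) ⬝ᵥ scaledCoords q α β z| := by
  have hs0 : s ≠ 0 := by rcases hs with rfl | rfl <;> norm_num
  have hs2 : s ^ 2 = 1 := by rcases hs with rfl | rfl <;> norm_num
  have hsa : |s| = 1 := by rcases hs with rfl | rfl <;> simp
  obtain ⟨a, b, c, rfl⟩ := exists_coordElt q h4 hs0 hx
  obtain ⟨a', b', c', rfl⟩ := exists_coordElt q h4 hs0 hy
  obtain ⟨e, f, g, rfl⟩ := exists_coordElt q h4 hs0 hz
  have hi : q.i = coordElt q 1 0 0 0 := by simp [coordElt]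
  rw [coordElt_commutator]
  have e1 : ∀ a b c, redTrace ℝ A (coordElt q a b c 0 * q.i) = -(2 * a) := by
    intro a b c
    rw [hi, coordElt_mul, redTrace_coordElt q h4 hs0]; ring
  rw [redNorm_coordElt q h4 hs0, e1, coordElt_mul, redTrace_coordElt q h4 hs0]
  simp only [scaledCoords_coordElt q h4 hs]
  set v : Fin 3 → ℝ := ![a / α, b / β, c / β] ⨯₃ ![a' / α, b' / β, c' / β] with hv
  have v0 : b * c' - c * b' = β ^ 2 * v 0 := by
    simp [hv, cross_apply]; field_simp
  have v1 : c * a' - a * c' = α * β * v 1 := by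
    simp [hv, cross_apply]; field_simp
  have v2 : a * b' - b * a' = α * β * v 2 := by
    simp [hv, cross_apply]; field_simp
  rw [v0, v1, v2]
  have comp : ∀ i, v i ^ 2 ≤ ‖v‖ ^ 2 := fun i => by
    rw [← sq_abs]; exact pow_le_pow_left₀ (abs_nonneg _) (norm_le_pi_norm v i) 2
  refine ⟨fun hne h0 => hne ?_, ?_, ?_, ?_⟩
  · have h := congrArg (scaledCoords q 1 1) h0
    rw [scaledCoords_coordElt q h4 hs, map_zero] at h
    have h0 := congrFun h 0
    have h1 := congrFun h 1
    have h2 := congrFun h 2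
    simp [hs0, hα.ne', hβ.ne'] at h0 h1 h2
    ext i
    fin_cases i
    · exact h0
    · exact h1
    · exact h2
  · have hb4 : β ^ 4 ≤ β ^ 2 := by
      calc β ^ 4 = β ^ 2 * β ^ 2 := by ring
        _ ≤ β ^ 2 * 1 := by gcongr; exact pow_le_one₀ hβ.le hβ1
        _ = β ^ 2 := mul_one _
    have hab : (α * β) ^ 2 ≤ β ^ 2 := by
      rw [mul_pow]; exact mul_le_of_le_one_left (by positivity) (pow_le_one₀ hα.le hα1)
    have t0 : β ^ 4 * v 0 ^ 2 ≤ β ^ 2 * ‖v‖ ^ 2 :=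
      mul_le_mul hb4 (comp 0) (by positivity) (by positivity)
    have t1 : (α * β) ^ 2 * v 1 ^ 2 ≤ β ^ 2 * ‖v‖ ^ 2 :=
      mul_le_mul hab (comp 1) (by positivity) (by positivity)
    have t2 : (α * β) ^ 2 * v 2 ^ 2 ≤ β ^ 2 * ‖v‖ ^ 2 :=
      mul_le_mul hab (comp 2) (by positivity) (by positivity)
    have n0 : 0 ≤ β ^ 4 * v 0 ^ 2 := by positivity
    have n1 : 0 ≤ (α * β) ^ 2 * v 1 ^ 2 := by positivity
    have n2 : 0 ≤ (α * β) ^ 2 * v 2 ^ 2 := by positivity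
    have hexp : (-(2 * s) * (β ^ 2 * v 0)) ^ 2 - s * ((2 * (α * β * v 1)) ^ 2
        + (2 * (α * β * v 2)) ^ 2) = 4 * (β ^ 4 * v 0 ^ 2)
        - s * (4 * ((α * β) ^ 2 * v 1 ^ 2) + 4 * ((α * β) ^ 2 * v 2 ^ 2)) := by
      linear_combination (4 * β ^ 4 * v 0 ^ 2) * hs2
    rw [hexp]
    rcases hs with rfl | rfl <;> rw [abs_le] <;> constructor <;> linarith
  · have : |-(2 * (-(2 * s) * (β ^ 2 * v 0)))| = 4 * β ^ 2 * |v 0| := by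
      rw [show -(2 * (-(2 * s) * (β ^ 2 * v 0))) = s * (4 * β ^ 2 * v 0) by ring, abs_mul, hsa,
        one_mul, abs_mul, abs_of_pos (by positivity : 0 < 4 * β ^ 2)]
    rw [this]
    gcongr
    exact norm_le_pi_norm v 0
  · have : v ⬝ᵥ ![e / α, f / β, g / β] = v 0 * (e / α) + v 1 * (f / β) + v 2 * (g / β) := by
      simp [dotProduct, Fin.sum_univ_three]
    rw [this, show 2 * (-(-(2 * s) * (β ^ 2 * v 0) * e) + s * (2 * (α * β * v 1) * f)
      + s * (2 * (α * β * v 2) * g)) = s * (4 * (α * β ^ 2) *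
        (v 0 * (e / α) + v 1 * (f / β) + v 2 * (g / β))) by field_simp; ring, abs_mul, hsa, one_mul,
      abs_mul, abs_of_pos (by positivity : 0 < 4 * (α * β ^ 2))]

/-- Points of a lattice of trace zero elements in a box of scaled coordinates. -/
theorem finite_and_ncard_le (h4 : Module.finrank ℝ A = 4) (hs : s = 1 ∨ s = -1)
    {α β : ℝ} (hα : 0 < α) (hβ : 0 < β) {L S : Set A}
    (hL0 : ∀ x ∈ L, redTrace ℝ A x = 0) (hsub : ∀ x ∈ L, ∀ y ∈ L, x - y ∈ L)
    {m₁ m₂ m₃ T : ℝ} (hm₁ : 0 < m₁) (hm₂ : 0 < m₂) (hm₃ : 0 < m₃) (hT : 0 < T)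
    (h₁ : ∀ x ∈ L, x ≠ 0 → m₁ ≤ ‖scaledCoords q α β x‖)
    (h₂ : ∀ x ∈ L, ∀ y ∈ L, scaledCoords q α β x ⨯₃ scaledCoords q α β y ≠ 0 →
      m₂ ≤ ‖scaledCoords q α β x ⨯₃ scaledCoords q α β y‖)
    (h₃ : ∀ x ∈ L, ∀ y ∈ L, ∀ z ∈ L,
      (scaledCoords q α β x ⨯₃ scaledCoords q α β y) ⬝ᵥ scaledCoords q α β z ≠ 0 →
      m₃ ≤ |(scaledCoords q α β x ⨯₃ scaledCoords q α β y) ⬝ᵥ scaledCoords q α β z|)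
    (hSL : S ⊆ L) (hST : ∀ x ∈ S, ‖scaledCoords q α β x‖ ≤ T) :
    S.Finite ∧ (S.ncard : ℝ) ≤ 192 * (1 + T / m₁ + T ^ 2 / m₂ + T ^ 3 / m₃) := by
  classical
  have hinj : ∀ x ∈ L, ∀ y ∈ L, scaledCoords q α β x = scaledCoords q α β y → x = y := by
    intro x hx y hy h
    refine sub_eq_zero.mp (scaledCoords_injective q h4 hs hα hβ (hL0 _ (hsub x hx y hy)) ?_)
    rw [map_sub, h, sub_self]
  have key : ∀ F : Finset A, (F : Set A) ⊆ S →
      (F.card : ℝ) ≤ 192 * (1 + T / m₁ + T ^ 2 / m₂ + T ^ 3 / m₃) := by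
    intro F hF
    have hcard : (F.image (scaledCoords q α β)).card = F.card :=
      Finset.card_image_of_injOn fun x hx y hy h => hinj x (hSL (hF hx)) y (hSL (hF hy)) h
    rw [← hcard]
    refine card_lattice_le (Λ := scaledCoords q α β '' L) ?_ hm₁ hm₂ hm₃ hT ?_ ?_ ?_ _ ?_ ?_
    · rintro _ ⟨x, hx, rfl⟩ _ ⟨y, hy, rfl⟩
      exact ⟨x - y, hsub x hx y hy, map_sub _ _ _⟩
    · rintro _ ⟨x, hx, rfl⟩ hne
      exact h₁ x hx fun h => hne (by rw [h, map_zero])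
    · rintro _ ⟨x, hx, rfl⟩ _ ⟨y, hy, rfl⟩
      exact h₂ x hx y hy
    · rintro _ ⟨x, hx, rfl⟩ _ ⟨y, hy, rfl⟩ _ ⟨z, hz, rfl⟩
      exact h₃ x hx y hy z hz
    · intro v hv
      obtain ⟨x, hx, rfl⟩ := Finset.mem_image.mp hv
      exact ⟨x, hSL (hF hx), rfl⟩
    · intro v hv
      obtain ⟨x, hx, rfl⟩ := Finset.mem_image.mp hv
      exact hST x (hF hx)
  have hfin : S.Finite := by
    by_contra hinf
    obtain ⟨n, hn⟩ := exists_nat_gt (192 * (1 + T / m₁ + T ^ 2 / m₂ + T ^ 3 / m₃))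
    obtain ⟨F, hF, rfl⟩ := Set.Infinite.exists_subset_card_eq hinf n
    exact absurd (key F hF) (not_le.mpr hn)
  refine ⟨hfin, ?_⟩
  rw [Set.ncard_eq_toFinset_card S hfin]
  exact key _ (by simp)

/-! ### The regions and first successive minima -/

theorem norm_scaledCoords_le_of_mem_regionOmega (h4 : Module.finrank ℝ A = 4) (hs : s = 1 ∨ s = -1)
    {δ T : ℝ} (hδ : 0 < δ) (hT : 0 ≤ T)
    {x : A} (hx : x ∈ regionOmega q δ T) (hx0 : redTrace ℝ A x = 0) :
    ‖scaledCoords q 1 (Real.sqrt δ) x‖ ≤ T := by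
  have hs0 : s ≠ 0 := by rcases hs with rfl | rfl <;> norm_num
  obtain ⟨a, b, c, d, rfl, h1, h2⟩ := hx
  obtain rfl : d = 0 := by
    rw [redTrace_coordElt q h4 hs0] at hx0; linarith
  have hsq := Real.sq_sqrt hδ.le
  have hpos := Real.sqrt_pos.mpr hδ
  rw [scaledCoords_coordElt q h4 hs, pi_norm_le_iff_of_nonneg hT]
  have ha : |a / 1| ≤ T := by
    rw [div_one]; exact abs_le_of_sq_le_sq (by nlinarith) hT
  have hb : |b / Real.sqrt δ| ≤ T := by
    refine abs_le_of_sq_le_sq ?_ hT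
    rw [div_pow, hsq, div_le_iff₀ hδ]; nlinarith
  have hc : |c / Real.sqrt δ| ≤ T := by
    refine abs_le_of_sq_le_sq ?_ hT
    rw [div_pow, hsq, div_le_iff₀ hδ]; nlinarith
  intro i
  fin_cases i
  · exact ha
  · exact hb
  · exact hc

theorem norm_scaledCoords_le_of_mem_regionPsi (h4 : Module.finrank ℝ A = 4) (hs : s = 1 ∨ s = -1)
    {δ T : ℝ} (hδ : 0 < δ) (hT : 0 ≤ T)
    {x : A} (hx : x ∈ regionPsi q δ T) (hx0 : redTrace ℝ A x = 0) :
    ‖scaledCoords q (Real.sqrt δ) 1 x‖ ≤ T := by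
  have hs0 : s ≠ 0 := by rcases hs with rfl | rfl <;> norm_num
  obtain ⟨a, b, c, d, rfl, h1, h2⟩ := hx
  obtain rfl : d = 0 := by
    rw [redTrace_coordElt q h4 hs0] at hx0; linarith
  have hsq := Real.sq_sqrt hδ.le
  have hpos := Real.sqrt_pos.mpr hδ
  rw [scaledCoords_coordElt q h4 hs, pi_norm_le_iff_of_nonneg hT]
  have ha : |a / Real.sqrt δ| ≤ T := by
    refine abs_le_of_sq_le_sq ?_ hT
    rw [div_pow, hsq, div_le_iff₀ hδ]; nlinarith
  have hb : |b / 1| ≤ T := by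
    rw [div_one]; exact abs_le_of_sq_le_sq (by nlinarith) hT
  have hc : |c / 1| ≤ T := by
    rw [div_one]; exact abs_le_of_sq_le_sq (by nlinarith) hT
  intro i
  fin_cases i
  · exact ha
  · exact hb
  · exact hc

theorem exists_mem_smul_regions (h4 : Module.finrank ℝ A = 4) (hs : s = 1 ∨ s = -1)
    {δ : ℝ} (hδ : 0 < δ) (hδ1 : δ ≤ 1) {x : A}
    (hx0 : redTrace ℝ A x = 0) :
    ∃ t : ℝ, 0 < t ∧ x ∈ t • (regionOmega q δ 1 ∩ traceZero A) ∧
      x ∈ t • (regionPsi q δ 1 ∩ traceZero A) := by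
  have hs0 : s ≠ 0 := by rcases hs with rfl | rfl <;> norm_num
  obtain ⟨a, b, c, rfl⟩ := exists_coordElt q h4 hs0 hx0
  set S := a ^ 2 + b ^ 2 + c ^ 2 with hS
  have hS0 : 0 ≤ S := by positivity
  set t := 1 + S / δ with ht
  have ht1 : 1 ≤ t := by
    have : 0 ≤ S / δ := by positivity
    linarith
  have ht0 : 0 < t := by linarith
  have hSt : S / t ^ 2 ≤ δ := by
    rw [div_le_iff₀ (by positivity)]
    have h1 : S ≤ δ * t := by
      rw [ht, mul_add, mul_div_cancel₀ _ hδ.ne']; linarith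
    nlinarith
  have hsum : (a / t) ^ 2 + (b / t) ^ 2 + (c / t) ^ 2 ≤ δ := by
    rw [div_pow, div_pow, div_pow, ← add_div, ← add_div]; exact hSt
  have na := sq_nonneg (a / t)
  have nb := sq_nonneg (b / t)
  have nc := sq_nonneg (c / t)
  have hx : coordElt q a b c 0 = t • coordElt q (a / t) (b / t) (c / t) 0 := by
    rw [coordElt_smul, mul_div_cancel₀ _ ht0.ne', mul_div_cancel₀ _ ht0.ne',
      mul_div_cancel₀ _ ht0.ne', mul_zero]
  have htz : coordElt q (a / t) (b / t) (c / t) 0 ∈ traceZero A := by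
    have := redTrace_coordElt q h4 hs0 (a / t) (b / t) (c / t) 0
    rwa [mul_zero] at this
  refine ⟨t, ht0, ⟨_, ⟨⟨_, _, _, _, rfl, ?_, ?_⟩, htz⟩, hx.symm⟩,
    ⟨_, ⟨⟨_, _, _, _, rfl, ?_, ?_⟩, htz⟩, hx.symm⟩⟩ <;> linarith

/-- A linear map bounded by `1` on `K` bounds the first successive minimum of `K` on `L` from below.
That `K` absorbs the points of `L` and that `L` is nonzero ensures that the gauge and the successive
minimum are infima of nonempty sets. -/
theorem le_succMin {K L : Set A} {f : A →ₗ[ℝ] (Fin 3 → ℝ)} {m : ℝ}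
    (hf : ∀ x ∈ K, ‖f x‖ ≤ 1) (hab : ∀ x ∈ L, ∃ t : ℝ, 0 < t ∧ x ∈ t • K)
    (hL : ∃ x ∈ L, x ≠ 0) (hm : ∀ x ∈ L, x ≠ 0 → m ≤ ‖f x‖) : m ≤ succMin K L 1 := by
  refine le_csInf ?_ ?_
  · obtain ⟨x, hx, hx0⟩ := hL
    refine ⟨max 1 (gauge K x), lt_max_of_lt_left one_pos, fun _ => x, ?_, fun _ =>
      ⟨hx, le_max_right _ _⟩⟩
    exact LinearIndependent.of_subsingleton 0 hx0
  · rintro r ⟨hr, v, hv, h⟩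
    obtain ⟨hvL, hvr⟩ := h 0
    refine (hm _ hvL (hv.ne_zero 0)).trans (le_trans ?_ hvr)
    refine le_csInf (hab _ hvL) ?_
    rintro t ⟨ht, y, hy, hty⟩
    rw [← hty]
    simp only [map_smul, norm_smul, Real.norm_eq_abs, abs_of_pos ht]
    exact mul_le_of_le_one_right ht.le (hf y hy)

end Coordinates

/-! ### Real quadratic inequalities behind the choice of bounds -/

theorem inv_sqrt_le_of_sq {l n : ℝ} (hl : 0 < l) (hn : 0 ≤ n) (h : 1 ≤ 16 * l * n ^ 2) :
    1 / (4 * Real.sqrt l) ≤ n := by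
  have hs := Real.sqrt_pos.mpr hl
  have hsq := Real.sq_sqrt hl.le
  rw [div_le_iff₀ (by positivity)]
  refine le_of_abs_le (abs_le_of_sq_le_sq ?_ (by positivity))
  rw [one_pow, mul_pow, mul_pow, hsq]; linarith

theorem sqrt_div_le_of_sq {D l b n : ℝ} (hl : 0 < l) (hb : 0 < b) (hn : 0 ≤ n) (hD : 0 ≤ D)
    (h : D ≤ 196 * l ^ 3 * b ^ 2 * n ^ 2) :
    Real.sqrt D / (14 * Real.sqrt l ^ 3 * b) ≤ n := by
  have hs := Real.sqrt_pos.mpr hl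
  have hsq := Real.sq_sqrt hl.le
  have hDq := Real.sq_sqrt hD
  rw [div_le_iff₀ (by positivity)]
  refine le_of_abs_le (abs_le_of_sq_le_sq ?_ (by positivity))
  have : (Real.sqrt l ^ 3) ^ 2 = l ^ 3 := by rw [← pow_mul, mul_comm, pow_mul, hsq]
  rw [mul_pow, mul_pow, mul_pow, hDq, this]; linarith

/-! ### The lattices of a division algebra -/

section Conjugation

open scoped Matrix

variable {B : Type*} [Ring B] [Algebra ℚ B]

/-- The embedding `x ↦ g⁻¹ (1 ⊗ x) g` of `B` into `ℝ ⊗ B`. -/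
noncomputable def conjEmb (g : (ℝ ⊗[ℚ] B)ˣ) (x : B) : ℝ ⊗[ℚ] B :=
  (↑g⁻¹ : ℝ ⊗[ℚ] B) * (1 ⊗ₜ[ℚ] x) * (g : ℝ ⊗[ℚ] B)

theorem conjEmb_mul (g : (ℝ ⊗[ℚ] B)ˣ) (x y : B) :
    conjEmb g x * conjEmb g y = conjEmb g (x * y) := by
  simp only [conjEmb, mul_assoc, Units.mul_inv_cancel_left]
  rw [← mul_assoc (1 ⊗ₜ[ℚ] x), Algebra.TensorProduct.tmul_mul_tmul, one_mul]

theorem conjEmb_sub (g : (ℝ ⊗[ℚ] B)ˣ) (x y : B) :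
    conjEmb g x - conjEmb g y = conjEmb g (x - y) := by
  simp only [conjEmb, TensorProduct.tmul_sub, mul_sub, sub_mul]

theorem conjEmb_ne_zero [Nontrivial B] (g : (ℝ ⊗[ℚ] B)ˣ) {x : B} (hx : x ≠ 0) :
    conjEmb g x ≠ 0 := by
  intro h
  have h1 : (1 : ℝ) ⊗ₜ[ℚ] x = 0 := by
    have := congrArg (fun y => (g : ℝ ⊗[ℚ] B) * y * (↑g⁻¹ : ℝ ⊗[ℚ] B)) h
    simpa [conjEmb, mul_assoc] using this
  have h2 : (Algebra.TensorProduct.includeRight : B →ₐ[ℚ] ℝ ⊗[ℚ] B) x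
      = Algebra.TensorProduct.includeRight 0 := by
    rw [map_zero]; exact h1
  exact hx (Algebra.TensorProduct.includeRight_injective
    (FaithfulSMul.algebraMap_injective ℚ ℝ) h2)

variable [Module.Finite ℚ B]

theorem redTrace_conjEmb (g : (ℝ ⊗[ℚ] B)ˣ) (x : B) :
    redTrace ℝ _ (conjEmb g x) = (redTrace ℚ B x : ℝ) := by
  rw [conjEmb, redTrace_mul_comm, ← mul_assoc, Units.mul_inv, one_mul, redTrace_baseChange]; rfl

theorem redNorm_conjEmb (g : (ℝ ⊗[ℚ] B)ˣ) (x : B) :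
    redNorm ℝ (conjEmb g x) = (redNorm ℚ x : ℝ) := by
  rw [redNorm, conjEmb_mul, redTrace_conjEmb, redTrace_conjEmb, redNorm]; push_cast; rfl

end Conjugation

section Division

open scoped Matrix

variable {B : Type*} [Ring B] [Algebra ℚ B] [Algebra.IsCentral ℚ B] [Nontrivial B]

/-- Successive minima and point counts in boxes of scaled coordinates for `g⁻¹ R(ℓ)⁰ g` in a
division algebra. -/
theorem realLattice_bounds (h4 : Module.finrank ℚ B = 4) (hB : ∀ x : B, x ≠ 0 → IsUnit x)
    {R : Subring B} {N l : ℕ} {s : ℝ} (q : QuaternionAlgebra.Basis (ℝ ⊗[ℚ] B) (-1 : ℝ) 0 s)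
    (g : (ℝ ⊗[ℚ] B)ˣ) (hR : IsEichlerOrder R N) (hN : Squarefree N) (hl : l ∣ redDisc B * N)
    (hs : s = 1 ∨ s = -1) {α β : ℝ} (hα : 0 < α) (hα1 : α ≤ 1) (hβ : 0 < β) (hβ1 : β ≤ 1) :
    (∀ x ∈ realLattice R l g, x ≠ 0 → 1 / (4 * Real.sqrt l) ≤ ‖scaledCoords q α β x‖) ∧
    ∀ (T : ℝ) (S : Set (ℝ ⊗[ℚ] B)), 0 < T → S ⊆ realLattice R l g →
      (∀ x ∈ S, ‖scaledCoords q α β x‖ ≤ T) →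
      S.Finite ∧ (S.ncard : ℝ) ≤ 6144 * (1 + Real.sqrt l * T
        + Real.sqrt l ^ 3 * β / Real.sqrt (redDisc B * N : ℕ) * T ^ 2
        + (l : ℝ) ^ 2 * (α * β ^ 2) / (redDisc B * N : ℕ) * T ^ 3) := by
  have : Module.Finite ℚ B := Module.finite_of_finrank_pos (by omega)
  have h4' : Module.finrank ℝ (ℝ ⊗[ℚ] B) = 4 := by rw [Module.finrank_baseChange, h4]
  have hDne := (hR.squarefree hN).ne_zero
  have hD0 : (0 : ℝ) < (redDisc B * N : ℕ) := by exact_mod_cast Nat.pos_of_ne_zero hDne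
  have hl0 : (0 : ℝ) < l := by
    exact_mod_cast Nat.pos_of_ne_zero fun h => hDne (Nat.eq_zero_of_zero_dvd (h ▸ hl))
  set D : ℝ := ((redDisc B * N : ℕ) : ℝ) with hDdef
  rw [show realLattice R l g = conjEmb g '' partialDualZero R l from rfl]
  have htr : ∀ x ∈ conjEmb g '' partialDualZero R l, redTrace ℝ _ x = 0 := by
    rintro _ ⟨x, hx, rfl⟩
    rw [redTrace_conjEmb, hx.2, Rat.cast_zero]
  have b1 : ∀ x ∈ conjEmb g '' partialDualZero R l, x ≠ 0 →
      1 / (4 * Real.sqrt l) ≤ ‖scaledCoords q α β x‖ := by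
    intro y hy hne
    have hle := (redNorm_le_scaledCoords q h4' hs hα hα1 hβ hβ1 (htr y hy)).1
    obtain ⟨x, hx, rfl⟩ := hy
    have hx0 : x ≠ 0 := by rintro rfl; exact hne (by simp [conjEmb])
    have h := (partialDual_bounds h4 hB hR hN hl hx.1 hx.1 hx.1).1 hx0
    have h' : (1 : ℝ) ≤ l * (4 * |(redNorm ℚ x : ℝ)|) := by exact_mod_cast h
    rw [redNorm_conjEmb] at hle
    refine inv_sqrt_le_of_sq hl0 (norm_nonneg _) (h'.trans ?_)
    calc (l : ℝ) * (4 * |(redNorm ℚ x : ℝ)|)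
        ≤ l * (4 * (3 * ‖scaledCoords q α β (conjEmb g x)‖ ^ 2)) := by gcongr
      _ ≤ _ := by nlinarith [mul_nonneg hl0.le (sq_nonneg ‖scaledCoords q α β (conjEmb g x)‖)]
  refine ⟨b1, fun T S hT hSL hST => ?_⟩
  have hs1 := Real.sqrt_pos.mpr hl0
  have hs2 := Real.sqrt_pos.mpr hD0
  have hmain := finite_and_ncard_le q h4' hs hα hβ (L := conjEmb g '' partialDualZero R l) (S := S)
    (m₁ := 1 / (4 * Real.sqrt l)) (m₂ := Real.sqrt D / (14 * Real.sqrt l ^ 3 * β))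
    (m₃ := D / (32 * l ^ 2 * (α * β ^ 2))) (T := T) htr ?_ (by positivity) (by positivity)
    (by positivity) hT b1 ?_ ?_ hSL hST
  · refine ⟨hmain.1, hmain.2.trans ?_⟩
    have e1 : T / (1 / (4 * Real.sqrt l)) = 4 * (Real.sqrt l * T) := by field_simp
    have e2 : T ^ 2 / (Real.sqrt D / (14 * Real.sqrt l ^ 3 * β))
        = 14 * (Real.sqrt l ^ 3 * β / Real.sqrt D * T ^ 2) := by field_simp
    have e3 : T ^ 3 / (D / (32 * l ^ 2 * (α * β ^ 2)))
        = 32 * ((l : ℝ) ^ 2 * (α * β ^ 2) / D * T ^ 3) := by field_simp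
    rw [e1, e2, e3]
    have p1 : 0 ≤ Real.sqrt l * T := by positivity
    have p2 : 0 ≤ Real.sqrt l ^ 3 * β / Real.sqrt D * T ^ 2 := by positivity
    have p3 : 0 ≤ (l : ℝ) ^ 2 * (α * β ^ 2) / D * T ^ 3 := by positivity
    linarith
  · rintro _ ⟨x, hx, rfl⟩ _ ⟨y, hy, rfl⟩
    exact ⟨x - y, sub_mem_partialDualZero hx hy, (conjEmb_sub g x y).symm⟩
  · intro x' hx' y' hy' hne
    obtain ⟨hc1, hc2, -, -⟩ := commutator_le_scaledCoords q h4' hs hα hα1 hβ hβ1 (htr _ hx')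
      (htr _ hy') (htr _ hx')
    have hcomm := hc1 hne
    obtain ⟨x, hx, rfl⟩ := hx'
    obtain ⟨y, hy, rfl⟩ := hy'
    rw [conjEmb_mul, conjEmb_mul, conjEmb_sub] at hcomm hc2
    have h0 : x * y - y * x ≠ 0 := fun h => hcomm (by rw [h]; simp [conjEmb])
    have h := (partialDual_bounds h4 hB hR hN hl hx.1 hy.1 hx.1).2.1 h0
    have h' : D ≤ l ^ 3 * (16 * |(redNorm ℚ (x * y - y * x) : ℝ)|) := by
      rw [hDdef]; exact_mod_cast h
    rw [redNorm_conjEmb] at hc2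
    refine sqrt_div_le_of_sq hl0 hβ (norm_nonneg _) hD0.le (h'.trans ?_)
    set n := ‖scaledCoords q α β (conjEmb g x) ⨯₃ scaledCoords q α β (conjEmb g y)‖
    calc (l : ℝ) ^ 3 * (16 * |(redNorm ℚ (x * y - y * x) : ℝ)|)
        ≤ l ^ 3 * (16 * (12 * β ^ 2 * n ^ 2)) := by gcongr
      _ = 192 * (l ^ 3 * β ^ 2 * n ^ 2) := by ring
      _ ≤ 196 * (l ^ 3 * β ^ 2 * n ^ 2) := by gcongr; norm_num
      _ = _ := by ring
  · intro x' hx' y' hy' z' hz' hne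
    obtain ⟨-, -, -, hc⟩ := commutator_le_scaledCoords q h4' hs hα hα1 hβ hβ1 (htr _ hx')
      (htr _ hy') (htr _ hz')
    obtain ⟨x, hx, rfl⟩ := hx'
    obtain ⟨y, hy, rfl⟩ := hy'
    obtain ⟨z, hz, rfl⟩ := hz'
    rw [conjEmb_mul, conjEmb_mul, conjEmb_sub, conjEmb_mul, redTrace_conjEmb] at hc
    have hpos := abs_pos.mpr hne
    have h0 : redTrace ℚ B ((x * y - y * x) * z) ≠ 0 := by
      intro h
      rw [h, Rat.cast_zero, abs_zero] at hc
      have : 0 < 4 * (α * β ^ 2) * |(scaledCoords q α β (conjEmb g x) ⨯₃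
        scaledCoords q α β (conjEmb g y)) ⬝ᵥ scaledCoords q α β (conjEmb g z)| := by positivity
      linarith
    have h := (partialDual_bounds h4 hB hR hN hl hx.1 hy.1 hz.1).2.2 h0
    have h' : D ≤ l ^ 2 * (8 * |(redTrace ℚ B ((x * y - y * x) * z) : ℝ)|) := by
      rw [hDdef]; exact_mod_cast h
    rw [hc] at h'
    rw [div_le_iff₀ (by positivity)]
    linarith

end Division

/-! ### Heights -/

section Height

theorem im_smul_eq (h : GL (Fin 2) ℝ) (z : UpperHalfPlane) :
    (h • z).im = |h.1.det| * z.im / ((h 1 0 * z.re + h 1 1) ^ 2 + (h 1 0 * z.im) ^ 2) := by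
  rw [UpperHalfPlane.im_smul_eq_div_normSq]
  congr 1
  rw [Complex.normSq_apply]
  simp [UpperHalfPlane.denom]
  ring

/-- The real points of the standard order: integral matrices with lower left entry in `N ℤ`. -/
def realStdOrder (N : ℕ) : Set (Matrix (Fin 2) (Fin 2) ℝ) :=
  {M | ∃ a b c d : ℤ, M = !![(a : ℝ), (b : ℝ); (N : ℝ) * (c : ℝ), (d : ℝ)]}

theorem conj_mem_realStdOrder {N e : ℕ} (he : 0 < e) (hd : e ∣ N) (a b c d : ℤ)
    {M : Matrix (Fin 2) (Fin 2) ℝ} (hM : M ∈ realStdOrder N) :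
    (e : ℝ)⁻¹ • (!![(e : ℝ) * a, (b : ℝ); (N : ℝ) * c, (e : ℝ) * d] * M *
      !![(e : ℝ) * d, -(b : ℝ); -((N : ℝ) * c), (e : ℝ) * a]) ∈ realStdOrder N := by
  obtain ⟨x, y, z, w, rfl⟩ := hM
  obtain ⟨f, rfl⟩ := hd
  have he' : (e : ℝ) ≠ 0 := by positivity
  refine ⟨(e * a * x + b * (e * f) * z) * d - (e * a * y + b * w) * (f * c),
    -(a * x + b * f * z) * b + (e * a * y + b * w) * a,
    (c * x + e * d * z) * d - (f * c * y + d * w) * c,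
    -(f * c * x + d * (e * f) * z) * b + (e * f * c * y + e * d * w) * a, ?_⟩
  ext i j
  fin_cases i <;> fin_cases j <;> simp <;> field_simp <;> ring

/-- The Atkin–Lehner group normalizes the standard order. -/
theorem conj_mem_realStdOrder_of_mem_atkinLehnerGroup {N : ℕ} {γ : GL (Fin 2) ℝ}
    (hγ : γ ∈ atkinLehnerGroup N) : ∀ M ∈ realStdOrder N,
      γ.1 * M * (γ⁻¹).1 ∈ realStdOrder N ∧ (γ⁻¹).1 * M * γ.1 ∈ realStdOrder N := by
  induction hγ using Subgroup.closure_induction with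
  | mem γ h =>
    obtain ⟨e, a, b, c, d, he, hd, hdet, hγ⟩ := h
    have he' : (e : ℝ) ≠ 0 := by positivity
    have hdet' : (e : ℝ) * a * (e * d) - b * (N * c) = e := by exact_mod_cast hdet
    have hinv : (γ⁻¹).1 = (e : ℝ)⁻¹ • !![(e : ℝ) * d, -(b : ℝ); -((N : ℝ) * c), (e : ℝ) * a] := by
      rw [Matrix.coe_units_inv, hγ, Matrix.inv_def, Matrix.det_fin_two_of, hdet',
        Ring.inverse_eq_inv', Matrix.adjugate_fin_two_of]
    intro M hM
    rw [hinv]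
    change γ.1 = _ at hγ
    rw [hγ]
    constructor
    · rw [mul_smul_comm]
      exact conj_mem_realStdOrder he hd a b c d hM
    · rw [smul_mul_assoc, smul_mul_assoc]
      have := conj_mem_realStdOrder he hd d (-b) (-c) a hM
      simpa using this
  | one => intro M hM; simpa using hM
  | mul x y _ _ ihx ihy =>
    intro M hM
    constructor
    · have := (ihx _ (ihy M hM).1).1
      simpa [mul_assoc] using this
    · have := (ihy _ (ihx M hM).2).2
      simpa [mul_assoc] using this
  | inv x _ ih =>
    intro M hM
    rw [inv_inv]
    exact (ih M hM).symm

/-- The set defining the height is bounded, so that its supremum is not a junk value. -/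
theorem bddAbove_height (N : ℕ) (z : UpperHalfPlane) :
    BddAbove {y : ℝ | ∃ γ ∈ atkinLehnerGroup N, y = (γ • z).im} := by
  refine ⟨z.im + 1 / z.im, ?_⟩
  rintro _ ⟨γ, hγ, rfl⟩
  have hz := z.im_pos
  have hz' : 0 < 1 / z.im := by positivity
  have hdet : γ.1.det ≠ 0 := γ.det_ne_zero
  have habs := abs_pos.mpr hdet
  -- conjugating a unipotent matrix shows that `d²/det` and `c²/det` are integers
  obtain ⟨x, y, u, v, hM⟩ := (conj_mem_realStdOrder_of_mem_atkinLehnerGroup hγ !![0, 1; 0, 0]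
    ⟨0, 1, 0, 0, by simp⟩).2
  have hdet2 : γ.1.det = γ.1 0 0 * γ.1 1 1 - γ.1 0 1 * γ.1 1 0 := Matrix.det_fin_two _
  have hinv : (γ⁻¹).1 = (γ.1.det)⁻¹ • !![γ.1 1 1, -γ.1 0 1; -γ.1 1 0, γ.1 0 0] := by
    rw [Matrix.coe_units_inv, Matrix.inv_def, Ring.inverse_eq_inv', Matrix.adjugate_fin_two]
  rw [hinv] at hM
  have h01 : (γ.1.det)⁻¹ * (γ.1 1 1 * γ.1 1 1) = y := by
    have := congrFun (congrFun hM 0) 1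
    simpa [Matrix.mul_apply, Fin.sum_univ_two, mul_assoc] using this
  have h10 : -((γ.1.det)⁻¹ * (γ.1 1 0 * γ.1 1 0)) = N * u := by
    have := congrFun (congrFun hM 1) 0
    simpa [Matrix.mul_apply, Fin.sum_univ_two, mul_assoc] using this
  have hint : ∀ (t : ℝ) (k : ℤ), t ≠ 0 → (γ.1.det)⁻¹ * (t * t) = k → |γ.1.det| ≤ t ^ 2 := by
    intro t k ht hk
    have hk0 : k ≠ 0 := by
      rintro rfl
      rw [Int.cast_zero] at hk
      exact mul_ne_zero (inv_ne_zero hdet) (mul_ne_zero ht ht) hk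
    have h1 : (1 : ℝ) ≤ |(k : ℝ)| := by exact_mod_cast Int.one_le_abs hk0
    rw [← hk, abs_mul, abs_inv, abs_mul_self, ← sq, inv_mul_eq_div, le_div_iff₀ habs, one_mul] at h1
    exact h1
  rw [im_smul_eq]
  change |γ.1.det| * z.im / ((γ.1 1 0 * z.re + γ.1 1 1) ^ 2 + (γ.1 1 0 * z.im) ^ 2) ≤ _
  by_cases hc : γ.1 1 0 = 0
  · have hd : γ.1 1 1 ≠ 0 := fun h => hdet (by rw [hdet2, h, hc]; ring)
    have hle := hint _ _ hd h01
    have hpos : 0 < γ.1 1 1 ^ 2 := by positivity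
    rw [hc]
    have : |γ.1.det| * z.im / ((0 * z.re + γ.1 1 1) ^ 2 + (0 * z.im) ^ 2) ≤ z.im := by
      rw [zero_mul, zero_mul, zero_add, zero_pow two_ne_zero, add_zero, div_le_iff₀ hpos, mul_comm]
      gcongr
    linarith
  · have hle := hint _ (-(N * u)) hc (by push_cast; linarith)
    have hpos : 0 < (γ.1 1 0 * z.im) ^ 2 := by positivity
    have : |γ.1.det| * z.im / ((γ.1 1 0 * z.re + γ.1 1 1) ^ 2 + (γ.1 1 0 * z.im) ^ 2) ≤
        1 / z.im := by
      rw [div_le_div_iff₀ (by positivity) hz, one_mul]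
      have h1 : |γ.1.det| * z.im ^ 2 ≤ γ.1 1 0 ^ 2 * z.im ^ 2 := by gcongr
      nlinarith [sq_nonneg (γ.1 1 0 * z.re + γ.1 1 1)]
    linarith

theorem im_le_height {N : ℕ} {γ : GL (Fin 2) ℝ} (hγ : γ ∈ atkinLehnerGroup N) (g : GL (Fin 2) ℝ) :
    ((γ * g) • UpperHalfPlane.I).im ≤ height N g := by
  rw [mul_smul]
  exact le_csSup (bddAbove_height N _) ⟨γ, hγ, rfl⟩

theorem height_pos (N : ℕ) (g : GL (Fin 2) ℝ) : 0 < height N g := by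
  have := im_le_height (one_mem (atkinLehnerGroup N)) g
  exact (UpperHalfPlane.im_pos _).trans_le this

theorem im_smul_I (h : GL (Fin 2) ℝ) :
    (h • UpperHalfPlane.I).im = |h.1.det| / (h.1 1 0 ^ 2 + h.1 1 1 ^ 2) := by
  rw [im_smul_eq]
  simp [add_comm]

theorem trace_conj_mul_splitBasis_i (g : GL (Fin 2) ℝ) (A B C : ℝ) :
    ((g⁻¹).1 * !![A, B; C, -A] * g.1 * splitBasis.i).trace * g.1.det =
      C * (g.1 0 0 ^ 2 + g.1 0 1 ^ 2) - 2 * A * (g.1 0 0 * g.1 1 0 + g.1 0 1 * g.1 1 1)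
        - B * (g.1 1 0 ^ 2 + g.1 1 1 ^ 2) := by
  have hdet : g.1.det ≠ 0 := g.det_ne_zero
  have hinv : (g⁻¹).1 = (g.1.det)⁻¹ • !![g.1 1 1, -g.1 0 1; -g.1 1 0, g.1 0 0] := by
    rw [Matrix.coe_units_inv, Matrix.inv_def, Ring.inverse_eq_inv', Matrix.adjugate_fin_two]
  rw [hinv, smul_mul_assoc, smul_mul_assoc, smul_mul_assoc, Matrix.trace_smul, smul_eq_mul,
    mul_comm, mul_inv_cancel_left₀ hdet]
  simp only [splitBasis, Matrix.trace_fin_two, Matrix.mul_apply, Fin.sum_univ_two, Matrix.of_apply,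
    Matrix.cons_val', Matrix.cons_val_zero, Matrix.cons_val_one, Matrix.cons_val_fin_one]
  ring

theorem sq_add_sq_pos {x y : ℝ} (h : x = 0 → y = 0 → False) : 0 < x ^ 2 + y ^ 2 := by
  refine lt_of_le_of_ne (by positivity) fun h0 => ?_
  have := (add_eq_zero_iff_of_nonneg (sq_nonneg x) (sq_nonneg y)).mp h0.symm
  exact h (pow_eq_zero_iff two_ne_zero |>.mp this.1) (pow_eq_zero_iff two_ne_zero |>.mp this.2)

/-- An isotropic vector of `R(ℓ)⁰` is, up to an Atkin–Lehner operator `γ`, a strictly upper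
triangular matrix with entry in `ℓ⁻¹ ℤ`. The trace of its conjugate by `g` times `i` is, up to sign,
that entry divided by `Im (γ g i)`. -/
theorem inv_height_le_abs_trace {N l m : ℕ} (hN : Squarefree N) (hlm : N = l * m)
    (g : GL (Fin 2) ℝ) (a b c : ℤ) (hne : ¬ (a = 0 ∧ b = 0 ∧ c = 0))
    (hdet : (l : ℤ) * a ^ 2 + b * (m * c) = 0) :
    1 / (l * height N g) ≤
      |((g⁻¹).1 * !![(a : ℝ), (b : ℝ) / l; (m : ℝ) * c, -(a : ℝ)] * g.1 * splitBasis.i).trace| := by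
  have hN0 := hN.ne_zero
  have hl0 : l ≠ 0 := by rintro rfl; simp at hlm; exact hN0 hlm
  have hm0 : m ≠ 0 := by rintro rfl; simp at hlm; exact hN0 hlm
  have hlR : (0 : ℝ) < l := by positivity
  have hΔ : g.1.det ≠ 0 := g.det_ne_zero
  have hΔ' := abs_pos.mpr hΔ
  have hH := height_pos N g
  have htr := trace_conj_mul_splitBasis_i g a (b / l) (m * c)
  set t := ((g⁻¹).1 * !![(a : ℝ), (b : ℝ) / l; (m : ℝ) * c, -(a : ℝ)] * g.1 *
    splitBasis.i).trace with ht
  have hrow : 0 < g.1 1 0 ^ 2 + g.1 1 1 ^ 2 := by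
    refine sq_add_sq_pos fun h0 h1 => hΔ ?_
    rw [Matrix.det_fin_two, h0, h1]; ring
  rw [div_le_iff₀ (by positivity)]
  by_cases hc : c = 0
  · subst hc
    have ha : a = 0 := by
      have : (l : ℤ) * a ^ 2 = 0 := by simpa using hdet
      simpa [hl0] using this
    subst ha
    have hb : b ≠ 0 := fun h => hne ⟨rfl, h, rfl⟩
    have hb1 : (1 : ℝ) ≤ |(b : ℝ)| := by exact_mod_cast Int.one_le_abs hb
    have him := im_le_height (one_mem (atkinLehnerGroup N)) g
    rw [one_mul, im_smul_I, div_le_iff₀ hrow] at him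
    have habs : |t| * |g.1.det| = |(b : ℝ)| / l * (g.1 1 0 ^ 2 + g.1 1 1 ^ 2) := by
      rw [← abs_mul, htr]
      simp only [Int.cast_zero, mul_zero, zero_mul, sub_zero, zero_sub]
      rw [abs_neg, abs_mul, abs_div, abs_of_pos hlR, abs_of_pos hrow]
    have h1 : |t| * (l * height N g) * |g.1.det|
        = |(b : ℝ)| * (height N g * (g.1 1 0 ^ 2 + g.1 1 1 ^ 2)) := by
      rw [mul_right_comm, habs]; field_simp
    refine le_of_mul_le_mul_right ?_ hΔ'
    rw [h1, one_mul]
    nlinarith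
  · -- `u / w` is the fixed point of the matrix, in lowest terms
    have hmc : (m : ℤ) * c ≠ 0 := mul_ne_zero (by exact_mod_cast hm0) hc
    obtain ⟨h, u, w, hh, hcop, hu, hw⟩ : ∃ h u w : ℤ, 0 < h ∧ IsCoprime u w ∧ a = u * h ∧
        (m : ℤ) * c = w * h := by
      have hg : 0 < Int.gcd a (m * c) := Int.gcd_pos_of_ne_zero_right _ hmc
      obtain ⟨u, w, hcop, hu, hw⟩ := Int.exists_gcd_one hg
      exact ⟨_, u, w, by exact_mod_cast hg, Int.isCoprime_iff_gcd_eq_one.mpr hcop, hu, hw⟩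
    have hw0 : w ≠ 0 := by rintro rfl; simp at hw; omega
    have hrel : (l : ℤ) * u ^ 2 * h = -b * w := by
      have : ((l : ℤ) * u ^ 2 * h + b * w) * h = 0 := by
        rw [hu, hw] at hdet; linear_combination hdet
      have := (mul_eq_zero.mp this).resolve_right hh.ne'
      linarith
    obtain ⟨k, hk⟩ : w ∣ l * h := by
      refine (hcop.symm.pow_right (n := 2)).dvd_of_dvd_mul_left ⟨-b, ?_⟩
      linear_combination hrel
    -- the Atkin–Lehner operator moving `u / w` to infinity has determinant `e = N / gcd(N, w)`
    set f := Nat.gcd N w.natAbs with hf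
    set e := N / f with he
    have hef : N = e * f := (Nat.div_mul_cancel (Nat.gcd_dvd_left _ _)).symm
    have he0 : 0 < e := Nat.pos_of_ne_zero (by rintro h; rw [h, zero_mul] at hef; exact hN0 hef)
    have hew : IsCoprime (e : ℤ) w := by
      have := Nat.coprime_div_gcd_of_squarefree hN (Int.natAbs_ne_zero.mpr hw0)
      exact Int.isCoprime_iff_gcd_eq_one.mpr this
    obtain ⟨w', hw'⟩ : (f : ℤ) ∣ w := Int.natCast_dvd.mpr (Nat.gcd_dvd_right _ _)
    obtain ⟨k', hk'⟩ : (e : ℤ) ∣ k := by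
      refine (hew.pow_right (n := 2)).dvd_of_dvd_mul_left ⟨f * c, ?_⟩
      have h1 : (N : ℤ) * c = l * (m * c) := by rw [hlm]; push_cast; ring
      have h2 : (N : ℤ) = e * f := by exact_mod_cast hef
      rw [h2, hw] at h1
      linear_combination (-1) * h1 - w * hk
    have hk0 : k' ≠ 0 := by
      rintro rfl
      rw [hk', mul_zero, mul_zero] at hk
      exact mul_ne_zero (by exact_mod_cast hl0) hh.ne' hk
    obtain ⟨x, y, hxy⟩ : IsCoprime ((e : ℤ) * u) w := IsCoprime.mul_left hew hcop
    have heR : (0 : ℝ) < e := by positivity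
    set M : Matrix (Fin 2) (Fin 2) ℝ :=
      !![(e : ℝ) * ((-x : ℤ) : ℝ), ((-y : ℤ) : ℝ); (N : ℝ) * (w' : ℝ), (e : ℝ) * ((-u : ℤ) : ℝ)]
      with hM
    have hNw : (N : ℝ) * w' = e * w := by
      rw [hef, hw']; push_cast; ring
    have hxyR : (x : ℝ) * (e * u) + y * w = 1 := by exact_mod_cast hxy
    have hdetM : M.det = e := by
      rw [hM, Matrix.det_fin_two_of, hNw]; push_cast
      linear_combination (e : ℝ) * hxyR
    set γ : GL (Fin 2) ℝ := Matrix.GeneralLinearGroup.mkOfDetNeZero M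
      (by rw [hdetM]; exact heR.ne') with hγ
    have hγM : γ.1 = M := rfl
    have hmem : γ ∈ atkinLehnerGroup N := by
      refine Subgroup.subset_closure ⟨e, -x, -y, w', -u, he0, ⟨f, hef⟩, ?_, hγM⟩
      have hNw' : (N : ℤ) * w' = e * w := by exact_mod_cast hNw
      rw [hNw']
      linear_combination (e : ℤ) * hxy
    have him := im_le_height hmem g
    have hprod : (γ * g).1 = M * g.1 := rfl
    rw [im_smul_I, hprod, Matrix.det_mul, hdetM, abs_mul, abs_of_pos heR] at him
    set q := (w * g.1 0 0 - u * g.1 1 0) ^ 2 + (w * g.1 0 1 - u * g.1 1 1) ^ 2 with hq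
    have hrows : (M * g.1) 1 0 ^ 2 + (M * g.1) 1 1 ^ 2 = e ^ 2 * q := by
      simp only [hM, Matrix.mul_apply, Fin.sum_univ_two, Matrix.of_apply, Matrix.cons_val',
        Matrix.cons_val_zero, Matrix.cons_val_one, Matrix.cons_val_fin_one, hNw, hq]
      push_cast; ring
    have hwR : (w : ℝ) ≠ 0 := by exact_mod_cast hw0
    have hq0 : 0 < q := by
      refine sq_add_sq_pos fun h1 h2 => ?_
      have : (w : ℝ) * g.1.det = 0 := by
        rw [Matrix.det_fin_two]; linear_combination g.1 1 1 * h1 - g.1 1 0 * h2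
      exact hΔ ((mul_eq_zero.mp this).resolve_left hwR)
    rw [hrows, div_le_iff₀ (by positivity)] at him
    have haR : (a : ℝ) = u * h := by exact_mod_cast hu
    have hmcR : (m : ℝ) * c = w * h := by exact_mod_cast hw
    have hkR : (l : ℝ) * h = w * (e * k') := by rw [hk'] at hk; exact_mod_cast hk
    have hbR : (b : ℝ) = -(u ^ 2 * (e * k')) := by
      have h1 : (l : ℝ) * u ^ 2 * h = -b * w := by exact_mod_cast hrel
      have h2 : (b + u ^ 2 * (e * k')) * (w : ℝ) = 0 := by linear_combination h1 - u ^ 2 * hkR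
      have := (mul_eq_zero.mp h2).resolve_right hwR
      linarith
    have htl : l * (t * g.1.det) = e * k' * q := by
      rw [htr, hmcR, haR, hbR]
      field_simp
      rw [hq]
      linear_combination (w * (g.1 0 0 ^ 2 + g.1 0 1 ^ 2)
        - 2 * u * (g.1 0 0 * g.1 1 0 + g.1 0 1 * g.1 1 1)) * hkR
    have hk1 : (1 : ℝ) ≤ |(k' : ℝ)| := by exact_mod_cast Int.one_le_abs hk0
    have habs : l * (|t| * |g.1.det|) = e * |(k' : ℝ)| * q := by
      have := congrArg abs htl
      rwa [abs_mul, abs_mul, abs_mul, abs_mul, abs_of_pos hlR, abs_of_pos heR,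
        abs_of_pos hq0] at this
    have him' : |g.1.det| ≤ height N g * (e * q) := by
      refine le_of_mul_le_mul_left ?_ heR
      linarith
    refine le_of_mul_le_mul_right ?_ hΔ'
    calc 1 * |g.1.det| ≤ height N g * (e * q) := by rw [one_mul]; exact him'
      _ ≤ |(k' : ℝ)| * (height N g * (e * q)) := le_mul_of_one_le_left (by positivity) hk1
      _ = height N g * (e * |(k' : ℝ)| * q) := by ring
      _ = |t| * (l * height N g) * |g.1.det| := by rw [← habs]; ring

end Height

/-! ### The lattices of the split case -/

section Split

open scoped Matrix

theorem redTrace_mul_stdConj_matrix (x y : Matrix (Fin 2) (Fin 2) ℚ) :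
    redTrace ℚ _ (x * stdConj ℚ _ y) = x.trace * y.trace - (x * y).trace := by
  have h : x * stdConj ℚ _ y = redTrace ℚ _ y • x - x * y := by
    rw [stdConj, mul_sub, ← Algebra.commutes, Algebra.smul_def]
  rw [h, redTrace_sub, redTrace_smul, redTrace_matrix, redTrace_matrix, redTrace_matrix, mul_comm]

/-- For the standard order of squarefree level `ℓ m`, the elements of `R(ℓ)⁰` are the matrices
`!![a, b / ℓ; m c, -a]` with integers `a`, `b`, `c`. -/
theorem exists_int_of_mem_partialDualZero_stdOrder {N l m : ℕ} (hN : Squarefree N)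
    (hlm : N = l * m) {x : Matrix (Fin 2) (Fin 2) ℚ} (hx : x ∈ partialDualZero (stdOrder N) l) :
    ∃ a b c : ℤ, x = !![(a : ℚ), (b : ℚ) / l; (m : ℚ) * c, -(a : ℚ)] := by
  obtain ⟨hx, h0⟩ := hx
  have hl0 : (l : ℚ) ≠ 0 := by
    have := hN.ne_zero
    rw [hlm] at this
    exact_mod_cast left_ne_zero_of_mul this
  have hm0 : (m : ℚ) ≠ 0 := by
    have := hN.ne_zero
    rw [hlm] at this
    exact_mod_cast right_ne_zero_of_mul this
  rw [redTrace_matrix] at h0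
  have h11 : x 1 1 = -x 0 0 := by
    rw [Matrix.trace_fin_two] at h0; linarith
  have hloc : ∀ (p : ℕ) [Fact p.Prime], ‖((x 0 0 : ℚ) : ℚ_[p])‖ ≤ 1 ∧
      ‖((l * x 0 1 : ℚ) : ℚ_[p])‖ ≤ 1 ∧ ‖((x 1 0 / m : ℚ) : ℚ_[p])‖ ≤ 1 := by
    intro p hp
    have hint : ∀ k : ℤ, ‖(k : ℚ_[p])‖ ≤ 1 := fun k => Padic.norm_int_le_one k
    by_cases hpl : p ∣ l
    · have hpm : ¬ p ∣ m := fun h =>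
        hp.out.one_lt.ne' (Nat.isUnit_iff.mp (hN p (hlm ▸ mul_dvd_mul hpl h)))
      have hm1 : ‖(m : ℚ_[p])‖ = 1 := norm_natCast_eq_one_of_not_dvd hpm
      have key := fun y hy => Padic.norm_rat_le_one ((hx p hp.out).1 hpl y hy)
      simp only [redTrace_mul_stdConj_matrix, h0, zero_mul, zero_sub, Rat.cast_neg,
        norm_neg] at key
      have k1 := key !![1, 0; 0, 0] ⟨1, 0, 0, 0, by simp⟩
      have k2 := key !![0, 1; 0, 0] ⟨0, 1, 0, 0, by simp⟩
      have k3 := key !![0, 0; N, 0] ⟨0, 0, 1, 0, by simp⟩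
      simp only [Matrix.trace_fin_two, Matrix.mul_apply, Fin.sum_univ_two, Matrix.of_apply,
        Matrix.cons_val', Matrix.cons_val_zero, Matrix.cons_val_one, Matrix.cons_val_fin_one,
        mul_zero, mul_one, add_zero, zero_add] at k1 k2 k3
      refine ⟨k1, ?_, ?_⟩
      · rw [hlm] at k3
        push_cast at k3 ⊢
        rw [norm_mul, norm_mul, hm1, mul_one] at k3
        rwa [norm_mul, mul_comm]
      · rw [Rat.cast_div, norm_div, Rat.cast_natCast, hm1, div_one]; exact k2
    · obtain ⟨n, hn, a, b, c, d, hnx⟩ := (hx p hp.out).2 hpl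
      have hn1 : ‖(n : ℚ_[p])‖ = 1 := norm_natCast_eq_one_of_not_dvd hn
      have hscale : ∀ (q : ℚ) (k : ℤ), n * q = k → ‖(q : ℚ_[p])‖ ≤ 1 := by
        intro q k h
        have h' : (n : ℚ_[p]) * (q : ℚ_[p]) = k := by exact_mod_cast h
        have := hint k
        rwa [← h', norm_mul, hn1, one_mul] at this
      have e00 := congrFun (congrFun hnx 0) 0
      have e01 := congrFun (congrFun hnx 0) 1
      have e10 := congrFun (congrFun hnx 1) 0
      simp at e00 e01 e10
      refine ⟨hscale _ a e00, hscale _ (l * b) ?_, hscale _ (l * c) ?_⟩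
      · push_cast; rw [← e01]; ring
      · rw [mul_div_assoc', e10, hlm]; push_cast; field_simp
  obtain ⟨a, ha⟩ := exists_int_eq_of_forall_norm_le_one fun p hp => (hloc p).1
  obtain ⟨b, hb⟩ := exists_int_eq_of_forall_norm_le_one fun p hp => (hloc p).2.1
  obtain ⟨c, hc⟩ := exists_int_eq_of_forall_norm_le_one fun p hp => (hloc p).2.2
  refine ⟨a, b, c, ?_⟩
  rw [ha, hb, hc, mul_div_cancel_left₀ _ hl0, mul_div_cancel₀ _ hm0, ← h11]
  exact Matrix.eta_fin_two x

/-- The trace zero matrix `!![a, b / ℓ; m c, -a]`. -/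
noncomputable def splitMat (l m : ℕ) (a b c : ℤ) : Matrix (Fin 2) (Fin 2) ℝ :=
  !![(a : ℝ), (b : ℝ) / l; (m : ℝ) * c, -(a : ℝ)]

theorem exists_int_of_mem_splitLattice {N l m : ℕ} (hN : Squarefree N) (hlm : N = l * m)
    {g : GL (Fin 2) ℝ} {x : Matrix (Fin 2) (Fin 2) ℝ} (hx : x ∈ splitLattice N l g) :
    ∃ a b c : ℤ, x = (g⁻¹).1 * splitMat l m a b c * g.1 := by
  obtain ⟨M, hM, rfl⟩ := hx
  obtain ⟨a, b, c, rfl⟩ := exists_int_of_mem_partialDualZero_stdOrder hN hlm hM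
  refine ⟨a, b, c, ?_⟩
  dsimp only
  congr 2
  ext i j
  fin_cases i <;> fin_cases j <;> simp [splitMat]

theorem sub_mem_splitLattice {N l : ℕ} {g : GL (Fin 2) ℝ} {x y : Matrix (Fin 2) (Fin 2) ℝ}
    (hx : x ∈ splitLattice N l g) (hy : y ∈ splitLattice N l g) : x - y ∈ splitLattice N l g := by
  obtain ⟨M, hM, rfl⟩ := hx
  obtain ⟨M', hM', rfl⟩ := hy
  refine ⟨M - M', sub_mem_partialDualZero hM hM', ?_⟩
  dsimp only
  rw [← sub_mul, ← mul_sub]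
  congr 2
  ext i j
  simp

theorem exists_ne_zero_mem_splitLattice (N l : ℕ) (g : GL (Fin 2) ℝ) :
    ∃ x ∈ splitLattice N l g, x ≠ 0 := by
  refine ⟨_, ⟨!![1, 0; 0, -1], ⟨fun p hp => ⟨fun _ y hy => ?_, fun _ => ⟨1, ?_, ?_⟩⟩, ?_⟩, rfl⟩, ?_⟩
  · obtain ⟨a, b, c, d, rfl⟩ := hy
    rw [redTrace_mul_stdConj_matrix]
    have : (!![1, 0; 0, -1] : Matrix (Fin 2) (Fin 2) ℚ).trace *
        !![(a : ℚ), (b : ℚ); (N : ℚ) * c, (d : ℚ)].trace -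
        (!![1, 0; 0, -1] * !![(a : ℚ), (b : ℚ); (N : ℚ) * c, (d : ℚ)]).trace =
          ((d - a : ℤ) : ℚ) := by
      simp [Matrix.trace_fin_two, sub_eq_add_neg]
    rw [this, Rat.den_intCast]
    exact fun h => hp.one_lt.ne' (Nat.dvd_one.mp h)
  · exact fun h => hp.one_lt.ne' (Nat.dvd_one.mp h)
  · exact ⟨1, 0, 0, -1, by simp⟩
  · rw [redTrace_matrix]; simp [Matrix.trace_fin_two]
  · intro h
    have h1 := congrArg (fun y => g.1 * y * (g⁻¹).1) h
    simp only [mul_assoc, Units.mul_inv_cancel_left, Units.mul_inv, mul_one, mul_zero,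
      zero_mul] at h1
    have := congrFun (congrFun h1 0) 0
    simp at this

theorem conj_mul_conj (g : GL (Fin 2) ℝ) (X Y : Matrix (Fin 2) (Fin 2) ℝ) :
    (g⁻¹).1 * X * g.1 * ((g⁻¹).1 * Y * g.1) = (g⁻¹).1 * (X * Y) * g.1 := by
  simp only [mul_assoc, Units.mul_inv_cancel_left]

theorem trace_conj (g : GL (Fin 2) ℝ) (X : Matrix (Fin 2) (Fin 2) ℝ) :
    ((g⁻¹).1 * X * g.1).trace = X.trace := by
  rw [Matrix.trace_mul_comm, ← mul_assoc, Units.mul_inv, one_mul]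

theorem det_conj (g : GL (Fin 2) ℝ) (X : Matrix (Fin 2) (Fin 2) ℝ) :
    ((g⁻¹).1 * X * g.1).det = X.det := by
  rw [Matrix.det_mul_comm, ← mul_assoc, Units.mul_inv, one_mul]

theorem trace_splitMat (l m : ℕ) (a b c : ℤ) : (splitMat l m a b c).trace = 0 := by
  simp [splitMat, Matrix.trace_fin_two]

theorem mul_det_splitMat {l m : ℕ} (hl : (l : ℝ) ≠ 0) (a b c : ℤ) :
    l * (splitMat l m a b c).det = ((-(l * a ^ 2 + b * (m * c)) : ℤ) : ℝ) := by
  rw [splitMat, Matrix.det_fin_two_of]; push_cast; field_simp; ring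

/-- Commutators in `R(ℓ)⁰` are multiples of elements of `R(m)⁰`. -/
theorem commutator_splitMat {l m : ℕ} (hl : (l : ℝ) ≠ 0) (hm : (m : ℝ) ≠ 0) (a b c a' b' c' : ℤ) :
    splitMat l m a b c * splitMat l m a' b' c' - splitMat l m a' b' c' * splitMat l m a b c =
      ((m : ℝ) / l) • splitMat m l (b * c' - b' * c) (2 * (a * b' - a' * b))
        (2 * (c * a' - c' * a)) := by
  ext i j
  fin_cases i <;> fin_cases j <;> simp [splitMat] <;> field_simp <;> ring

theorem trace_splitMat_mul_splitMat {l m : ℕ} (hl : (l : ℝ) ≠ 0) (hm : (m : ℝ) ≠ 0)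
    (a b c a' b' c' : ℤ) : (splitMat m l a b c * splitMat l m a' b' c').trace =
      ((2 * a * a' + b * c' + c * b' : ℤ) : ℝ) := by
  simp [splitMat, Matrix.trace_fin_two]; field_simp; ring

theorem div_min_le {t a b : ℝ} (ht : 0 ≤ t) (ha : 0 < a) (hb : 0 < b) :
    t / min a b ≤ t / a + t / b := by
  have h1 : 0 ≤ t / a := by positivity
  have h2 : 0 ≤ t / b := by positivity
  rcases min_choice a b with h | h <;> rw [h] <;> linarith

/-- Either the determinant or the height bounds a nonzero element of `R(ℓ)⁰` from below, according
to whether it is anisotropic. -/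
theorem splitMat_bound {N l m : ℕ} (hN : Squarefree N) (hlm : N = l * m) (g : GL (Fin 2) ℝ)
    {a b c : ℤ} (hne : splitMat l m a b c ≠ 0) :
    1 ≤ l * |((g⁻¹).1 * splitMat l m a b c * g.1).det| ∨
    ((g⁻¹).1 * splitMat l m a b c * g.1).det = 0 ∧
      1 / (l * height N g) ≤ |((g⁻¹).1 * splitMat l m a b c * g.1 * splitBasis.i).trace| := by
  have hl0 : (l : ℝ) ≠ 0 := by
    have := hN.ne_zero
    rw [hlm] at this
    exact_mod_cast left_ne_zero_of_mul this
  have hd := mul_det_splitMat (m := m) hl0 a b c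
  rw [det_conj]
  by_cases h0 : (l : ℤ) * a ^ 2 + b * (m * c) = 0
  · right
    rw [h0, neg_zero, Int.cast_zero, mul_eq_zero] at hd
    refine ⟨hd.resolve_left hl0, inv_height_le_abs_trace hN hlm g a b c ?_ h0⟩
    rintro ⟨rfl, rfl, rfl⟩
    refine hne ?_
    ext i j
    fin_cases i <;> fin_cases j <;> simp [splitMat]
  · left
    have h1 : (1 : ℝ) ≤ |((-(l * a ^ 2 + b * (m * c)) : ℤ) : ℝ)| := by
      exact_mod_cast Int.one_le_abs (neg_ne_zero.mpr h0)
    rwa [← hd, abs_mul, Nat.abs_cast] at h1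

/-- Successive minima and point counts in boxes of scaled coordinates for `g⁻¹ R(ℓ)⁰ g` in the
split case. -/
theorem splitLattice_bounds {N l : ℕ} (hN : Squarefree N) (hl : l ∣ N) (g : GL (Fin 2) ℝ) {β : ℝ}
    (hβ : 0 < β) (hβ1 : β ≤ 1) :
    (∀ x ∈ splitLattice N l g, x ≠ 0 →
      min (1 / (4 * Real.sqrt l)) (1 / (3 * (l * β * height N g))) ≤
        ‖scaledCoords splitBasis 1 β x‖) ∧
    ∀ (T : ℝ) (S : Set (Matrix (Fin 2) (Fin 2) ℝ)), 0 < T → S ⊆ splitLattice N l g →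
      (∀ x ∈ S, ‖scaledCoords splitBasis 1 β x‖ ≤ T) →
      S.Finite ∧ (S.ncard : ℝ) ≤ 2688 * (1 + (Real.sqrt l + l * β * height N g) * T
        + (Real.sqrt l ^ 3 * β / Real.sqrt N + l * β ^ 2 * height N g) * T ^ 2
        + (l : ℝ) ^ 2 * β ^ 2 / N * T ^ 3) := by
  obtain ⟨m, hlm⟩ := hl
  have hN0 := hN.ne_zero
  have hl0 : l ≠ 0 := left_ne_zero_of_mul (hlm ▸ hN0)
  have hm0 : m ≠ 0 := right_ne_zero_of_mul (hlm ▸ hN0)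
  have hNR : (0 : ℝ) < N := by positivity
  have hlR : (0 : ℝ) < l := by positivity
  have hmR : (0 : ℝ) < m := by positivity
  have hNlm : (N : ℝ) = l * m := by exact_mod_cast hlm
  have hH := height_pos N g
  set H := height N g with hHdef
  have h4 : Module.finrank ℝ (Matrix (Fin 2) (Fin 2) ℝ) = 4 := by
    simp [Module.finrank_matrix]
  have hs : (1 : ℝ) = 1 ∨ (1 : ℝ) = -1 := Or.inl rfl
  have htr : ∀ x ∈ splitLattice N l g, redTrace ℝ _ x = 0 := by
    intro x hx
    obtain ⟨a, b, c, rfl⟩ := exists_int_of_mem_splitLattice hN hlm hx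
    rw [redTrace_matrix, trace_conj, trace_splitMat]
  have b1 : ∀ x ∈ splitLattice N l g, x ≠ 0 →
      min (1 / (4 * Real.sqrt l)) (1 / (3 * (l * β * H))) ≤
        ‖scaledCoords splitBasis 1 β x‖ := by
    intro y hy hne
    obtain ⟨hle, hi⟩ := redNorm_le_scaledCoords splitBasis h4 hs one_pos le_rfl hβ hβ1 (htr y hy)
    obtain ⟨a, b, c, rfl⟩ := exists_int_of_mem_splitLattice hN hlm hy
    rw [redNorm_matrix] at hle hi
    rw [redTrace_matrix] at hi
    set n := ‖scaledCoords splitBasis 1 β ((g⁻¹).1 * splitMat l m a b c * g.1)‖ with hn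
    have hn0 : 0 ≤ n := norm_nonneg _
    rcases splitMat_bound hN hlm g (a := a) (b := b) (c := c)
      (fun h => hne (by rw [h, mul_zero, zero_mul])) with h | ⟨h, h'⟩
    · refine min_le_of_left_le (inv_sqrt_le_of_sq hlR hn0 (h.trans ?_))
      calc _ ≤ (l : ℝ) * (3 * n ^ 2) := by gcongr
        _ ≤ _ := by nlinarith [mul_nonneg hlR.le (sq_nonneg n)]
    · refine min_le_of_right_le ?_
      have h3 : |((g⁻¹).1 * splitMat l m a b c * g.1 * splitBasis.i).trace| ≤ 3 * β * n := by
        refine abs_le_of_sq_le_sq ((hi h).trans ?_) (by positivity)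
        nlinarith [sq_nonneg (β * n)]
      have h4 := h'.trans h3
      rw [div_le_iff₀ (by positivity)] at h4 ⊢
      linarith
  refine ⟨b1, fun T S hT hSL hST => ?_⟩
  have hs1 := Real.sqrt_pos.mpr hlR
  have hs2 := Real.sqrt_pos.mpr hNR
  have hmain := finite_and_ncard_le splitBasis h4 hs one_pos hβ (L := splitLattice N l g) (S := S)
    (m₁ := min (1 / (4 * Real.sqrt l)) (1 / (3 * (l * β * H))))
    (m₂ := min (Real.sqrt N / (14 * Real.sqrt l ^ 3 * β)) (1 / (4 * (l * β ^ 2 * H))))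
    (m₃ := N / (4 * l ^ 2 * β ^ 2)) (T := T) htr (fun x hx y hy => sub_mem_splitLattice hx hy)
    (lt_min (by positivity) (by positivity)) (lt_min (by positivity) (by positivity))
    (by positivity) hT b1 ?_ ?_ hSL hST
  · refine ⟨hmain.1, hmain.2.trans ?_⟩
    have e1 : T / min (1 / (4 * Real.sqrt l)) (1 / (3 * (l * β * H)))
        ≤ 4 * (Real.sqrt l * T) + 3 * (l * β * H * T) := by
      refine (div_min_le hT.le (by positivity) (by positivity)).trans_eq ?_
      field_simp
    have e2 : T ^ 2 / min (Real.sqrt N / (14 * Real.sqrt l ^ 3 * β)) (1 / (4 * (l * β ^ 2 * H)))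
        ≤ 14 * (Real.sqrt l ^ 3 * β / Real.sqrt N * T ^ 2) + 4 * (l * β ^ 2 * H * T ^ 2) := by
      refine (div_min_le (by positivity) (by positivity) (by positivity)).trans_eq ?_
      field_simp
    have e3 : T ^ 3 / (N / (4 * l ^ 2 * β ^ 2)) = 4 * ((l : ℝ) ^ 2 * β ^ 2 / N * T ^ 3) := by
      field_simp
    have p1 : 0 ≤ Real.sqrt l * T := by positivity
    have p2 : 0 ≤ l * β * H * T := by positivity
    have p3 : 0 ≤ Real.sqrt l ^ 3 * β / Real.sqrt N * T ^ 2 := by positivity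
    have p4 : 0 ≤ l * β ^ 2 * H * T ^ 2 := by positivity
    have p5 : 0 ≤ (l : ℝ) ^ 2 * β ^ 2 / N * T ^ 3 := by positivity
    rw [add_mul, add_mul]
    linarith
  · intro x hx y hy hne
    obtain ⟨hc1, hc2, hc3, -⟩ := commutator_le_scaledCoords splitBasis h4 hs one_pos le_rfl hβ hβ1
      (htr _ hx) (htr _ hy) (htr _ hx)
    have hcomm := hc1 hne
    obtain ⟨a, b, c, rfl⟩ := exists_int_of_mem_splitLattice hN hlm hx
    obtain ⟨a', b', c', rfl⟩ := exists_int_of_mem_splitLattice hN hlm hy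
    have hcm : (g⁻¹).1 * splitMat l m a b c * g.1 * ((g⁻¹).1 * splitMat l m a' b' c' * g.1)
        - (g⁻¹).1 * splitMat l m a' b' c' * g.1 * ((g⁻¹).1 * splitMat l m a b c * g.1)
        = ((m : ℝ) / l) • ((g⁻¹).1 * splitMat m l (b * c' - b' * c) (2 * (a * b' - a' * b))
          (2 * (c * a' - c' * a)) * g.1) := by
      rw [conj_mul_conj, conj_mul_conj, ← sub_mul, ← mul_sub,
        commutator_splitMat hlR.ne' hmR.ne', mul_smul_comm, smul_mul_assoc]
    set n := ‖scaledCoords splitBasis 1 β ((g⁻¹).1 * splitMat l m a b c * g.1) ⨯₃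
      scaledCoords splitBasis 1 β ((g⁻¹).1 * splitMat l m a' b' c' * g.1)‖ with hn
    have hn0 : 0 ≤ n := norm_nonneg _
    rw [hcm, redNorm_matrix, Matrix.det_smul, Fintype.card_fin, abs_mul,
      abs_of_pos (by positivity : 0 < ((m : ℝ) / l) ^ 2)] at hc2
    rw [hcm, redTrace_matrix, smul_mul_assoc, Matrix.trace_smul, smul_eq_mul, abs_mul,
      abs_of_pos (by positivity : 0 < (m : ℝ) / l)] at hc3
    rcases splitMat_bound hN (hlm.trans (mul_comm l m)) g (a := b * c' - b' * c)
      (b := 2 * (a * b' - a' * b)) (c := 2 * (c * a' - c' * a))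
      (fun h => hcomm (by rw [hcm, h, mul_zero, zero_mul, smul_zero])) with h | ⟨-, h⟩
    · refine min_le_of_left_le (sqrt_div_le_of_sq hlR hβ hn0 hNR.le ?_)
      set d := |((g⁻¹).1 * splitMat m l (b * c' - b' * c) (2 * (a * b' - a' * b))
          (2 * (c * a' - c' * a)) * g.1).det|
      calc (N : ℝ) ≤ N * (m * d) := le_mul_of_one_le_right hNR.le h
        _ = l ^ 3 * (((m : ℝ) / l) ^ 2 * d) := by rw [hNlm]; field_simp
        _ ≤ l ^ 3 * (12 * β ^ 2 * n ^ 2) := by gcongr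
        _ = 12 * (l ^ 3 * β ^ 2 * n ^ 2) := by ring
        _ ≤ 196 * (l ^ 3 * β ^ 2 * n ^ 2) := by gcongr; norm_num
        _ = _ := by ring
    · refine min_le_of_right_le ?_
      have h5 : (m : ℝ) / l * (1 / (m * H)) ≤ 4 * β ^ 2 * n :=
        (mul_le_mul_of_nonneg_left h (by positivity)).trans hc3
      rw [show (m : ℝ) / l * (1 / (m * H)) = 1 / (l * H) by field_simp,
        div_le_iff₀ (by positivity)] at h5
      rw [div_le_iff₀ (by positivity)]
      linarith
  · intro x hx y hy z hz hne
    obtain ⟨-, -, -, hc⟩ := commutator_le_scaledCoords splitBasis h4 hs one_pos le_rfl hβ hβ1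
      (htr _ hx) (htr _ hy) (htr _ hz)
    obtain ⟨a, b, c, rfl⟩ := exists_int_of_mem_splitLattice hN hlm hx
    obtain ⟨a', b', c', rfl⟩ := exists_int_of_mem_splitLattice hN hlm hy
    obtain ⟨e, f, h, rfl⟩ := exists_int_of_mem_splitLattice hN hlm hz
    have hpos := abs_pos.mpr hne
    set v := |(scaledCoords splitBasis 1 β ((g⁻¹).1 * splitMat l m a b c * g.1) ⨯₃
      scaledCoords splitBasis 1 β ((g⁻¹).1 * splitMat l m a' b' c' * g.1)) ⬝ᵥ
      scaledCoords splitBasis 1 β ((g⁻¹).1 * splitMat l m e f h * g.1)|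
    rw [conj_mul_conj, conj_mul_conj, ← sub_mul, ← mul_sub, conj_mul_conj, redTrace_matrix,
      trace_conj, commutator_splitMat hlR.ne' hmR.ne', smul_mul_assoc, Matrix.trace_smul,
      smul_eq_mul, trace_splitMat_mul_splitMat hlR.ne' hmR.ne', abs_mul,
      abs_of_pos (by positivity : 0 < (m : ℝ) / l), one_mul] at hc
    set k : ℤ := 2 * (b * c' - b' * c) * e + 2 * (a * b' - a' * b) * h + 2 * (c * a' - c' * a) * f
    have hk0 : k ≠ 0 := by
      intro h0
      rw [h0, Int.cast_zero, abs_zero, mul_zero] at hc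
      have : 0 < 4 * β ^ 2 * v := by positivity
      linarith
    have hk1 : (1 : ℝ) ≤ |(k : ℝ)| := by exact_mod_cast Int.one_le_abs hk0
    rw [div_le_iff₀ (by positivity)]
    calc (N : ℝ) = l ^ 2 * ((m : ℝ) / l * 1) := by rw [hNlm]; field_simp
      _ ≤ l ^ 2 * ((m : ℝ) / l * |(k : ℝ)|) := by gcongr
      _ = v * (4 * l ^ 2 * β ^ 2) := by rw [hc]; ring

end Split

/-! ### Passage to real powers -/

theorem sqrt_pow_three (x : ℝ) (hx : 0 ≤ x) : Real.sqrt x ^ 3 = x ^ (3 / 2 : ℝ) := by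
  rw [Real.sqrt_eq_rpow, ← Real.rpow_natCast, ← Real.rpow_mul hx]; norm_num

theorem rpow_neg_half (x : ℝ) (hx : 0 ≤ x) : x ^ (-(1 / 2) : ℝ) = (Real.sqrt x)⁻¹ := by
  rw [Real.rpow_neg hx, ← Real.sqrt_eq_rpow]

/-- A bound without the factor `(D (1 + T)) ^ ε` implies the one with it. -/
theorem le_mul_rpow_mul {D T ε C E n : ℝ} (hD : 1 ≤ D) (hT : 0 < T) (hε : 0 < ε) (hC : 0 ≤ C)
    (hE : 0 ≤ E) (h : n ≤ C * E) : n ≤ C * (D * (1 + T)) ^ ε * E := by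
  have h1 : 1 ≤ (D * (1 + T)) ^ ε := Real.one_le_rpow (by nlinarith) hε.le
  calc n ≤ C * E := h
    _ ≤ (C * E) * (D * (1 + T)) ^ ε := le_mul_of_one_le_right (by positivity) h1
    _ = _ := by ring

/-! ### The estimates -/

theorem redTrace_of_mem_splitLattice {N l : ℕ} {g : GL (Fin 2) ℝ} {x : Matrix (Fin 2) (Fin 2) ℝ}
    (hN : Squarefree N) (hl : l ∣ N) (hx : x ∈ splitLattice N l g) : redTrace ℝ _ x = 0 := by
  obtain ⟨m, hlm⟩ := hl
  obtain ⟨a, b, c, rfl⟩ := exists_int_of_mem_splitLattice hN hlm hx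
  rw [redTrace_matrix, trace_conj, trace_splitMat]

theorem redTrace_of_mem_realLattice {B : Type*} [Ring B] [Algebra ℚ B] [Module.Finite ℚ B]
    {R : Subring B} {l : ℕ} {g : (ℝ ⊗[ℚ] B)ˣ} {x : ℝ ⊗[ℚ] B} (hx : x ∈ realLattice R l g) :
    redTrace ℝ _ x = 0 := by
  obtain ⟨y, hy, rfl⟩ := hx
  have := redTrace_conjEmb g y
  rwa [hy.2, Rat.cast_zero] at this

theorem exists_ne_zero_mem_realLattice {B : Type*} [Ring B] [Algebra ℚ B] [Algebra.IsCentral ℚ B]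
    [Nontrivial B] (h4 : Module.finrank ℚ B = 4) (hB : ∀ x : B, x ≠ 0 → IsUnit x) {R : Subring B}
    (hR : IsOrder R) (l : ℕ) (g : (ℝ ⊗[ℚ] B)ˣ) : ∃ x ∈ realLattice R l g, x ≠ 0 := by
  obtain ⟨x, hx, hx0⟩ := exists_ne_zero_mem_partialDualZero h4 hB hR l
  exact ⟨_, ⟨x, hx, rfl⟩, conjEmb_ne_zero g hx0⟩

end QuatLattice

theorem mainTheorem8 :
    -- the split case: first successive minimum for `Ω`
    (∃ κ : ℝ, 0 < κ ∧ ∀ (N l : ℕ) (g : GL (Fin 2) ℝ) (δ : ℝ),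
      Squarefree N → l ∣ N → 0 < δ → δ ≤ 1 →
      κ * min ((l : ℝ) ^ (-(1 / 2) : ℝ))
          ((l : ℝ)⁻¹ * δ ^ (-(1 / 2) : ℝ) * (height N g)⁻¹) ≤
        succMin (regionOmega splitBasis δ 1 ∩ traceZero (Matrix (Fin 2) (Fin 2) ℝ))
          (splitLattice N l g) 1) ∧
    -- the split case: lattice point count for `Ω`
    (∀ ε : ℝ, 0 < ε → ∃ C : ℝ, 0 < C ∧ ∀ (N l : ℕ) (g : GL (Fin 2) ℝ) (δ T : ℝ),
      Squarefree N → l ∣ N → 0 < δ → δ ≤ 1 → 0 < T →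
      (splitLattice N l g ∩ regionOmega splitBasis δ T).Finite ∧
      ((splitLattice N l g ∩ regionOmega splitBasis δ T).ncard : ℝ) ≤
        C * ((N : ℝ) * (1 + T)) ^ ε *
          (1 + ((l : ℝ) ^ (1 / 2 : ℝ) + l * δ ^ (1 / 2 : ℝ) * height N g) * T
            + ((l : ℝ) ^ (3 / 2 : ℝ) * δ ^ (1 / 2 : ℝ) / (N : ℝ) ^ (1 / 2 : ℝ)
                + l * δ * height N g) * T ^ 2
            + (l : ℝ) ^ 2 * δ / N * T ^ 3)) ∧
    -- the non-split case: first successive minima for `Ω` and `Ψ`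
    (∃ κ : ℝ, 0 < κ ∧ ∀ (B : Type*) [Ring B] [Algebra ℚ B] [Algebra.IsCentral ℚ B]
        [IsSimpleRing B],
      Module.finrank ℚ B = 4 → IsEmpty (B ≃ₐ[ℚ] Matrix (Fin 2) (Fin 2) ℚ) →
      ∀ (R : Subring B) (N l : ℕ) (s : ℝ)
        (q : QuaternionAlgebra.Basis (ℝ ⊗[ℚ] B) (-1 : ℝ) 0 s) (g : (ℝ ⊗[ℚ] B)ˣ) (δ : ℝ),
      IsEichlerOrder R N → Squarefree N → l ∣ redDisc B * N → (s = 1 ∨ s = -1) →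
      0 < δ → δ ≤ 1 →
      κ * (l : ℝ) ^ (-(1 / 2) : ℝ) ≤
          succMin (regionOmega q δ 1 ∩ traceZero (ℝ ⊗[ℚ] B)) (realLattice R l g) 1 ∧
      κ * (l : ℝ) ^ (-(1 / 2) : ℝ) ≤
          succMin (regionPsi q δ 1 ∩ traceZero (ℝ ⊗[ℚ] B)) (realLattice R l g) 1) ∧
    -- the non-split case: lattice point counts for `Ω` and `Ψ`
    (∀ ε : ℝ, 0 < ε → ∃ C : ℝ, 0 < C ∧ ∀ (B : Type*) [Ring B] [Algebra ℚ B]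
        [Algebra.IsCentral ℚ B] [IsSimpleRing B],
      Module.finrank ℚ B = 4 → IsEmpty (B ≃ₐ[ℚ] Matrix (Fin 2) (Fin 2) ℚ) →
      ∀ (R : Subring B) (N l : ℕ) (s : ℝ)
        (q : QuaternionAlgebra.Basis (ℝ ⊗[ℚ] B) (-1 : ℝ) 0 s) (g : (ℝ ⊗[ℚ] B)ˣ) (δ T : ℝ),
      IsEichlerOrder R N → Squarefree N → l ∣ redDisc B * N → (s = 1 ∨ s = -1) →
      0 < δ → δ ≤ 1 → 0 < T →
      ((realLattice R l g ∩ regionOmega q δ T).Finite ∧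
        ((realLattice R l g ∩ regionOmega q δ T).ncard : ℝ) ≤
          C * (((redDisc B * N : ℕ) : ℝ) * (1 + T)) ^ ε *
            (1 + (l : ℝ) ^ (1 / 2 : ℝ) * T
              + (l : ℝ) ^ (3 / 2 : ℝ) * δ ^ (1 / 2 : ℝ)
                  / ((redDisc B * N : ℕ) : ℝ) ^ (1 / 2 : ℝ) * T ^ 2
              + (l : ℝ) ^ 2 * δ / ((redDisc B * N : ℕ) : ℝ) * T ^ 3)) ∧
      ((realLattice R l g ∩ regionPsi q δ T).Finite ∧
        ((realLattice R l g ∩ regionPsi q δ T).ncard : ℝ) ≤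
          C * (((redDisc B * N : ℕ) : ℝ) * (1 + T)) ^ ε *
            (1 + (l : ℝ) ^ (1 / 2 : ℝ) * T
              + (l : ℝ) ^ (3 / 2 : ℝ) / ((redDisc B * N : ℕ) : ℝ) ^ (1 / 2 : ℝ) * T ^ 2
              + (l : ℝ) ^ 2 * δ ^ (1 / 2 : ℝ) / ((redDisc B * N : ℕ) : ℝ) * T ^ 3))) := by
  refine ⟨⟨1 / 4, by norm_num, ?_⟩, fun ε hε => ⟨2688, by norm_num, ?_⟩, ⟨1 / 4, by norm_num, ?_⟩,
    fun ε hε => ⟨6144, by norm_num, ?_⟩⟩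
  · intro N l g δ hN hl hδ hδ1
    have h4 : Module.finrank ℝ (Matrix (Fin 2) (Fin 2) ℝ) = 4 := by simp [Module.finrank_matrix]
    have hs : (1 : ℝ) = 1 ∨ (1 : ℝ) = -1 := Or.inl rfl
    have hd := Real.sqrt_pos.mpr hδ
    have hH := height_pos N g
    have hl0 : (0 : ℝ) < l := by
      exact_mod_cast Nat.pos_of_ne_zero fun h => hN.ne_zero (Nat.eq_zero_of_zero_dvd (h ▸ hl))
    have hs1 := Real.sqrt_pos.mpr hl0
    refine le_trans ?_ (le_succMin (f := scaledCoords splitBasis 1 (Real.sqrt δ))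
      (fun x hx =>
        norm_scaledCoords_le_of_mem_regionOmega splitBasis h4 hs hδ zero_le_one hx.1 hx.2)
      (fun x hx => ?_) (exists_ne_zero_mem_splitLattice N l g)
      (splitLattice_bounds hN hl g hd (Real.sqrt_le_one.mpr hδ1)).1)
    · rw [rpow_neg_half _ hl0.le, rpow_neg_half _ hδ.le]
      refine le_min ?_ ?_
      · refine (mul_le_mul_of_nonneg_left (min_le_left _ _) (by norm_num)).trans_eq ?_
        field_simp
      · refine (mul_le_mul_of_nonneg_left (min_le_right _ _) (by norm_num)).trans ?_
        rw [show (1 / 4 : ℝ) * ((l : ℝ)⁻¹ * (Real.sqrt δ)⁻¹ * (height N g)⁻¹)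
          = 1 / (4 * (l * Real.sqrt δ * height N g)) by field_simp]
        gcongr
        norm_num
    · obtain ⟨t, ht, h, -⟩ := exists_mem_smul_regions splitBasis h4 hs hδ hδ1
        (redTrace_of_mem_splitLattice hN hl hx)
      exact ⟨t, ht, h⟩
  · intro N l g δ T hN hl hδ hδ1 hT
    have h4 : Module.finrank ℝ (Matrix (Fin 2) (Fin 2) ℝ) = 4 := by simp [Module.finrank_matrix]
    have hs : (1 : ℝ) = 1 ∨ (1 : ℝ) = -1 := Or.inl rfl
    have hH := height_pos N g
    obtain ⟨hfin, hcard⟩ := (splitLattice_bounds hN hl g (Real.sqrt_pos.mpr hδ)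
      (Real.sqrt_le_one.mpr hδ1)).2 T (splitLattice N l g ∩ regionOmega splitBasis δ T) hT
      Set.inter_subset_left fun x hx => norm_scaledCoords_le_of_mem_regionOmega splitBasis h4 hs hδ
        hT.le hx.2 (redTrace_of_mem_splitLattice hN hl hx.1)
    refine ⟨hfin, le_mul_rpow_mul (by exact_mod_cast Nat.pos_of_ne_zero hN.ne_zero) hT hε
      (by norm_num) (by positivity) (hcard.trans_eq ?_)⟩
    rw [sqrt_pow_three _ (Nat.cast_nonneg l), Real.sq_sqrt hδ.le]
    simp only [Real.sqrt_eq_rpow]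
  · intro B _ _ _ _ h4 hM R N l s q g δ hR hN hl hs hδ hδ1
    have hB : ∀ x : B, x ≠ 0 → IsUnit x := fun x hx => isUnit_of_ne_zero_of_isEmpty_matrix h4 hM hx
    have : Module.Finite ℚ B := Module.finite_of_finrank_pos (by omega)
    have h4' : Module.finrank ℝ (ℝ ⊗[ℚ] B) = 4 := by rw [Module.finrank_baseChange, h4]
    have hd := Real.sqrt_pos.mpr hδ
    have hd1 := Real.sqrt_le_one.mpr hδ1
    have hκ : 1 / 4 * (l : ℝ) ^ (-(1 / 2) : ℝ) = 1 / (4 * Real.sqrt l) := by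
      rw [rpow_neg_half _ (Nat.cast_nonneg l), one_div, one_div, mul_inv]
    have hne := exists_ne_zero_mem_realLattice h4 hB hR.isOrder l g
    have hmem := fun x (hx : x ∈ realLattice R l g) =>
      exists_mem_smul_regions q h4' hs hδ hδ1 (redTrace_of_mem_realLattice hx)
    rw [hκ]
    constructor
    · exact le_succMin (f := scaledCoords q 1 (Real.sqrt δ))
        (fun x hx => norm_scaledCoords_le_of_mem_regionOmega q h4' hs hδ zero_le_one hx.1 hx.2)
        (fun x hx => (hmem x hx).imp fun t h => ⟨h.1, h.2.1⟩) hne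
        (realLattice_bounds h4 hB q g hR hN hl hs one_pos le_rfl hd hd1).1
    · exact le_succMin (f := scaledCoords q (Real.sqrt δ) 1)
        (fun x hx => norm_scaledCoords_le_of_mem_regionPsi q h4' hs hδ zero_le_one hx.1 hx.2)
        (fun x hx => (hmem x hx).imp fun t h => ⟨h.1, h.2.2⟩) hne
        (realLattice_bounds h4 hB q g hR hN hl hs hd hd1 one_pos le_rfl).1
  · intro B _ _ _ _ h4 hM R N l s q g δ T hR hN hl hs hδ hδ1 hT
    have hB : ∀ x : B, x ≠ 0 → IsUnit x := fun x hx => isUnit_of_ne_zero_of_isEmpty_matrix h4 hM hx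
    have : Module.Finite ℚ B := Module.finite_of_finrank_pos (by omega)
    have h4' : Module.finrank ℝ (ℝ ⊗[ℚ] B) = 4 := by rw [Module.finrank_baseChange, h4]
    have hd := Real.sqrt_pos.mpr hδ
    have hd1 := Real.sqrt_le_one.mpr hδ1
    have hD : (1 : ℝ) ≤ (redDisc B * N : ℕ) := by
      exact_mod_cast Nat.pos_of_ne_zero (hR.squarefree hN).ne_zero
    constructor
    · obtain ⟨hfin, hcard⟩ := (realLattice_bounds h4 hB q g hR hN hl hs one_pos le_rfl hd hd1).2 T
        (realLattice R l g ∩ regionOmega q δ T) hT Set.inter_subset_left fun x hx =>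
          norm_scaledCoords_le_of_mem_regionOmega q h4' hs hδ hT.le hx.2
            (redTrace_of_mem_realLattice hx.1)
      refine ⟨hfin, le_mul_rpow_mul hD hT hε (by norm_num) (by positivity) (hcard.trans_eq ?_)⟩
      rw [sqrt_pow_three _ (Nat.cast_nonneg l), Real.sq_sqrt hδ.le, one_mul]
      simp only [Real.sqrt_eq_rpow]
    · obtain ⟨hfin, hcard⟩ := (realLattice_bounds h4 hB q g hR hN hl hs hd hd1 one_pos le_rfl).2 T
        (realLattice R l g ∩ regionPsi q δ T) hT Set.inter_subset_left fun x hx =>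
          norm_scaledCoords_le_of_mem_regionPsi q h4' hs hδ hT.le hx.2
            (redTrace_of_mem_realLattice hx.1)
      refine ⟨hfin, le_mul_rpow_mul hD hT hε (by norm_num) (by positivity) (hcard.trans_eq ?_)⟩
      rw [sqrt_pow_three _ (Nat.cast_nonneg l), one_pow, mul_one, mul_one]
      simp only [Real.sqrt_eq_rpow]
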